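/- Let $\mu\ge 0$ and let $\Lambda_\mu=\mathbb{Z}[t_1^{\pm1},\ldots,t_\mu^{\pm1}]=\mathbb{Z}[\mathbb{Z}^\mu]$. For a finitely generated $\Lambda_\mu$-module $M$ and $k\ge 0$, the $k$-th Alexander polynomial $\Delta_k(M)\in\Lambda_\mu$, defined up to multiplication by a unit, is a greatest common divisor of the $(n-k)\times(n-k)$ minors of an $m\times n$ presentation matrix $P$ of $M$ (that is, $\Lambda_\mu^m\xrightarrow{P}\Lambda_\mu^n\to M\to 0$ is exact) with $n>k$ and $m\ge n-k$. Let $tM$ denote the $\Lambda_\mu$-torsion submodule of $M$. Let $X$ be a finite connected CW complex with an epimorphism $\gamma\colon\pi_1(X)\to\mathbb{Z}^\mu$, and let $X_0$ be a subcomplex of $X$. Let $H_*(X,X_0;\Lambda_\mu)$ be the singular homology with local coefficients induced by $\gamma$, where $g\in\pi_1(X)$ acts on $\Lambda_\mu=\mathbb{Z}[\mathbb{Z}^\mu]$ by multiplication by $\gamma(g)$ (equivalently, the homology of the $\mathbb{Z}^\mu$-cover of $X$ relative to the preimage of $X_0$). Let $k,l\ge 0$ be such that $$H_k(X,X_0;\mathbb{Z})\cong\mathbb{Z}^l\quad\text{and}\quad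 \operatorname{rank}_{\Lambda_\mu}H_k(X,X_0;\Lambda_\mu)=l .$$ Then the $l$-th Alexander polynomial of $H_k(X,X_0;\Lambda_\mu)$ exists, it is equal, up to units of $\Lambda_\mu$, to the $0$-th Alexander polynomial of the torsion submodule, $$A=\Delta_l\big(H_k(X,X_0;\Lambda_\mu)\big)=\Delta_0\big(tH_k(X,X_0;\Lambda_\mu)\big),$$ and it satisfies $|A(1,\ldots,1)|=1$. -/

import Mathlib

open Topology

/-! ## Singular simplices -/

/-- A singular `n`-simplex of `X`: a continuous map from the standard `n`-simplex to `X`. -/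
abbrev SingularSimplex (X : Type*) [TopologicalSpace X] (n : ℕ) : Type _ :=
  C(stdSimplex ℝ (Fin (n + 1)), X)

namespace SingularSimplex

variable {X : Type*} [TopologicalSpace X]

/-- The affine map of standard simplices induced by a map `f` of vertices. -/
noncomputable def stdMap {m n : ℕ} (f : Fin (m + 1) → Fin (n + 1)) :
    C(stdSimplex ℝ (Fin (m + 1)), stdSimplex ℝ (Fin (n + 1))) :=
  ⟨stdSimplex.map f, stdSimplex.continuous_map f⟩

/-- The `i`-th face of a singular simplex, opposite to the vertex `i`. -/
noncomputable def face {n : ℕ} (i : Fin (n + 2)) (σ : SingularSimplex X (n + 1)) :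
    SingularSimplex X n :=
  σ.comp (stdMap i.succAbove)

/-- The `i`-th vertex of a singular simplex. -/
noncomputable def vert {n : ℕ} (i : Fin (n + 1)) (σ : SingularSimplex X n) : X :=
  σ (stdSimplex.vertex i)

/-- The path along which a singular simplex runs on the straight edge from its vertex `0` to its
vertex `1`. -/
noncomputable def edge {n : ℕ} (σ : SingularSimplex X (n + 1)) : Path (σ.vert 0) (σ.vert 1) where
  toFun t := σ (stdMap (m := 1) ![0, 1] (stdSimplexHomeomorphUnitInterval.symm t))
  continuous_toFun := by fun_prop
  source' := by
    have h : stdSimplexHomeomorphUnitInterval.symm 0 = stdSimplex.vertex (S := ℝ) (0 : Fin 2) :=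
      stdSimplexHomeomorphUnitInterval.symm_apply_eq.2 rfl
    rw [h]
    exact congrArg σ (stdSimplex.map_vertex _ _)
  target' := by
    have h : stdSimplexHomeomorphUnitInterval.symm 1 = stdSimplex.vertex (S := ℝ) (1 : Fin 2) :=
      stdSimplexHomeomorphUnitInterval.symm_apply_eq.2 rfl
    rw [h]
    exact congrArg σ (stdSimplex.map_vertex _ _)

end SingularSimplex

/-! ## Subquotients of modules -/

section Subquotient

variable {R M : Type*} [CommRing R] [AddCommGroup M] [Module R M]

/-- The subquotient `Z / (B ∩ Z)` of a module; it is the usual `Z / B` when `B ≤ Z`. -/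
def Subquotient (Z B : Submodule R M) : Type _ := Z ⧸ B.submoduleOf Z

noncomputable instance (Z B : Submodule R M) : AddCommGroup (Subquotient Z B) :=
  inferInstanceAs (AddCommGroup (Z ⧸ B.submoduleOf Z))

noncomputable instance (Z B : Submodule R M) : Module R (Subquotient Z B) :=
  inferInstanceAs (Module R (Z ⧸ B.submoduleOf Z))

end Subquotient

/-! ## Singular homology of a pair with coefficients in a rank one local system -/

section LocalCoefficients

variable {X : Type*} [TopologicalSpace X] {x₀ : X} {R : Type*} [CommRing R]

open Classical in
/-- The monodromy along a path `p` from `a` to `b` of the local system of free `R`-modules of rank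
one given by `ρ : π₁(X, x₀) → R`. The fibre over a point `a` of the path component of `x₀` is
identified with `R` by a path `τ_a` from `x₀` to `a`, chosen once and for all; then the monodromy
along `p` is `ρ [τ_a · p · τ_b⁻¹]`. (Other path components play no role.) -/
noncomputable def monodromy (ρ : FundamentalGroup X x₀ →* R) {a b : X} (p : Path a b) : R :=
  if h : Joined x₀ a then
    ρ (FundamentalGroup.fromPath (Path.Homotopic.Quotient.mk
      ((h.somePath.trans p).trans (h.trans ⟨p⟩).somePath.symm)))
  else 1

/-- Singular `n`-chains with local coefficients: finite sums `∑ r_σ σ`, where the coefficient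
`r_σ` lies in the fibre over the vertex `0` of `σ`. -/
abbrev SingularChain (X : Type*) [TopologicalSpace X] (R : Type*) [CommRing R] (n : ℕ) : Type _ :=
  SingularSimplex X n →₀ R

/-- The boundary operator with local coefficients,
`∂ σ = ρ(edge of σ from vertex 0 to vertex 1) • ∂₀ σ + ∑_{i ≥ 1} (-1)ⁱ • ∂ᵢ σ`;
the `0`-th face is the only one whose vertex `0` is not the vertex `0` of `σ`. -/
noncomputable def singularBoundary (ρ : FundamentalGroup X x₀ →* R) (n : ℕ) :
    SingularChain X R (n + 1) →ₗ[R] SingularChain X R n :=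
  Finsupp.lift (SingularChain X R n) R (SingularSimplex X (n + 1)) fun σ ↦
    Finsupp.single (σ.face 0) (monodromy ρ σ.edge) +
      ∑ i : Fin (n + 1), Finsupp.single (σ.face i.succ) ((-1 : R) ^ ((i : ℕ) + 1))

/-- The chains of `X` that are carried by the subspace `A`. -/
noncomputable def chainsIn (R : Type*) [CommRing R] (A : Set X) (n : ℕ) :
    Submodule R (SingularChain X R n) :=
  Finsupp.supported R R {σ : SingularSimplex X n | Set.range σ ⊆ A}

/-- The relative cycles: chains of `X` whose boundary is carried by `A`. -/
noncomputable def relCycles (ρ : FundamentalGroup X x₀ →* R) (A : Set X) :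
    (n : ℕ) → Submodule R (SingularChain X R n)
  | 0 => ⊤
  | n + 1 => (chainsIn R A n).comap (singularBoundary ρ n)

/-- The relative boundaries: sums of a boundary and of a chain carried by `A`. -/
noncomputable def relBoundaries (ρ : FundamentalGroup X x₀ →* R) (A : Set X) (n : ℕ) :
    Submodule R (SingularChain X R n) :=
  LinearMap.range (singularBoundary ρ n) ⊔ chainsIn R A n

/-- The `n`-th singular homology `H_n(X, A; R_ρ)` of the pair `(X, A)` with coefficients in the
local system given by `ρ : π₁(X, x₀) → R`: relative cycles modulo relative boundaries. -/
abbrev LocalHomology (ρ : FundamentalGroup X x₀ →* R) (A : Set X) (n : ℕ) : Type _ :=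
  Subquotient (relCycles ρ A n) (relBoundaries ρ A n)

end LocalCoefficients

/-! ## The ring `Λ_μ` and the two kinds of coefficients -/

/-- The Laurent polynomial ring `Λ_μ = ℤ[t₁^±, …, t_μ^±] = ℤ[ℤ^μ]`. -/
abbrev LaurentRing (μ : ℕ) : Type := AddMonoidAlgebra ℤ (Fin μ → ℤ)

/-- The evaluation `f ↦ f(1, …, 1)` of Laurent polynomials. -/
noncomputable def LaurentRing.evalOne (μ : ℕ) : LaurentRing μ →ₐ[ℤ] ℤ :=
  AddMonoidAlgebra.lift ℤ ℤ (Fin μ → ℤ) 1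

section Coefficients

variable {X : Type*} [TopologicalSpace X]

/-- Ordinary relative singular homology `H_n(X, A; ℤ)`: the local system is trivial, with all
monodromies equal to `1`. (The base point is irrelevant.) -/
abbrev IntegralHomology (x₀ : X) (A : Set X) (n : ℕ) : Type _ :=
  LocalHomology (1 : FundamentalGroup X x₀ →* ℤ) A n

/-- `H_n(X, A; Λ_μ)` for `γ : π₁(X, x₀) → ℤ^μ`: an element `g` of `π₁(X, x₀)` acts on
`Λ_μ = ℤ[ℤ^μ]` as multiplication by the monomial `t^γ(g)`. -/
abbrev LaurentHomology {x₀ : X} {μ : ℕ}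
    (γ : FundamentalGroup X x₀ →* Multiplicative (Fin μ → ℤ)) (A : Set X) (n : ℕ) : Type _ :=
  LocalHomology ((AddMonoidAlgebra.of ℤ (Fin μ → ℤ)).comp γ) A n

end Coefficients

/-! ## Alexander polynomials of modules -/

section AlexanderPolynomial

variable {R : Type*} [CommRing R]

/-- The `m × n` matrix `P` is a presentation matrix of the module `M`: there is an exact sequence
`R^m → R^n → M → 0` whose first map is given by `P` (the rows of `P` are the relations). -/
def IsPresentationMatrix {m n : ℕ} (P : Matrix (Fin m) (Fin n) R)
    (M : Type*) [AddCommGroup M] [Module R M] : Prop :=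
  ∃ π : (Fin n → R) →ₗ[R] M, Function.Exact P.vecMulLinear π ∧ Function.Surjective π

/-- `d` is a minor of size `j × j` of the matrix `P`. -/
def IsMinor {m n : ℕ} (P : Matrix (Fin m) (Fin n) R) (j : ℕ) (d : R) : Prop :=
  ∃ (r : Fin j ↪o Fin m) (c : Fin j ↪o Fin n), d = (P.submatrix r c).det

/-- `A` is a `k`-th Alexander polynomial `Δ_k(M)` of the module `M`: there is an `m × n`
presentation matrix `P` of `M` with `n > k` and `m ≥ n - k` such that `A` is a greatest common
divisor of the minors of size `n - k` of `P`. (`Δ_k(M)` is defined up to units only.) -/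
def IsAlexanderPolynomial (k : ℕ) (M : Type*) [AddCommGroup M] [Module R M] (A : R) : Prop :=
  ∃ (m n : ℕ) (P : Matrix (Fin m) (Fin n) R),
    k < n ∧ n - k ≤ m ∧ IsPresentationMatrix P M ∧
      (∀ d, IsMinor P (n - k) d → A ∣ d) ∧
      ∀ e : R, (∀ d, IsMinor P (n - k) d → e ∣ d) → e ∣ A

end AlexanderPolynomial

/-! Let `H` be the Laurent homology in degree `k` and `tH` its torsion submodule. The proof rests on
three facts.

Finiteness: `H` is a finitely generated module over the Noetherian ring `Λ_μ`. For singular homology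
with twisted coefficients this is proved by attaching one cell at a time, from homotopy invariance,
barycentric subdivision and a Mayer-Vietoris argument (`FinHom.of_homotopy`, `FinHom.of_cover`,
`FinHom.attach`, `localHomology_finite_of_subcomplex`). The operators on twisted chains are pushed
forward from ordered chains on the points of a simplex, where all identities follow from the
boundary formula for cones.

Specialization: putting the first variable `t` equal to `1` maps the chains over `Λ_(μ+1)` onto
those over `Λ_μ`, with kernel the multiples of `t - 1`. Hence `H / (t - 1)H` embeds in the homology
`H'` over `Λ_μ` (`exists_homologyMap`). By Cayley-Hamilton (`exists_annihilator_of_smul_eq`), if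
`rank H' ≤ l` then `rank H ≤ l`; and if moreover `rank H = l` and `s'` kills `tH'`, then `tH` is
killed by an element that specializes to a power of `s'`. Induction on `μ`, starting from the free
group over `Λ_0 = ℤ`, gives an `s` that kills `tH` and satisfies `s(1, …, 1) = 1`
(`laurentHomology_rank_le_and_annihilator`).

Alexander polynomials: the ideal of minors of given corank depends only on the module and not on the
presentation (`minorIdeal_ker_eq`), and a free summand only shifts the index. In the factorial ring
`Λ_μ` divisibility can be tested after localizing at principal primes
(`dvd_of_forall_localization`). There the ring is a principal ideal domain and `H` splits as `tH`
plus a free module of rank `l`, so the minors defining `Δ_l(H)` and `Δ_0(tH)` have the same common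
divisors.

Finally, as `s` kills `tH`, the power `s ^ n` lies in the ideal of maximal minors of a presentation
of `tH` with `n` generators. So `A` divides `s ^ n`, and `A(1, …, 1)` divides `1`. -/

/-! ## Ordered chains -/

section OrderedChains

variable {R : Type*} [CommRing R] {V W : Type*}

/-- The ordered chains on a type `V` of vertices: formal combinations of `n`-tuples of vertices.
The empty tuple is allowed, so that this is an augmented complex. -/
abbrev OrdChain (R : Type*) [CommRing R] (V : Type*) (n : ℕ) : Type _ := (Fin n → V) →₀ R

namespace OrdChain

/-- The boundary operator of ordered chains. -/
noncomputable def d (R : Type*) [CommRing R] (V : Type*) (n : ℕ) :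
    OrdChain R V (n + 1) →ₗ[R] OrdChain R V n :=
  Finsupp.lift (OrdChain R V n) R (Fin (n + 1) → V) fun v ↦
    ∑ i : Fin (n + 1), Finsupp.single (v ∘ i.succAbove) ((-1 : R) ^ (i : ℕ))

/-- The cone operator with apex `b`. -/
noncomputable def cone (b : V) (n : ℕ) : OrdChain R V n →ₗ[R] OrdChain R V (n + 1) :=
  Finsupp.lmapDomain R R fun v ↦ (Fin.cons b v : Fin (n + 1) → V)

/-- The map of ordered chains induced by a map of vertices. -/
noncomputable def map (f : V → W) (n : ℕ) : OrdChain R V n →ₗ[R] OrdChain R W n :=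
  Finsupp.lmapDomain R R (f ∘ ·)

lemma d_single (n : ℕ) (v : Fin (n + 1) → V) : d R V n (Finsupp.single v 1) =
    ∑ i : Fin (n + 1), Finsupp.single (v ∘ i.succAbove) ((-1 : R) ^ (i : ℕ)) := by
  simp [d]

lemma cone_single (b : V) (n : ℕ) (v : Fin n → V) (r : R) :
    cone b n (Finsupp.single v r) = Finsupp.single (Fin.cons b v : Fin (n + 1) → V) r := by
  simp [cone]

lemma map_single (f : V → W) (n : ℕ) (v : Fin n → V) (r : R) :
    map f n (Finsupp.single v r) = Finsupp.single (f ∘ v) r := by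
  simp [map]

lemma hom_ext {n : ℕ} {N : Type*} [AddCommGroup N] [Module R N] {f g : OrdChain R V n →ₗ[R] N}
    (h : ∀ v, f (Finsupp.single v 1) = g (Finsupp.single v 1)) : f = g :=
  Finsupp.lhom_ext' fun v ↦ LinearMap.ext_ring (h v)

lemma map_d (f : V → W) (n : ℕ) (c : OrdChain R V (n + 1)) :
    map f n (d R V n c) = d R W n (map f (n + 1) c) := by
  suffices h : (map f n).comp (d R V n) = (d R W n).comp (map f (n + 1)) from
    LinearMap.congr_fun h c
  refine hom_ext fun v ↦ ?_
  simp [d_single, map_single, Function.comp_assoc]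

lemma map_cone (f : V → W) (b : V) (n : ℕ) (c : OrdChain R V n) :
    map f (n + 1) (cone b n c) = cone (f b) n (map f n c) := by
  suffices h : (map f (n + 1)).comp (cone b n) = (cone (R := R) (f b) n).comp (map f n) from
    LinearMap.congr_fun h c
  refine hom_ext fun v ↦ ?_
  simp only [LinearMap.comp_apply, cone_single, map_single]
  congr 1
  funext i
  refine Fin.cases ?_ (fun j ↦ ?_) i <;> simp

lemma d_cone_zero (b : V) (c : OrdChain R V 0) : d R V 0 (cone b 0 c) = c := by
  suffices h : (d R V 0).comp (cone b 0) = LinearMap.id from LinearMap.congr_fun h c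
  refine hom_ext fun v ↦ ?_
  simp only [LinearMap.comp_apply, cone_single, d_single, LinearMap.id_apply]
  rw [Fin.sum_univ_one, Fin.val_zero, pow_zero]
  congr 1

/-- Deleting the apex gives the chain back; deleting any other vertex commutes with coning, up to a
sign. The identities for `d`, `sd`, `sdHomotopy` and `prism` all come from this formula by induction
on the degree. -/
lemma d_cone (b : V) (n : ℕ) (c : OrdChain R V (n + 1)) :
    d R V (n + 1) (cone b (n + 1) c) = c - cone b n (d R V n c) := by
  suffices h : (d R V (n + 1)).comp (cone b (n + 1)) =
      LinearMap.id - (cone b n).comp (d R V n) from LinearMap.congr_fun h c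
  refine hom_ext fun v ↦ ?_
  simp only [LinearMap.comp_apply, cone_single, d_single, LinearMap.sub_apply, LinearMap.id_apply]
  rw [Fin.sum_univ_succ, map_sum, sub_eq_add_neg, ← Finset.sum_neg_distrib]
  congr 1
  · simp only [Fin.val_zero, pow_zero]
    congr 1
  · refine Finset.sum_congr rfl fun i _ ↦ ?_
    rw [cone_single, ← Finsupp.single_neg, Fin.val_succ, pow_succ]
    congr 1
    · funext j
      refine Fin.cases ?_ (fun j ↦ ?_) j <;> simp [Fin.succ_succAbove_succ]
    · ring

lemma single_eq_cone (n : ℕ) (v : Fin (n + 1) → V) :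
    (Finsupp.single v 1 : OrdChain R V (n + 1)) =
      cone (v 0) n (Finsupp.single (Fin.tail v) 1) := by
  rw [cone_single, Fin.cons_self_tail]

/-- A simplex is the cone over its tail from its own first vertex, so `d_cone` and induction apply.
-/
lemma d_d (n : ℕ) (c : OrdChain R V (n + 2)) : d R V n (d R V (n + 1) c) = 0 := by
  induction n with
  | zero =>
    suffices h : (d R V 0).comp (d R V 1) = 0 from LinearMap.congr_fun h c
    refine hom_ext fun v ↦ ?_
    rw [LinearMap.comp_apply, single_eq_cone, d_cone, map_sub, d_cone_zero, sub_self]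
    rfl
  | succ n ih =>
    suffices h : (d R V (n + 1)).comp (d R V (n + 2)) = 0 from LinearMap.congr_fun h c
    refine hom_ext fun v ↦ ?_
    rw [LinearMap.comp_apply, single_eq_cone, d_cone, map_sub, d_cone, ih, map_zero, sub_zero,
      sub_self]
    rfl

/-- The subdivision operator attached to a choice `β` of "barycenters". -/
noncomputable def sd (R : Type*) [CommRing R] (β : ∀ n, (Fin (n + 1) → V) → V) :
    (n : ℕ) → OrdChain R V n →ₗ[R] OrdChain R V n
  | 0 => LinearMap.id
  | n + 1 => Finsupp.lift (OrdChain R V (n + 1)) R (Fin (n + 1) → V) fun v ↦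
      cone (β n v) n (sd R β n (d R V n (Finsupp.single v 1)))

/-- The chain homotopy between the identity and the subdivision operator. -/
noncomputable def sdHomotopy (R : Type*) [CommRing R] (β : ∀ n, (Fin (n + 1) → V) → V) :
    (n : ℕ) → OrdChain R V n →ₗ[R] OrdChain R V (n + 1)
  | 0 => 0
  | n + 1 => Finsupp.lift (OrdChain R V (n + 2)) R (Fin (n + 1) → V) fun v ↦
      cone (β n v) (n + 1) (Finsupp.single v 1 - sdHomotopy R β n (d R V n (Finsupp.single v 1)))

variable {β : ∀ n, (Fin (n + 1) → V) → V}

lemma sd_single (n : ℕ) (v : Fin (n + 1) → V) : sd R β (n + 1) (Finsupp.single v 1) =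
    cone (β n v) n (sd R β n (d R V n (Finsupp.single v 1))) := by
  simp [sd]

lemma sdHomotopy_single (n : ℕ) (v : Fin (n + 1) → V) :
    sdHomotopy R β (n + 1) (Finsupp.single v 1) =
      cone (β n v) (n + 1)
        (Finsupp.single v 1 - sdHomotopy R β n (d R V n (Finsupp.single v 1))) := by
  simp [sdHomotopy]

/-- The subdivided boundary is a cycle by induction, so coning it off yields a chain with exactly
that boundary. Nothing is needed about the apices `β`. -/
lemma d_sd (n : ℕ) (c : OrdChain R V (n + 1)) :
    d R V n (sd R β (n + 1) c) = sd R β n (d R V n c) := by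
  induction n with
  | zero =>
    suffices h : (d R V 0).comp (sd R β 1) = (sd R β 0).comp (d R V 0) from LinearMap.congr_fun h c
    refine hom_ext fun v ↦ ?_
    rw [LinearMap.comp_apply, sd_single, d_cone_zero, LinearMap.comp_apply]
  | succ n ih =>
    suffices h : (d R V (n + 1)).comp (sd R β (n + 2)) = (sd R β (n + 1)).comp (d R V (n + 1)) from
      LinearMap.congr_fun h c
    refine hom_ext fun v ↦ ?_
    rw [LinearMap.comp_apply, sd_single, d_cone, ih, d_d, map_zero, map_zero, sub_zero,
      LinearMap.comp_apply]

lemma d_sdHomotopy (n : ℕ) (c : OrdChain R V (n + 1)) :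
    d R V (n + 1) (sdHomotopy R β (n + 1) c) =
      c - sd R β (n + 1) c - sdHomotopy R β n (d R V n c) := by
  induction n with
  | zero =>
    suffices h : (d R V 1).comp (sdHomotopy R β 1) =
        LinearMap.id - sd R β 1 - (sdHomotopy R β 0).comp (d R V 0) from LinearMap.congr_fun h c
    refine hom_ext fun v ↦ ?_
    simp only [LinearMap.comp_apply, LinearMap.sub_apply, LinearMap.id_apply]
    rw [sdHomotopy_single, sd_single, d_cone]
    simp [sdHomotopy, sd]
  | succ n ih =>
    suffices h : (d R V (n + 2)).comp (sdHomotopy R β (n + 2)) =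
        LinearMap.id - sd R β (n + 2) - (sdHomotopy R β (n + 1)).comp (d R V (n + 1)) from
      LinearMap.congr_fun h c
    refine hom_ext fun v ↦ ?_
    simp only [LinearMap.comp_apply, LinearMap.sub_apply, LinearMap.id_apply]
    rw [sdHomotopy_single, sd_single, d_cone, map_sub, ih, d_d]
    simp only [map_zero, sub_zero, sub_sub_cancel]
    abel

variable {β' : ∀ n, (Fin (n + 1) → W) → W}

/-- Naturality for maps that respect the chosen apices. Affine maps of simplices respect
barycenters, so subdivision descends to singular chains. -/
lemma map_sd {f : V → W} (hf : ∀ n v, f (β n v) = β' n (f ∘ v)) (n : ℕ) (c : OrdChain R V n) :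
    map f n (sd R β n c) = sd R β' n (map f n c) := by
  induction n with
  | zero => rfl
  | succ n ih =>
    suffices h : (map f (n + 1)).comp (sd R β (n + 1)) = (sd R β' (n + 1)).comp (map f (n + 1)) from
      LinearMap.congr_fun h c
    refine hom_ext fun v ↦ ?_
    simp only [LinearMap.comp_apply]
    rw [sd_single, map_cone, ih, map_d, hf, map_single, sd_single]

lemma map_sdHomotopy {f : V → W} (hf : ∀ n v, f (β n v) = β' n (f ∘ v)) (n : ℕ)
    (c : OrdChain R V n) :
    map f (n + 1) (sdHomotopy R β n c) = sdHomotopy R β' n (map f n c) := by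
  induction n with
  | zero => simp [sdHomotopy]
  | succ n ih =>
    suffices h : (map f (n + 2)).comp (sdHomotopy R β (n + 1)) =
        (sdHomotopy R β' (n + 1)).comp (map f (n + 1)) from LinearMap.congr_fun h c
    refine hom_ext fun v ↦ ?_
    simp only [LinearMap.comp_apply]
    rw [sdHomotopy_single, map_cone, map_sub, ih, map_d, hf, map_single, sdHomotopy_single]

/-- The prism operator from ordered chains on `V` to ordered chains on the two copies
`V × Fin 2` of `V`. -/
noncomputable def prism (R : Type*) [CommRing R] (V : Type*) :
    (n : ℕ) → OrdChain R V n →ₗ[R] OrdChain R (V × Fin 2) (n + 1)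
  | 0 => 0
  | n + 1 => Finsupp.lift (OrdChain R (V × Fin 2) (n + 2)) R (Fin (n + 1) → V) fun v ↦
      -- The chain in parentheses is the required boundary of the prism. It is a cycle, hence the
      -- boundary of its cone from any vertex; the bottom copy of `v 0` is a natural choice.
      cone (v 0, 0) (n + 1) (map (·, 1) (n + 1) (Finsupp.single v 1) -
        map (·, 0) (n + 1) (Finsupp.single v 1) - prism R V n (d R V n (Finsupp.single v 1)))

lemma prism_single (n : ℕ) (v : Fin (n + 1) → V) :
    prism R V (n + 1) (Finsupp.single v 1) =
      cone (v 0, 0) (n + 1) (map (·, 1) (n + 1) (Finsupp.single v 1) -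
        map (·, 0) (n + 1) (Finsupp.single v 1) -
          prism R V n (d R V n (Finsupp.single v 1))) := by
  simp [prism]

lemma d_prism (n : ℕ) (c : OrdChain R V (n + 1)) :
    d R (V × Fin 2) (n + 1) (prism R V (n + 1) c) =
      map (·, 1) (n + 1) c - map (·, 0) (n + 1) c - prism R V n (d R V n c) := by
  induction n with
  | zero =>
    suffices h : (d R (V × Fin 2) 1).comp (prism R V 1) =
        map (·, 1) 1 - map (·, 0) 1 - (prism R V 0).comp (d R V 0) from LinearMap.congr_fun h c
    refine hom_ext fun v ↦ ?_
    simp only [LinearMap.comp_apply, LinearMap.sub_apply]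
    rw [prism_single, d_cone]
    simp only [prism, LinearMap.zero_apply, sub_zero, map_sub, ← map_d]
    -- In degree zero there is only the empty tuple, so the top and the bottom agree.
    have h0 : (map (·, 1) 0 : OrdChain R V 0 →ₗ[R] OrdChain R (V × Fin 2) 0) = map (·, 0) 0 :=
      hom_ext fun w ↦ by rw [map_single, map_single]; congr 1; exact Subsingleton.elim _ _
    rw [h0, sub_self, sub_zero]
  | succ n ih =>
    suffices h : (d R (V × Fin 2) (n + 2)).comp (prism R V (n + 2)) =
        map (·, 1) (n + 2) - map (·, 0) (n + 2) - (prism R V (n + 1)).comp (d R V (n + 1)) from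
      LinearMap.congr_fun h c
    refine hom_ext fun v ↦ ?_
    simp only [LinearMap.comp_apply, LinearMap.sub_apply]
    rw [prism_single, d_cone, map_sub, ih, d_d]
    simp only [map_zero, sub_zero, map_sub, map_d]
    abel

lemma map_prism (f : V → W) (n : ℕ) (c : OrdChain R V n) :
    map (Prod.map f id) (n + 1) (prism R V n c) = prism R W n (map f n c) := by
  induction n with
  | zero => simp [prism]
  | succ n ih =>
    suffices h : (map (Prod.map f id) (n + 2)).comp (prism R V (n + 1)) =
        (prism R W (n + 1)).comp (map f (n + 1)) from LinearMap.congr_fun h c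
    refine hom_ext fun v ↦ ?_
    simp only [LinearMap.comp_apply]
    rw [prism_single, map_cone, map_sub (map (R := R) (Prod.map f (id : Fin 2 → Fin 2)) (n + 1)),
      map_sub (map (R := R) (Prod.map f (id : Fin 2 → Fin 2)) (n + 1)), ih, map_d, map_single f, prism_single]
    simp only [map_single]
    rfl

end OrdChain

end OrderedChains

/-! ## Affine maps between standard simplices -/

section AffineMaps

variable {ι κ l : Type*} [Fintype ι] [Fintype κ] [Fintype l]

/-- The affine map of standard simplices with prescribed images of the vertices. -/
noncomputable def affineSimplex (v : κ → stdSimplex ℝ ι) : C(stdSimplex ℝ κ, stdSimplex ℝ ι) where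
  toFun x := ⟨∑ k, x k • (v k : ι → ℝ),
    (convex_stdSimplex ℝ ι).sum_mem (fun k _ ↦ x.2.1 k) x.2.2 fun k _ ↦ (v k).2⟩
  continuous_toFun := by
    refine Continuous.subtype_mk (continuous_finsetSum _ fun k _ ↦ ?_) _
    exact ((continuous_apply k).comp continuous_subtype_val).smul continuous_const

lemma affineSimplex_apply (v : κ → stdSimplex ℝ ι) (x : stdSimplex ℝ κ) (i : ι) :
    affineSimplex v x i = ∑ k, x k * v k i := by
  change (∑ k, x k • (v k : ι → ℝ)) i = _
  rw [Finset.sum_apply]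
  rfl

lemma affineSimplex_vertex [DecidableEq κ] (v : κ → stdSimplex ℝ ι) (k : κ) :
    affineSimplex v (stdSimplex.vertex k) = v k := by
  ext i
  rw [affineSimplex_apply, Finset.sum_eq_single k]
  · simp
  · intro j _ hj
    simp [hj]
  · simp

lemma affineSimplex_comp_affineSimplex (u : κ → stdSimplex ℝ ι) (v : l → stdSimplex ℝ κ) :
    (affineSimplex u).comp (affineSimplex v) = affineSimplex (affineSimplex u ∘ v) := by
  ext x i
  simp only [ContinuousMap.comp_apply]
  change affineSimplex u (affineSimplex v x) i = affineSimplex (affineSimplex u ∘ v) x i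
  simp only [affineSimplex_apply, Function.comp_apply, Finset.sum_mul, Finset.mul_sum]
  rw [Finset.sum_comm]
  exact Finset.sum_congr rfl fun _ _ ↦ Finset.sum_congr rfl fun _ _ ↦ by ring

lemma affineSimplex_vertex_eq_id [DecidableEq κ] :
    affineSimplex (stdSimplex.vertex : κ → stdSimplex ℝ κ) = ContinuousMap.id _ := by
  ext x i
  change affineSimplex stdSimplex.vertex x i = x i
  rw [affineSimplex_apply, Finset.sum_eq_single i]
  · simp
  · intro j _ hj
    simp [hj.symm]
  · simp

lemma map_eq_affineSimplex [DecidableEq ι] (f : κ → ι) (x : stdSimplex ℝ κ) :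
    stdSimplex.map f x = affineSimplex (stdSimplex.vertex ∘ f) x := by
  classical
  ext i
  rw [affineSimplex_apply, stdSimplex.map_coe, FunOnFinite.linearMap_apply_apply]
  simp only [Function.comp_apply, stdSimplex.vertex_coe, Finset.sum_filter]
  refine Finset.sum_congr rfl fun k _ ↦ ?_
  by_cases h : f k = i
  · simp [h]
  · simp [h, Ne.symm h]

lemma stdMap_eq_affineSimplex {m n : ℕ} (f : Fin (m + 1) → Fin (n + 1)) :
    SingularSimplex.stdMap f = affineSimplex (stdSimplex.vertex ∘ f) := by
  refine ContinuousMap.ext fun x ↦ ?_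
  exact map_eq_affineSimplex f x

lemma affineSimplex_comp_stdMap {m n : ℕ} (v : Fin (n + 1) → stdSimplex ℝ ι)
    (f : Fin (m + 1) → Fin (n + 1)) :
    (affineSimplex v).comp (SingularSimplex.stdMap f) = affineSimplex (v ∘ f) := by
  rw [stdMap_eq_affineSimplex, affineSimplex_comp_affineSimplex]
  congr 1
  funext i
  simp [affineSimplex_vertex]

lemma affineSimplex_const (a : stdSimplex ℝ ι) :
    affineSimplex (fun _ : κ ↦ a) = ContinuousMap.const _ a := by
  ext x i
  change affineSimplex (fun _ : κ ↦ a) x i = a i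
  rw [affineSimplex_apply, ← Finset.sum_mul, stdSimplex.sum_eq_one, one_mul]

end AffineMaps

/-! ## Singular chains with coefficients twisted by a multiplicative cocycle -/

/-- A multiplicative cocycle on the singular `1`-simplices of `X`, a combinatorial description of
a local system of rank one. -/
structure MulCocycle (X : Type*) [TopologicalSpace X] (R : Type*) [CommRing R] where
  /-- The weight of a `1`-simplex. -/
  weight : SingularSimplex X 1 → R
  weight_const (x : X) : weight (ContinuousMap.const _ x) = 1
  weight_mul (τ : SingularSimplex X 2) :
    weight (τ.comp (SingularSimplex.stdMap ![0, 1])) *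
      weight (τ.comp (SingularSimplex.stdMap ![1, 2])) =
        weight (τ.comp (SingularSimplex.stdMap ![0, 2]))

namespace MulCocycle

variable {X Y : Type*} [TopologicalSpace X] [TopologicalSpace Y] {R : Type*} [CommRing R]

/-- The pullback of a cocycle along a continuous map. -/
def comap (ω : MulCocycle X R) (f : C(Y, X)) : MulCocycle Y R where
  weight σ := ω.weight (f.comp σ)
  weight_const y := ω.weight_const (f y)
  weight_mul τ := ω.weight_mul (f.comp τ)

/-- The boundary operator with coefficients twisted by a cocycle. -/
noncomputable def bd (ω : MulCocycle X R) (n : ℕ) :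
    SingularChain X R (n + 1) →ₗ[R] SingularChain X R n :=
  Finsupp.lift (SingularChain X R n) R (SingularSimplex X (n + 1)) fun σ ↦
    Finsupp.single (σ.face 0) (ω.weight (σ.comp (SingularSimplex.stdMap ![0, 1]))) +
      ∑ i : Fin (n + 1), Finsupp.single (σ.face i.succ) ((-1 : R) ^ ((i : ℕ) + 1))

lemma bd_single (ω : MulCocycle X R) (n : ℕ) (σ : SingularSimplex X (n + 1)) (r : R) :
    ω.bd n (Finsupp.single σ r) = r •
    (Finsupp.single (σ.face 0) (ω.weight (σ.comp (SingularSimplex.stdMap ![0, 1]))) +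
      ∑ i : Fin (n + 1), Finsupp.single (σ.face i.succ) ((-1 : R) ^ ((i : ℕ) + 1))) := by
  simp [bd]

variable {ι κ : Type*} [Fintype ι] [Fintype κ]

/-- The weight of the image under `F` of the straight edge from `a` to `b`. -/
noncomputable def seg (ω : MulCocycle X R) (F : C(stdSimplex ℝ ι, X)) (a b : stdSimplex ℝ ι) : R :=
  ω.weight (F.comp (affineSimplex ![a, b]))

lemma seg_self (ω : MulCocycle X R) (F : C(stdSimplex ℝ ι, X)) (a : stdSimplex ℝ ι) :
    ω.seg F a a = 1 := by
  have h : ![a, a] = fun _ : Fin 2 ↦ a := by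
    funext i; fin_cases i <;> rfl
  rw [seg, h, affineSimplex_const]
  exact ω.weight_const (F a)

lemma seg_mul (ω : MulCocycle X R) (F : C(stdSimplex ℝ ι, X)) (a b c : stdSimplex ℝ ι) :
    ω.seg F a b * ω.seg F b c = ω.seg F a c := by
  have h := ω.weight_mul (F.comp (affineSimplex ![a, b, c]))
  simp only [ContinuousMap.comp_assoc, affineSimplex_comp_stdMap] at h
  have h1 : ![a, b, c] ∘ ![0, 1] = ![a, b] := by funext i; fin_cases i <;> rfl
  have h2 : ![a, b, c] ∘ ![1, 2] = ![b, c] := by funext i; fin_cases i <;> rfl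
  have h3 : ![a, b, c] ∘ ![0, 2] = ![a, c] := by funext i; fin_cases i <;> rfl
  rwa [h1, h2, h3] at h

lemma seg_comp (ω : MulCocycle X R) (F : C(stdSimplex ℝ κ, X)) (u : ι → stdSimplex ℝ κ)
    (a b : stdSimplex ℝ ι) :
    ω.seg (F.comp (affineSimplex u)) a b = ω.seg F (affineSimplex u a) (affineSimplex u b) := by
  rw [seg, seg, ContinuousMap.comp_assoc, affineSimplex_comp_affineSimplex]
  congr 3
  funext i
  fin_cases i <;> rfl

/-- The chain map from ordered chains in a standard simplex to twisted singular chains of `X`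
induced by a map `F` of the simplex to `X`; the fibres are identified with the one over `F b`. -/
noncomputable def push (ω : MulCocycle X R) (F : C(stdSimplex ℝ ι, X)) (b : stdSimplex ℝ ι)
    (n : ℕ) : OrdChain R (stdSimplex ℝ ι) (n + 1) →ₗ[R] SingularChain X R n :=
  Finsupp.lift (SingularChain X R n) R (Fin (n + 1) → stdSimplex ℝ ι) fun v ↦
    Finsupp.single (F.comp (affineSimplex v)) (ω.seg F b (v 0))

lemma push_single (ω : MulCocycle X R) (F : C(stdSimplex ℝ ι, X)) (b : stdSimplex ℝ ι)
    (n : ℕ) (v : Fin (n + 1) → stdSimplex ℝ ι) :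
    ω.push F b n (Finsupp.single v 1) =
      Finsupp.single (F.comp (affineSimplex v)) (ω.seg F b (v 0)) := by
  rw [push, Finsupp.lift_apply, Finsupp.sum_single_index (by simp), one_smul]

/-- Only the face opposite to vertex `0` changes the first vertex. Its factor in the twisted
boundary, the weight of the edge from `v 0` to `v 1`, turns `seg b (v 0)` into `seg b (v 1)` by the
cocycle law. -/
lemma bd_push (ω : MulCocycle X R) (F : C(stdSimplex ℝ ι, X)) (b : stdSimplex ℝ ι)
    (n : ℕ) (c : OrdChain R (stdSimplex ℝ ι) (n + 2)) :
    ω.bd n (ω.push F b (n + 1) c) = ω.push F b n (OrdChain.d R _ (n + 1) c) := by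
  suffices h : (ω.bd n).comp (ω.push F b (n + 1)) =
      (ω.push F b n).comp (OrdChain.d R _ (n + 1)) from LinearMap.congr_fun h c
  refine OrdChain.hom_ext fun v ↦ ?_
  simp only [LinearMap.comp_apply]
  have key (w : Fin (n + 1) → stdSimplex ℝ ι) (r : R) : ω.push F b n (Finsupp.single w r) =
      Finsupp.single (F.comp (affineSimplex w)) (r * ω.seg F b (w 0)) := by simp [push]
  rw [push_single, bd_single, OrdChain.d_single, map_sum, Fin.sum_univ_succ (n := n + 1), smul_add,
    Finset.smul_sum]
  simp only [key, Finsupp.smul_single, SingularSimplex.face, ContinuousMap.comp_assoc,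
    affineSimplex_comp_stdMap]
  congr 1
  · congr 1
    have h1 : v ∘ ![0, 1] = ![v 0, v 1] := by funext i; fin_cases i <;> rfl
    rw [h1, smul_eq_mul]
    change ω.seg F b (v 0) * ω.seg F (v 0) (v 1) = _
    rw [seg_mul]
    simp
  · refine Finset.sum_congr rfl fun i _ ↦ ?_
    congr 1
    rw [smul_eq_mul, mul_comm, Fin.val_succ, Function.comp_apply, Fin.succ_succAbove_zero]

lemma push_map (ω : MulCocycle X R) (F : C(stdSimplex ℝ κ, X)) (u : ι → stdSimplex ℝ κ)
    (b : stdSimplex ℝ ι) (n : ℕ) (c : OrdChain R (stdSimplex ℝ ι) (n + 1)) :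
    ω.push (F.comp (affineSimplex u)) b n c =
      ω.push F (affineSimplex u b) n (OrdChain.map (affineSimplex u) (n + 1) c) := by
  suffices h : ω.push (F.comp (affineSimplex u)) b n =
      (ω.push F (affineSimplex u b) n).comp (OrdChain.map (affineSimplex u) (n + 1)) from
    LinearMap.congr_fun h c
  refine OrdChain.hom_ext fun v ↦ ?_
  rw [LinearMap.comp_apply, push_single, OrdChain.map_single, push_single, seg_comp,
    ContinuousMap.comp_assoc, affineSimplex_comp_affineSimplex, Function.comp_apply]

lemma push_base (ω : MulCocycle X R) (F : C(stdSimplex ℝ ι, X)) (a b : stdSimplex ℝ ι)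
    (n : ℕ) (c : OrdChain R (stdSimplex ℝ ι) (n + 1)) :
    ω.seg F a b • ω.push F b n c = ω.push F a n c := by
  suffices h : ω.seg F a b • ω.push F b n = ω.push F a n from LinearMap.congr_fun h c
  refine OrdChain.hom_ext fun v ↦ ?_
  rw [LinearMap.smul_apply, push_single, push_single, Finsupp.smul_single, smul_eq_mul, seg_mul]

lemma push_mem (ω : MulCocycle X R) (F : C(stdSimplex ℝ ι, X)) (b : stdSimplex ℝ ι) {A : Set X}
    (hF : Set.range F ⊆ A) (n : ℕ) (c : OrdChain R (stdSimplex ℝ ι) (n + 1)) :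
    ω.push F b n c ∈ chainsIn R A n := by
  induction c using Finsupp.induction_linear with
  | zero => simp
  | add f g hf hg => rw [map_add]; exact add_mem hf hg
  | single v r =>
    rw [← mul_one r, ← smul_eq_mul, ← Finsupp.smul_single, map_smul, push_single]
    refine Submodule.smul_mem _ _ (Finsupp.single_mem_supported R _ ?_)
    exact (Set.range_comp_subset_range (affineSimplex v) F).trans hF

/-! ### Natural operators on twisted singular chains -/

/-- The vertices of the standard simplex. -/
noncomputable def stdVertices (n : ℕ) : Fin (n + 1) → stdSimplex ℝ (Fin (n + 1)) :=
  stdSimplex.vertex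

/-- The operator on twisted singular chains with a prescribed universal value `θ` on the identity
of the standard simplex. -/
noncomputable def op (ω : MulCocycle X R) {n m : ℕ}
    (θ : OrdChain R (stdSimplex ℝ (Fin (n + 1))) (m + 1)) :
    SingularChain X R n →ₗ[R] SingularChain X R m :=
  Finsupp.lift (SingularChain X R m) R (SingularSimplex X n) fun σ ↦
    ω.push σ (stdVertices n 0) m θ

lemma op_single (ω : MulCocycle X R) {n m : ℕ}
    (θ : OrdChain R (stdSimplex ℝ (Fin (n + 1))) (m + 1)) (σ : SingularSimplex X n) (r : R) :
    ω.op θ (Finsupp.single σ r) = r • ω.push σ (stdVertices n 0) m θ := by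
  rw [op, Finsupp.lift_apply, Finsupp.sum_single_index (by simp)]

lemma op_mem (ω : MulCocycle X R) {n m : ℕ} {A : Set X}
    (θ : OrdChain R (stdSimplex ℝ (Fin (n + 1))) (m + 1)) {c : SingularChain X R n}
    (hc : c ∈ chainsIn R A n) : ω.op θ c ∈ chainsIn R A m := by
  rw [op, Finsupp.lift_apply]
  exact Submodule.sum_mem _ fun σ hσ ↦ Submodule.smul_mem _ _ (ω.push_mem _ _ (hc hσ) _ _)

/-- The transfer principle: an operator prescribed on the universal simplex acts on every pushed
chain as the natural operator `Θ` on ordered chains. Together with `single_eq_push` it reduces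
identities of twisted singular chains to identities of ordered chains. -/
lemma op_push (ω : MulCocycle X R) {n m : ℕ}
    (Θ : OrdChain R (stdSimplex ℝ ι) (n + 1) →ₗ[R] OrdChain R (stdSimplex ℝ ι) (m + 1))
    (θ : OrdChain R (stdSimplex ℝ (Fin (n + 1))) (m + 1))
    (hΘ : ∀ v, OrdChain.map (affineSimplex v) (m + 1) θ = Θ (Finsupp.single v 1))
    (F : C(stdSimplex ℝ ι, X)) (b : stdSimplex ℝ ι)
    (c : OrdChain R (stdSimplex ℝ ι) (n + 1)) :
    ω.op θ (ω.push F b n c) = ω.push F b m (Θ c) := by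
  suffices h : (ω.op θ).comp (ω.push F b n) = (ω.push F b m).comp Θ from LinearMap.congr_fun h c
  refine OrdChain.hom_ext fun v ↦ ?_
  rw [LinearMap.comp_apply, push_single, op_single, push_map, hΘ, stdVertices,
    affineSimplex_vertex, push_base, LinearMap.comp_apply]

lemma single_eq_push (ω : MulCocycle X R) {n : ℕ} (σ : SingularSimplex X n) :
    (Finsupp.single σ 1 : SingularChain X R n) =
      ω.push σ (stdVertices n 0) n (Finsupp.single (stdVertices n) 1) := by
  rw [push_single, seg_self, stdVertices, affineSimplex_vertex_eq_id, ContinuousMap.comp_id]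

lemma chain_hom_ext {n : ℕ} {N : Type*} [AddCommGroup N] [Module R N]
    {f g : SingularChain X R n →ₗ[R] N}
    (h : ∀ σ, f (Finsupp.single σ 1) = g (Finsupp.single σ 1)) : f = g :=
  Finsupp.lhom_ext' fun v ↦ LinearMap.ext_ring (h v)

lemma bd_bd (ω : MulCocycle X R) (n : ℕ) (c : SingularChain X R (n + 2)) :
    ω.bd n (ω.bd (n + 1) c) = 0 := by
  suffices h : (ω.bd n).comp (ω.bd (n + 1)) = 0 from LinearMap.congr_fun h c
  refine chain_hom_ext fun σ ↦ ?_
  rw [LinearMap.comp_apply, single_eq_push ω σ, bd_push, bd_push, OrdChain.d_d, map_zero,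
    LinearMap.zero_apply]

lemma bd_mem (ω : MulCocycle X R) {n : ℕ} {A : Set X} {c : SingularChain X R (n + 1)}
    (hc : c ∈ chainsIn R A (n + 1)) : ω.bd n c ∈ chainsIn R A n := by
  rw [← Finsupp.sum_single c, Finsupp.sum, map_sum]
  refine Submodule.sum_mem _ fun σ hσ ↦ ?_
  rw [← mul_one (c σ), ← smul_eq_mul, ← Finsupp.smul_single, map_smul, single_eq_push ω σ, bd_push]
  exact Submodule.smul_mem _ _ (ω.push_mem _ _ (hc hσ) _ _)

/-! ### Subdivision -/

/-- The barycenter of a tuple of points of a standard simplex. -/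
noncomputable def bary (ι : Type*) [Fintype ι] (n : ℕ) (v : Fin (n + 1) → stdSimplex ℝ ι) :
    stdSimplex ℝ ι :=
  affineSimplex v stdSimplex.barycenter

lemma affineSimplex_bary (u : ι → stdSimplex ℝ κ) (n : ℕ) (v : Fin (n + 1) → stdSimplex ℝ ι) :
    affineSimplex u (bary ι n v) = bary κ n (affineSimplex u ∘ v) := by
  rw [bary, bary, ← affineSimplex_comp_affineSimplex, ContinuousMap.comp_apply]

/-- Barycentric subdivision of twisted singular chains. -/
noncomputable def subdiv (ω : MulCocycle X R) (n : ℕ) :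
    SingularChain X R n →ₗ[R] SingularChain X R n :=
  ω.op (OrdChain.sd R (bary _) (n + 1) (Finsupp.single (stdVertices n) 1))

/-- The chain homotopy from the identity to barycentric subdivision. -/
noncomputable def subdivHomotopy (ω : MulCocycle X R) (n : ℕ) :
    SingularChain X R n →ₗ[R] SingularChain X R (n + 1) :=
  ω.op (OrdChain.sdHomotopy R (bary _) (n + 1) (Finsupp.single (stdVertices n) 1))

lemma affineSimplex_comp_stdVertices {n : ℕ} (v : Fin (n + 1) → stdSimplex ℝ ι) :
    affineSimplex v ∘ stdVertices n = v :=
  funext fun _ ↦ affineSimplex_vertex _ _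

lemma subdiv_push (ω : MulCocycle X R) (F : C(stdSimplex ℝ ι, X)) (b : stdSimplex ℝ ι) (n : ℕ)
    (c : OrdChain R (stdSimplex ℝ ι) (n + 1)) :
    ω.subdiv n (ω.push F b n c) = ω.push F b n (OrdChain.sd R (bary _) (n + 1) c) := by
  refine ω.op_push _ _ (fun v ↦ ?_) F b c
  rw [OrdChain.map_sd (β' := bary _) (affineSimplex_bary v), OrdChain.map_single,
    affineSimplex_comp_stdVertices]

lemma subdivHomotopy_push (ω : MulCocycle X R) (F : C(stdSimplex ℝ ι, X)) (b : stdSimplex ℝ ι)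
    (n : ℕ) (c : OrdChain R (stdSimplex ℝ ι) (n + 1)) :
    ω.subdivHomotopy n (ω.push F b n c) =
      ω.push F b (n + 1) (OrdChain.sdHomotopy R (bary _) (n + 1) c) := by
  refine ω.op_push _ _ (fun v ↦ ?_) F b c
  rw [OrdChain.map_sdHomotopy (β' := bary _) (affineSimplex_bary v), OrdChain.map_single,
    affineSimplex_comp_stdVertices]

lemma bd_subdiv (ω : MulCocycle X R) (n : ℕ) (c : SingularChain X R (n + 1)) :
    ω.bd n (ω.subdiv (n + 1) c) = ω.subdiv n (ω.bd n c) := by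
  suffices h : (ω.bd n).comp (ω.subdiv (n + 1)) = (ω.subdiv n).comp (ω.bd n) from
    LinearMap.congr_fun h c
  refine chain_hom_ext fun σ ↦ ?_
  simp only [LinearMap.comp_apply]
  rw [single_eq_push ω σ, subdiv_push, bd_push, bd_push, subdiv_push, OrdChain.d_sd]

lemma bd_subdivHomotopy_zero (ω : MulCocycle X R) (c : SingularChain X R 0) :
    ω.bd 0 (ω.subdivHomotopy 0 c) = c - ω.subdiv 0 c := by
  suffices h : (ω.bd 0).comp (ω.subdivHomotopy 0) = LinearMap.id - ω.subdiv 0 from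
    LinearMap.congr_fun h c
  refine chain_hom_ext fun σ ↦ ?_
  simp only [LinearMap.comp_apply, LinearMap.sub_apply, LinearMap.id_apply]
  rw [single_eq_push ω σ, subdivHomotopy_push, bd_push, subdiv_push, OrdChain.d_sdHomotopy]
  simp [OrdChain.sdHomotopy]

lemma bd_subdivHomotopy (ω : MulCocycle X R) (n : ℕ) (c : SingularChain X R (n + 1)) :
    ω.bd (n + 1) (ω.subdivHomotopy (n + 1) c) =
      c - ω.subdiv (n + 1) c - ω.subdivHomotopy n (ω.bd n c) := by
  suffices h : (ω.bd (n + 1)).comp (ω.subdivHomotopy (n + 1)) =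
      LinearMap.id - ω.subdiv (n + 1) - (ω.subdivHomotopy n).comp (ω.bd n) from
    LinearMap.congr_fun h c
  refine chain_hom_ext fun σ ↦ ?_
  simp only [LinearMap.comp_apply, LinearMap.sub_apply, LinearMap.id_apply]
  rw [single_eq_push ω σ, subdivHomotopy_push, bd_push, bd_push, subdiv_push, subdivHomotopy_push,
    OrdChain.d_sdHomotopy, map_sub, map_sub]

end MulCocycle

/-! ## Homotopies -/

namespace MulCocycle

open OrdChain

variable {X Y : Type*} [TopologicalSpace X] [TopologicalSpace Y] {R : Type*} [CommRing R]

/-- The map of the convex hull of the prism over a simplex to `X` given by a homotopy. -/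
noncomputable def prismMap (h : C(Y × unitInterval, X)) {n : ℕ} (σ : SingularSimplex Y n) :
    C(stdSimplex ℝ (Fin (n + 1) × Fin 2), X) where
  -- The simplex spanned by the vertices of the prism maps to the prism by its two affine
  -- projections. Tuples of prism vertices thus give singular simplices, without a triangulation of
  -- the product.
  toFun x := h (σ (stdSimplex.map Prod.fst x),
    stdSimplexHomeomorphUnitInterval (stdSimplex.map Prod.snd x))
  continuous_toFun := h.continuous.comp <|
    (σ.continuous.comp (stdSimplex.continuous_map _)).prodMk
      (stdSimplexHomeomorphUnitInterval.continuous.comp (stdSimplex.continuous_map _))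

lemma prismMap_comp_stdMap (h : C(Y × unitInterval, X)) {m n : ℕ} (σ : SingularSimplex Y n)
    (f : Fin (m + 1) → Fin (n + 1)) :
    prismMap h (σ.comp (SingularSimplex.stdMap f)) =
      (prismMap h σ).comp (affineSimplex (stdSimplex.vertex ∘ Prod.map f id)) := by
  refine ContinuousMap.ext fun x ↦ ?_
  rw [ContinuousMap.comp_apply, ← map_eq_affineSimplex]
  change h (σ (stdSimplex.map f (stdSimplex.map Prod.fst x)),
    stdSimplexHomeomorphUnitInterval (stdSimplex.map Prod.snd x)) =
    h (σ (stdSimplex.map Prod.fst (stdSimplex.map (Prod.map f id) x)),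
      stdSimplexHomeomorphUnitInterval (stdSimplex.map Prod.snd (stdSimplex.map (Prod.map f id) x)))
  simp only [stdSimplex.map_comp_apply]
  rfl

/-- The stage of a homotopy at an end point of the unit interval. -/
noncomputable def stage (h : C(Y × unitInterval, X)) (j : Fin 2) : C(Y, X) :=
  h.comp ((ContinuousMap.id Y).prodMk
    (ContinuousMap.const Y (stdSimplexHomeomorphUnitInterval (stdSimplex.vertex j))))

lemma stage_one (h : C(Y × unitInterval, X)) (y : Y) : stage h 1 y = h (y, 1) := by
  have h1 : stdSimplexHomeomorphUnitInterval (stdSimplex.vertex (S := ℝ) (1 : Fin 2)) = 1 :=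
    stdSimplexHomeomorphUnitInterval_one
  rw [← h1]
  rfl

lemma prismMap_comp_level (h : C(Y × unitInterval, X)) {m n : ℕ} (σ : SingularSimplex Y n)
    (f : Fin (m + 1) → Fin (n + 1)) (j : Fin 2) :
    (prismMap h σ).comp (affineSimplex (stdSimplex.vertex ∘ (·, j) ∘ f)) =
      (stage h j).comp (σ.comp (SingularSimplex.stdMap f)) := by
  refine ContinuousMap.ext fun x ↦ ?_
  rw [ContinuousMap.comp_apply, ← map_eq_affineSimplex]
  have hc : stdSimplex.map (fun _ : Fin (m + 1) ↦ j) x = stdSimplex.vertex j := by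
    rw [map_eq_affineSimplex]
    exact DFunLike.congr_fun (affineSimplex_const (stdSimplex.vertex j)) x
  change h (σ (stdSimplex.map Prod.fst (stdSimplex.map ((·, j) ∘ f) x)),
    stdSimplexHomeomorphUnitInterval (stdSimplex.map Prod.snd (stdSimplex.map ((·, j) ∘ f) x))) =
    h (σ (stdSimplex.map f x), stdSimplexHomeomorphUnitInterval (stdSimplex.vertex j))
  rw [← hc]
  simp only [stdSimplex.map_comp_apply]
  rfl

/-- The operator from chains of `Y` to chains of `X` along a homotopy that is given by a universal
chain on the vertices of the prism. -/
noncomputable def prismOp (ω : MulCocycle X R) (h : C(Y × unitInterval, X)) {n m : ℕ}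
    (θ : OrdChain R (Fin (n + 1) × Fin 2) (m + 1)) :
    SingularChain Y R n →ₗ[R] SingularChain X R m :=
  Finsupp.lift (SingularChain X R m) R (SingularSimplex Y n) fun σ ↦
    ω.push (prismMap h σ) (stdSimplex.vertex (0, 0)) m (map stdSimplex.vertex (m + 1) θ)

lemma prismOp_single (ω : MulCocycle X R) (h : C(Y × unitInterval, X)) {n m : ℕ}
    (θ : OrdChain R (Fin (n + 1) × Fin 2) (m + 1)) (σ : SingularSimplex Y n) (r : R) :
    ω.prismOp h θ (Finsupp.single σ r) = r •
      ω.push (prismMap h σ) (stdSimplex.vertex (0, 0)) m (map stdSimplex.vertex (m + 1) θ) := by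
  rw [prismOp, Finsupp.lift_apply, Finsupp.sum_single_index (by simp)]

lemma map_map {U V W : Type*} (f : U → V) (g : V → W) (n : ℕ) (c : OrdChain R U n) :
    map g n (map f n c) = map (g ∘ f) n c := by
  suffices h : (map g n).comp (map f n) = map (R := R) (g ∘ f) n from LinearMap.congr_fun h c
  refine hom_ext fun v ↦ ?_
  rw [LinearMap.comp_apply, map_single, map_single, map_single]
  rfl

lemma push_prismMap_face (ω : MulCocycle X R) (h : C(Y × unitInterval, X)) {n m : ℕ}
    (θ : OrdChain R (Fin (n + 1) × Fin 2) (m + 1)) (σ : SingularSimplex Y (n + 1))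
    (i : Fin (n + 2)) :
    ω.push (prismMap h (σ.face i)) (stdSimplex.vertex (0, 0)) m (map stdSimplex.vertex (m + 1) θ) =
    ω.push (prismMap h σ) (stdSimplex.vertex (i.succAbove 0, 0)) m
      (map stdSimplex.vertex (m + 1) (map (Prod.map i.succAbove id) (m + 1) θ)) := by
  rw [SingularSimplex.face, prismMap_comp_stdMap, push_map, affineSimplex_vertex, map_map, map_map]
  congr 2
  congr 1
  funext x
  exact affineSimplex_vertex _ _

lemma prismOp_bd (ω : MulCocycle X R) (h : C(Y × unitInterval, X)) {n m : ℕ}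
    (θ : OrdChain R (Fin (n + 1) × Fin 2) (m + 1))
    (Θ : OrdChain R (Fin (n + 2)) (n + 1) →ₗ[R] OrdChain R (Fin (n + 2) × Fin 2) (m + 1))
    (hΘ : ∀ f : Fin (n + 1) → Fin (n + 2),
      map (Prod.map f id) (m + 1) θ = Θ (Finsupp.single f 1))
    (σ : SingularSimplex Y (n + 1)) :
    ω.prismOp h θ ((ω.comap (stage h 0)).bd n (Finsupp.single σ 1)) =
      ω.push (prismMap h σ) (stdSimplex.vertex (0, 0)) m
        (map stdSimplex.vertex (m + 1) (Θ (d R _ (n + 1) (Finsupp.single id 1)))) := by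
  have key (f : Fin (n + 1) → Fin (n + 2)) (r : R) :
      Θ (Finsupp.single f r) = r • map (Prod.map f id) (m + 1) θ := by
    rw [hΘ, ← map_smul, Finsupp.smul_single, smul_eq_mul, mul_one]
  rw [bd_single, one_smul, map_add, map_sum, d_single, map_sum, map_sum, map_sum,
    Fin.sum_univ_succ (n := n + 1)]
  simp only [prismOp_single, push_prismMap_face, key, map_smul, Function.id_comp]
  congr 1
  -- The face opposite to vertex `0` has its base at `(1, 0)`; its twisted weight transports the
  -- fibre back to `(0, 0)` along the bottom of the prism.
  · have hw : (ω.comap (stage h 0)).weight (σ.comp (SingularSimplex.stdMap ![0, 1])) =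
        ω.seg (prismMap h σ) (stdSimplex.vertex (0, 0)) (stdSimplex.vertex (1, 0)) := by
      change ω.weight ((stage h 0).comp (σ.comp (SingularSimplex.stdMap ![0, 1]))) = _
      rw [← prismMap_comp_level, seg]
      congr 3
      funext i
      fin_cases i <;> rfl
    rw [hw, Fin.succAbove_zero, Fin.succ_zero_eq_one, push_base]
    simp

/-- The twisted prism operator of a homotopy. -/
noncomputable def prismChain (ω : MulCocycle X R) (h : C(Y × unitInterval, X)) (n : ℕ) :
    SingularChain Y R n →ₗ[R] SingularChain X R (n + 1) :=
  ω.prismOp h (prism R (Fin (n + 1)) (n + 1) (Finsupp.single id 1))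

/-- The chain map given by a stage of a homotopy; the fibres are identified along the homotopy. -/
noncomputable def stageChain (ω : MulCocycle X R) (h : C(Y × unitInterval, X)) (j : Fin 2)
    (n : ℕ) : SingularChain Y R n →ₗ[R] SingularChain X R n :=
  ω.prismOp h (map (·, j) (n + 1) (Finsupp.single id 1))

lemma stageChain_single (ω : MulCocycle X R) (h : C(Y × unitInterval, X)) (j : Fin 2)
    (n : ℕ) (σ : SingularSimplex Y n) (r : R) :
    ω.stageChain h j n (Finsupp.single σ r) = Finsupp.single ((stage h j).comp σ)
      (r * ω.seg (prismMap h σ) (stdSimplex.vertex (0, 0)) (stdSimplex.vertex (0, j))) := by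
  rw [stageChain, prismOp_single, map_single, map_single, push_single]
  have h1 := prismMap_comp_level h σ id j
  have h2 : SingularSimplex.stdMap (id : Fin (n + 1) → Fin (n + 1)) = ContinuousMap.id _ := by
    rw [stdMap_eq_affineSimplex]
    exact affineSimplex_vertex_eq_id
  rw [h2, ContinuousMap.comp_id] at h1
  rw [h1, Finsupp.smul_single]
  rfl

/-- The fibres are identified along the homotopy from its bottom, so no twisting factor appears at
the initial stage. -/
lemma stageChain_zero (ω : MulCocycle X R) (h : C(Y × unitInterval, X)) (n : ℕ) :
    ω.stageChain h 0 n = Finsupp.lmapDomain R R (stage h 0).comp := by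
  refine chain_hom_ext fun σ ↦ ?_
  rw [stageChain_single, seg_self, mul_one, Finsupp.lmapDomain_apply, Finsupp.mapDomain_single]

lemma bd_prismChain_zero (ω : MulCocycle X R) (h : C(Y × unitInterval, X))
    (c : SingularChain Y R 0) :
    ω.bd 0 (ω.prismChain h 0 c) = ω.stageChain h 1 0 c - ω.stageChain h 0 0 c := by
  suffices hs : (ω.bd 0).comp (ω.prismChain h 0) = ω.stageChain h 1 0 - ω.stageChain h 0 0 from
    LinearMap.congr_fun hs c
  refine chain_hom_ext fun σ ↦ ?_
  simp only [LinearMap.comp_apply, LinearMap.sub_apply, prismChain, stageChain, prismOp_single,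
    one_smul]
  rw [bd_push, ← map_d, d_prism, ← map_sub, ← map_sub]
  simp [prism]

lemma bd_prismChain (ω : MulCocycle X R) (h : C(Y × unitInterval, X)) (n : ℕ)
    (c : SingularChain Y R (n + 1)) :
    ω.bd (n + 1) (ω.prismChain h (n + 1) c) =
      ω.stageChain h 1 (n + 1) c - ω.stageChain h 0 (n + 1) c -
        ω.prismChain h n ((ω.comap (stage h 0)).bd n c) := by
  suffices hs : (ω.bd (n + 1)).comp (ω.prismChain h (n + 1)) =
      ω.stageChain h 1 (n + 1) - ω.stageChain h 0 (n + 1) -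
        (ω.prismChain h n).comp ((ω.comap (stage h 0)).bd n) from LinearMap.congr_fun hs c
  refine chain_hom_ext fun σ ↦ ?_
  simp only [LinearMap.comp_apply, LinearMap.sub_apply]
  rw [prismChain, prismChain, prismOp_bd (Θ := prism R (Fin (n + 2)) (n + 1))]
  · simp only [stageChain, prismOp_single, one_smul]
    rw [bd_push, ← map_d, d_prism, ← map_sub, ← map_sub, ← map_sub, ← map_sub]
  · intro f
    rw [map_prism, map_single]
    rfl

lemma prismChain_mem (ω : MulCocycle X R) (h : C(Y × unitInterval, X)) {A : Set X}
    (hA : ∀ p, h p ∈ A) (n : ℕ) (c : SingularChain Y R n) :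
    ω.prismChain h n c ∈ chainsIn R A (n + 1) := by
  rw [prismChain, prismOp, Finsupp.lift_apply]
  refine Submodule.sum_mem _ fun σ hσ ↦ Submodule.smul_mem _ _ (ω.push_mem _ _ ?_ _ _)
  rintro _ ⟨x, rfl⟩
  exact hA _

lemma stageChain_one_mem (ω : MulCocycle X R) (h : C(Y × unitInterval, X)) {A : Set X}
    (hA : ∀ y, h (y, 1) ∈ A) (n : ℕ) (c : SingularChain Y R n) :
    ω.stageChain h 1 n c ∈ chainsIn R A n := by
  rw [← Finsupp.sum_single c, Finsupp.sum, map_sum]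
  refine Submodule.sum_mem _ fun σ hσ ↦ ?_
  rw [stageChain_single]
  refine Finsupp.single_mem_supported R _ ?_
  rintro _ ⟨x, rfl⟩
  change stage h 1 (σ x) ∈ A
  rw [stage_one]
  exact hA _

/-! ## Subspaces with finitely generated homology -/

/-- The twisted cycles. -/
noncomputable def cycles (ω : MulCocycle X R) : (n : ℕ) → Submodule R (SingularChain X R n)
  | 0 => ⊤
  | n + 1 => LinearMap.ker (ω.bd n)

/-- The twisted homology of the subspace `A` is finitely generated in all degrees. -/
def FinHom (ω : MulCocycle X R) (A : Set X) : Prop :=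
  -- `F` need not consist of cycles nor lie in `A`. Over a Noetherian ring this still bounds the
  -- homology, which embeds in a quotient of `F`, and it allows the same `F` to serve for a larger
  -- subspace.
  ∀ n, ∃ F : Submodule R (SingularChain X R n), F.FG ∧
    ω.cycles n ⊓ chainsIn R A n ≤ F ⊔ (chainsIn R A (n + 1)).map (ω.bd n)

lemma bd_mem_cycles (ω : MulCocycle X R) (n : ℕ) (c : SingularChain X R (n + 1)) :
    ω.bd n c ∈ ω.cycles n := by
  cases n with
  | zero => trivial
  | succ n => exact ω.bd_bd n c

lemma bd_lmapDomain (ω : MulCocycle X R) (ψ : C(Y, X)) (n : ℕ) (c : SingularChain Y R (n + 1)) :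
    ω.bd n (Finsupp.lmapDomain R R ψ.comp c) =
      Finsupp.lmapDomain R R ψ.comp ((ω.comap ψ).bd n c) := by
  suffices hs : (ω.bd n).comp (Finsupp.lmapDomain R R ψ.comp) =
      (Finsupp.lmapDomain R R ψ.comp).comp ((ω.comap ψ).bd n) from LinearMap.congr_fun hs c
  refine chain_hom_ext fun σ ↦ ?_
  simp only [LinearMap.comp_apply, Finsupp.lmapDomain_apply, Finsupp.mapDomain_single, bd_single,
    one_smul, Finsupp.mapDomain_add, Finsupp.mapDomain_finsetSum]
  rfl

/-- A simplex with image in the range of an embedding factors continuously through it. -/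
lemma exists_lift_chain {ψ : C(Y, X)} (hψ : IsEmbedding ψ) {A : Set X} (hA : Set.range ψ = A)
    {n : ℕ} {z : SingularChain X R n} (hz : z ∈ chainsIn R A n) :
    ∃ z' : SingularChain Y R n, Finsupp.lmapDomain R R ψ.comp z' = z := by
  suffices h : chainsIn R A n ≤ LinearMap.range
      (Finsupp.lmapDomain R R (ψ.comp : SingularSimplex Y n → SingularSimplex X n)) from h hz
  rw [chainsIn, Finsupp.supported_eq_span_single, Submodule.span_le]
  rintro _ ⟨σ, hσ, rfl⟩
  have hl (x) : ∃ y, ψ y = σ x := by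
    have : σ x ∈ Set.range ψ := hA ▸ hσ ⟨x, rfl⟩
    exact this
  choose τ hτ using hl
  have hc : Continuous τ := by
    rw [hψ.continuous_iff]
    exact (funext hτ : ψ ∘ τ = σ) ▸ σ.continuous
  refine ⟨Finsupp.single ⟨τ, hc⟩ 1, ?_⟩
  rw [Finsupp.lmapDomain_apply, Finsupp.mapDomain_single]
  congr 1
  exact ContinuousMap.ext hτ

lemma chainsIn_mono {A B : Set X} (h : A ⊆ B) (n : ℕ) : chainsIn R A n ≤ chainsIn R B n :=
  Finsupp.supported_mono fun _ hσ ↦ Set.Subset.trans hσ h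

/-- If a homotopy inside `A` starts with the inclusion of `A` and ends in `B ⊆ A`, then the
homology of `A` is finitely generated if the homology of `B` is. -/
lemma FinHom.of_homotopy {ω : MulCocycle X R} {A B : Set X} (hBA : B ⊆ A)
    (h : C(Y × unitInterval, X)) (h0 : IsEmbedding fun y ↦ h (y, 0))
    (hr : Set.range (fun y ↦ h (y, 0)) = A) (hA : ∀ p, h p ∈ A) (h1 : ∀ y, h (y, 1) ∈ B)
    (hB : ω.FinHom B) : ω.FinHom A := by
  have hψ : IsEmbedding (stage h 0) := h0
  intro n
  obtain ⟨F, hF, hle⟩ := hB n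
  refine ⟨F, hF, ?_⟩
  rintro z ⟨hz, hzA⟩
  obtain ⟨y, rfl⟩ := exists_lift_chain hψ hr hzA
  -- The cycle differs from its final stage, a chain in `B`, by the boundary of its prism.
  have hbd : ω.bd n (ω.prismChain h n y) =
      ω.stageChain h 1 n y - Finsupp.lmapDomain R R (stage h 0).comp y := by
    cases n with
    | zero => rw [bd_prismChain_zero, stageChain_zero]
    | succ n =>
      -- Composition with an embedding is injective on simplices, so the lifted chain is a cycle as
      -- well.
      have hy : (ω.comap (stage h 0)).bd n y = 0 := by
        have hz' : ω.bd n (Finsupp.lmapDomain R R (stage h 0).comp y) = 0 := hz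
        rw [bd_lmapDomain] at hz'
        refine Finsupp.mapDomain_injective (f := (stage h 0).comp) ?_
          (hz'.trans (map_zero (Finsupp.lmapDomain R R (stage h 0).comp)).symm)
        intro σ τ hστ
        exact ContinuousMap.ext fun x ↦ hψ.injective (DFunLike.congr_fun hστ x)
      rw [bd_prismChain, stageChain_zero, hy, map_zero, sub_zero]
  have he : ω.stageChain h 1 n y ∈ ω.cycles n ⊓ chainsIn R B n := by
    refine ⟨?_, stageChain_one_mem ω h h1 n y⟩
    rw [← sub_add_cancel (ω.stageChain h 1 n y) (Finsupp.lmapDomain R R (stage h 0).comp y), ← hbd]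
    exact add_mem (bd_mem_cycles ω n _) hz
  have hz' : Finsupp.lmapDomain R R (stage h 0).comp y =
      ω.stageChain h 1 n y - ω.bd n (ω.prismChain h n y) := by rw [hbd, sub_sub_cancel]
  rw [hz']
  refine sub_mem (sup_le_sup_left (Submodule.map_mono (chainsIn_mono hBA _)) F (hle he)) ?_
  exact Submodule.mem_sup_right ⟨_, prismChain_mem ω h hA n y, rfl⟩

/-- There is at most one simplex in each degree, so already the chains are finitely generated. -/
lemma FinHom.of_subsingleton (ω : MulCocycle X R) {A : Set X} (hA : A.Subsingleton) :
    ω.FinHom A := by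
  intro n
  refine ⟨chainsIn R A n, ?_, fun z hz ↦ Submodule.mem_sup_left hz.2⟩
  rw [chainsIn, Finsupp.supported_eq_span_single]
  refine Submodule.fg_span (Set.Finite.image _ (Set.Subsingleton.finite ?_))
  intro σ hσ τ hτ
  exact ContinuousMap.ext fun x ↦ hA (hσ ⟨x, rfl⟩) (hτ ⟨x, rfl⟩)

end MulCocycle

/-! ## Mesh of the barycentric subdivision -/

section Mesh

variable {ι κ : Type*} [Fintype ι] [Fintype κ]

lemma dist_stdSimplex_le_iff {x y : stdSimplex ℝ ι} {D : ℝ} (hD : 0 ≤ D) :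
    dist x y ≤ D ↔ ∀ i, |x i - y i| ≤ D := by
  rw [Subtype.dist_eq, dist_pi_le_iff hD]
  rfl

lemma dist_affineSimplex_le {v : κ → stdSimplex ℝ ι} {p : stdSimplex ℝ ι} {D : ℝ}
    (h : ∀ k, dist (v k) p ≤ D) (x : stdSimplex ℝ κ) : dist (affineSimplex v x) p ≤ D := by
  rcases isEmpty_or_nonempty κ with hκ | ⟨⟨k₀⟩⟩
  · have := x.2.2
    simp at this
  have hD : 0 ≤ D := dist_nonneg.trans (h k₀)
  rw [dist_stdSimplex_le_iff hD]
  intro i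
  have h1 : affineSimplex v x i - p i = ∑ k, x k * (v k i - p i) := by
    rw [affineSimplex_apply]
    simp_rw [mul_sub]
    rw [Finset.sum_sub_distrib, ← Finset.sum_mul, stdSimplex.sum_eq_one, one_mul]
  rw [h1]
  calc |∑ k, x k * (v k i - p i)| ≤ ∑ k, |x k * (v k i - p i)| := Finset.abs_sum_le_sum_abs _ _
    _ ≤ ∑ k, x k * D := by
      refine Finset.sum_le_sum fun k _ ↦ ?_
      rw [abs_mul, abs_of_nonneg (stdSimplex.zero_le x k)]
      exact mul_le_mul_of_nonneg_left ((dist_stdSimplex_le_iff hD).1 (h k) i)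
        (stdSimplex.zero_le x k)
    _ = D := by rw [← Finset.sum_mul, stdSimplex.sum_eq_one, one_mul]

/-- The difference of `v i` and the barycenter is the mean of the `n + 1` differences `v i - v j`,
and the one with `j = i` vanishes. -/
lemma dist_bary_le {n : ℕ} {v : Fin (n + 1) → stdSimplex ℝ ι} {D : ℝ}
    (h : ∀ i j, dist (v i) (v j) ≤ D) (i : Fin (n + 1)) :
    dist (v i) (MulCocycle.bary ι n v) ≤ n / (n + 1) * D := by
  have hD : 0 ≤ D := dist_nonneg.trans (h 0 0)
  rw [dist_stdSimplex_le_iff (by positivity)]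
  intro x
  have hb : MulCocycle.bary ι n v x = ∑ j, ((n : ℝ) + 1)⁻¹ * v j x := by
    rw [MulCocycle.bary, affineSimplex_apply]
    refine Finset.sum_congr rfl fun j _ ↦ congrArg (· * v j x) ?_
    change ((Fintype.card (Fin (n + 1)) : ℝ))⁻¹ = _
    rw [Fintype.card_fin, Nat.cast_succ]
  have h1 : v i x - MulCocycle.bary ι n v x = ((n : ℝ) + 1)⁻¹ * ∑ j, (v i x - v j x) := by
    rw [hb, Finset.sum_sub_distrib, mul_sub, Finset.mul_sum, Finset.mul_sum]
    congr 1
    rw [Finset.sum_const, Finset.card_univ, Fintype.card_fin, nsmul_eq_mul]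
    push_cast
    field_simp
  rw [h1, abs_mul, abs_of_nonneg (by positivity)]
  have h2 : |∑ j, (v i x - v j x)| ≤ n * D := by
    calc |∑ j, (v i x - v j x)| ≤ ∑ j, |v i x - v j x| := Finset.abs_sum_le_sum_abs _ _
      _ = ∑ j ∈ Finset.univ.erase i, |v i x - v j x| := by
        rw [← Finset.add_sum_erase _ _ (Finset.mem_univ i)]
        simp
      _ ≤ ∑ j ∈ Finset.univ.erase i, D :=
        Finset.sum_le_sum fun j _ ↦ (dist_stdSimplex_le_iff hD).1 (h i j) x
      _ = n * D := by
        rw [Finset.sum_const, Finset.card_erase_of_mem (Finset.mem_univ i), Finset.card_univ,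
          Fintype.card_fin, nsmul_eq_mul, Nat.add_sub_cancel]
  calc ((n : ℝ) + 1)⁻¹ * |∑ j, (v i x - v j x)| ≤ ((n : ℝ) + 1)⁻¹ * (n * D) := by gcongr
    _ = n / (n + 1) * D := by ring

namespace OrdChain

variable {R : Type*} [CommRing R]

lemma cone_mem_supported {V : Type*} (b : V) {n : ℕ} {s : Set (Fin n → V)}
    {t : Set (Fin (n + 1) → V)} (h : ∀ w ∈ s, (Fin.cons b w : Fin (n + 1) → V) ∈ t)
    {c : OrdChain R V n} (hc : c ∈ Finsupp.supported R R s) :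
    cone b n c ∈ Finsupp.supported R R t := by
  rw [← Finsupp.sum_single c, Finsupp.sum, map_sum]
  refine Submodule.sum_mem _ fun w hw ↦ ?_
  rw [cone_single]
  exact Finsupp.single_mem_supported R _ (h w (hc hw))

/-- All simplices of the barycentric subdivision of a simplex of diameter at most `D` and of
dimension at most `N` lie in every ball that contains the simplex, and have diameter at most
`N / (N + 1) * D`. -/
lemma sd_bary_mem_supported (N : ℕ) {D : ℝ} (n : ℕ) (hn : n ≤ N + 1) (v : Fin n → stdSimplex ℝ ι)
    (hv : ∀ i j, dist (v i) (v j) ≤ D) :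
    sd R (MulCocycle.bary ι) n (Finsupp.single v 1) ∈ Finsupp.supported R R
      {w | (∀ p E, (∀ i, dist (v i) p ≤ E) → ∀ j, dist (w j) p ≤ E) ∧
        ∀ i j, dist (w i) (w j) ≤ N / (N + 1) * D} := by
  induction n with
  | zero => exact Finsupp.single_mem_supported R _ ⟨fun _ _ _ j ↦ j.elim0, fun i ↦ i.elim0⟩
  | succ n ih =>
    have hD : 0 ≤ D := dist_nonneg.trans (hv 0 0)
    have hb (i) : dist (v i) (MulCocycle.bary ι n v) ≤ N / (N + 1) * D := by
      refine (dist_bary_le hv i).trans (mul_le_mul_of_nonneg_right ?_ hD)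
      rw [div_le_div_iff₀ (by positivity) (by positivity)]
      have : (n : ℝ) ≤ N := by exact_mod_cast Nat.le_of_succ_le_succ hn
      linarith
    rw [sd_single, d_single, map_sum, map_sum]
    refine Submodule.sum_mem _ fun k _ ↦ ?_
    rw [← Finsupp.smul_single_one, map_smul, map_smul]
    refine Submodule.smul_mem _ _ (cone_mem_supported _ ?_
      (ih (by lia) (v ∘ k.succAbove) fun i j ↦ hv _ _))
    rintro w ⟨hw1, hw2⟩
    refine ⟨fun p E hE ↦ ?_, ?_⟩
    · refine Fin.cases ?_ fun j ↦ ?_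
      · exact dist_affineSimplex_le hE _
      · exact hw1 p E (fun i ↦ hE _) j
    -- This is why the induction also carries the statement about balls: the subdivided face stays
    -- in the ball about the barycenter that contains the whole simplex.
    · have h1 (j) : dist (w j) (MulCocycle.bary ι n v) ≤ N / (N + 1) * D :=
        hw1 _ _ (fun i ↦ hb _) j
      refine Fin.cases (Fin.cases ?_ fun j ↦ ?_) fun i ↦ Fin.cases ?_ fun j ↦ ?_
      · simp only [Fin.cons_zero, dist_self]
        positivity
      · simpa [dist_comm] using h1 j
      · simpa using h1 i
      · simpa using hw2 i j

lemma iterate_sd_bary_mem_supported (n : ℕ) {D : ℝ} (v : Fin (n + 1) → stdSimplex ℝ ι)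
    (hv : ∀ i j, dist (v i) (v j) ≤ D) (k : ℕ) :
    (sd R (MulCocycle.bary ι) (n + 1))^[k] (Finsupp.single v 1) ∈ Finsupp.supported R R
      {w | ∀ i j, dist (w i) (w j) ≤ ((n : ℝ) / (n + 1)) ^ k * D} := by
  induction k with
  | zero => exact Finsupp.single_mem_supported R _ (by simpa using hv)
  | succ k ih =>
    rw [Function.iterate_succ_apply']
    generalize (sd R (MulCocycle.bary ι) (n + 1))^[k] (Finsupp.single v 1) = c at ih
    rw [← Finsupp.sum_single c, Finsupp.sum, map_sum]
    refine Submodule.sum_mem _ fun w hw ↦ ?_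
    rw [← Finsupp.smul_single_one, map_smul]
    refine Submodule.smul_mem _ _ (Finsupp.supported_mono ?_
      (sd_bary_mem_supported n (n + 1) le_rfl w (ih hw)))
    rintro u ⟨-, hu⟩ i j
    rw [pow_succ', mul_assoc]
    exact hu i j

end OrdChain

end Mesh

/-! ### Small chains and the Mayer-Vietoris argument -/

namespace MulCocycle

variable {X : Type*} [TopologicalSpace X] {R : Type*} [CommRing R]

lemma iterate_subdiv_push {ι : Type*} [Fintype ι] (ω : MulCocycle X R) (F : C(stdSimplex ℝ ι, X))
    (b : stdSimplex ℝ ι) (n : ℕ) (c : OrdChain R (stdSimplex ℝ ι) (n + 1)) (k : ℕ) :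
    (ω.subdiv n)^[k] (ω.push F b n c) =
      ω.push F b n ((OrdChain.sd R (bary _) (n + 1))^[k] c) := by
  induction k generalizing c with
  | zero => rfl
  | succ k ih => rw [Function.iterate_succ_apply, Function.iterate_succ_apply, subdiv_push, ih]

lemma exists_iterate_subdiv_single_mem (ω : MulCocycle X R) {A O₁ O₂ : Set X} (h₁ : IsOpen O₁)
    (h₂ : IsOpen O₂) (hA : A ⊆ O₁ ∪ O₂) {n : ℕ} (σ : SingularSimplex X n) (hσ : Set.range σ ⊆ A) :
    ∃ k, (ω.subdiv n)^[k] (Finsupp.single σ 1) ∈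
      chainsIn R (A ∩ O₁) n ⊔ chainsIn R (A ∩ O₂) n := by
  let c : Bool → Set (stdSimplex ℝ (Fin (n + 1))) := fun b ↦ bif b then σ ⁻¹' O₁ else σ ⁻¹' O₂
  have hc (b : Bool) : IsOpen (c b) := by
    cases b
    · exact h₂.preimage σ.continuous
    · exact h₁.preimage σ.continuous
  have hcov : (Set.univ : Set (stdSimplex ℝ (Fin (n + 1)))) ⊆ ⋃ b, c b := by
    intro x _
    rcases hA (hσ ⟨x, rfl⟩) with h | h
    · exact Set.mem_iUnion.2 ⟨true, h⟩
    · exact Set.mem_iUnion.2 ⟨false, h⟩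
  -- With a Lebesgue number `δ` of the pulled back cover, `k` subdivisions bring the mesh below `δ`,
  -- because the standard simplex has diameter at most `1`.
  obtain ⟨δ, hδ, hleb⟩ := lebesgue_number_lemma_of_metric isCompact_univ hc hcov
  obtain ⟨k, hk⟩ := exists_pow_lt_of_lt_one hδ
    (show (n : ℝ) / (n + 1) < 1 by rw [div_lt_one (by positivity)]; linarith)
  refine ⟨k, ?_⟩
  have hd (i j) : dist (stdVertices n i) (stdVertices n j) ≤ 1 := by
    rw [Subtype.dist_eq]
    exact (Metric.dist_le_diam_of_mem (bounded_stdSimplex _) (Subtype.mem _)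
      (Subtype.mem _)).trans diam_stdSimplex_le
  have hs := OrdChain.iterate_sd_bary_mem_supported (R := R) n (stdVertices n) hd k
  rw [single_eq_push ω σ, iterate_subdiv_push]
  generalize (OrdChain.sd R (bary _) (n + 1))^[k] (Finsupp.single (stdVertices n) 1) = e at hs
  rw [← Finsupp.sum_single e, Finsupp.sum, map_sum]
  refine Submodule.sum_mem _ fun w hw ↦ ?_
  rw [← Finsupp.smul_single_one, map_smul, push_single]
  refine Submodule.smul_mem _ _ ?_
  have hw' : ∀ i j, dist (w i) (w j) ≤ ((n : ℝ) / (n + 1)) ^ k * 1 := hs hw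
  obtain ⟨b, hb⟩ := hleb (w 0) trivial
  have hr (x) : affineSimplex w x ∈ c b := hb <| by
    rw [Metric.mem_ball]
    refine (dist_affineSimplex_le (fun i ↦ hw' i 0) x).trans_lt ?_
    rwa [mul_one]
  cases b
  · refine Submodule.mem_sup_right (Finsupp.single_mem_supported R _ ?_)
    rintro _ ⟨x, rfl⟩
    exact ⟨hσ ⟨_, rfl⟩, hr x⟩
  · refine Submodule.mem_sup_left (Finsupp.single_mem_supported R _ ?_)
    rintro _ ⟨x, rfl⟩
    exact ⟨hσ ⟨_, rfl⟩, hr x⟩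

lemma subdiv_mem (ω : MulCocycle X R) {n : ℕ} {A : Set X} {c : SingularChain X R n}
    (hc : c ∈ chainsIn R A n) : ω.subdiv n c ∈ chainsIn R A n := ω.op_mem _ hc

lemma iterate_subdiv_mem_sup (ω : MulCocycle X R) {n : ℕ} {A B : Set X} {c : SingularChain X R n}
    (hc : c ∈ chainsIn R A n ⊔ chainsIn R B n) (k : ℕ) :
    (ω.subdiv n)^[k] c ∈ chainsIn R A n ⊔ chainsIn R B n := by
  induction k with
  | zero => exact hc
  | succ k ih =>
    rw [Function.iterate_succ_apply']
    obtain ⟨a, ha, b, hb, h⟩ := Submodule.mem_sup.1 ih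
    rw [← h, map_add]
    exact Submodule.add_mem_sup (ω.subdiv_mem ha) (ω.subdiv_mem hb)

lemma exists_iterate_subdiv_mem (ω : MulCocycle X R) {A O₁ O₂ : Set X} (h₁ : IsOpen O₁)
    (h₂ : IsOpen O₂) (hA : A ⊆ O₁ ∪ O₂) {n : ℕ} {c : SingularChain X R n}
    (hc : c ∈ chainsIn R A n) :
    ∃ k, (ω.subdiv n)^[k] c ∈ chainsIn R (A ∩ O₁) n ⊔ chainsIn R (A ∩ O₂) n := by
  rw [chainsIn, Finsupp.supported_eq_span_single] at hc
  induction hc using Submodule.span_induction with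
  | mem x hx =>
    obtain ⟨σ, hσ, rfl⟩ := hx
    exact ω.exists_iterate_subdiv_single_mem h₁ h₂ hA σ hσ
  | zero => exact ⟨0, zero_mem _⟩
  | add x y _ _ hx hy =>
    obtain ⟨k, hk⟩ := hx
    obtain ⟨m, hm⟩ := hy
    refine ⟨k + m, ?_⟩
    rw [← Module.End.coe_pow, map_add, Module.End.coe_pow]
    refine add_mem ?_ ?_
    · rw [add_comm, Function.iterate_add_apply]
      exact ω.iterate_subdiv_mem_sup hk m
    · rw [Function.iterate_add_apply]
      exact ω.iterate_subdiv_mem_sup hm k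
  | smul r x _ hx =>
    obtain ⟨k, hk⟩ := hx
    refine ⟨k, ?_⟩
    rw [← Module.End.coe_pow, map_smul, Module.End.coe_pow]
    exact Submodule.smul_mem _ _ hk

lemma subdiv_mem_cycles (ω : MulCocycle X R) {n : ℕ} {z : SingularChain X R n}
    (hz : z ∈ ω.cycles n) : ω.subdiv n z ∈ ω.cycles n := by
  cases n with
  | zero => trivial
  | succ n =>
    have hz' : ω.bd n z = 0 := hz
    change ω.bd n _ = 0
    rw [bd_subdiv, hz', map_zero]

lemma sub_subdiv_mem (ω : MulCocycle X R) {n : ℕ} {A : Set X} {z : SingularChain X R n}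
    (hz : z ∈ ω.cycles n) (hA : z ∈ chainsIn R A n) :
    z - ω.subdiv n z ∈ (chainsIn R A (n + 1)).map (ω.bd n) := by
  refine ⟨ω.subdivHomotopy n z, ω.op_mem _ hA, ?_⟩
  cases n with
  | zero => exact ω.bd_subdivHomotopy_zero z
  | succ n =>
    have hz' : ω.bd n z = 0 := hz
    rw [bd_subdivHomotopy, hz', map_zero, sub_zero]

lemma sub_iterate_subdiv_mem (ω : MulCocycle X R) {n : ℕ} {A : Set X} {z : SingularChain X R n}
    (hz : z ∈ ω.cycles n) (hA : z ∈ chainsIn R A n) (k : ℕ) :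
    (ω.subdiv n)^[k] z ∈ ω.cycles n ∧
      z - (ω.subdiv n)^[k] z ∈ (chainsIn R A (n + 1)).map (ω.bd n) := by
  induction k generalizing z with
  | zero => exact ⟨hz, by simp⟩
  | succ k ih =>
    obtain ⟨h1, h2⟩ := ih (ω.subdiv_mem_cycles hz) (ω.subdiv_mem hA)
    rw [Function.iterate_succ_apply]
    refine ⟨h1, ?_⟩
    rw [← sub_add_sub_cancel z (ω.subdiv n z)]
    exact add_mem (ω.sub_subdiv_mem hz hA) h2

lemma exists_fg_le_map {M N : Type*} [AddCommGroup M] [Module R M] [AddCommGroup N] [Module R N]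
    (f : M →ₗ[R] N) {G : Submodule R N} (hG : G.FG) {P : Submodule R M} (h : G ≤ P.map f) :
    ∃ Q ≤ P, Q.FG ∧ G ≤ Q.map f := by
  obtain ⟨s, rfl⟩ := hG
  have hl (x : s) : ∃ y ∈ P, f y = x := h (Submodule.subset_span x.2)
  choose g hg hfg using hl
  refine ⟨Submodule.span R (Set.range g), ?_, Submodule.fg_span (Set.finite_range g), ?_⟩
  · rw [Submodule.span_le]
    rintro _ ⟨x, rfl⟩
    exact hg x
  · rw [Submodule.span_le]
    intro x hx
    exact ⟨g ⟨x, hx⟩, Submodule.subset_span ⟨_, rfl⟩, hfg ⟨x, hx⟩⟩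

lemma chainsIn_inf (A B : Set X) (n : ℕ) :
    chainsIn R A n ⊓ chainsIn R B n ≤ chainsIn R (A ∩ B) n := by
  rintro c ⟨hA, hB⟩ σ hσ
  exact Set.subset_inter (hA hσ) (hB hσ)

/-- A Mayer-Vietoris argument: if a space is the union of two relatively open subspaces, and the
homology of both and of the intersection is finitely generated, then so is that of the space. -/
lemma FinHom.of_cover [IsNoetherianRing R] {ω : MulCocycle X R} {A O₁ O₂ : Set X}
    (h₁ : IsOpen O₁) (h₂ : IsOpen O₂) (hA : A ⊆ O₁ ∪ O₂) (hU : ω.FinHom (A ∩ O₁))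
    (hV : ω.FinHom (A ∩ O₂)) (hUV : ω.FinHom ((A ∩ O₁) ∩ (A ∩ O₂))) : ω.FinHom A := by
  intro n
  -- Iterated subdivision changes a cycle by a boundary in `A` and makes it a sum of chains in the
  -- two pieces.
  suffices hs : ∃ F : Submodule R (SingularChain X R n), F.FG ∧
      ∀ a ∈ chainsIn R (A ∩ O₁) n, ∀ b ∈ chainsIn R (A ∩ O₂) n, a + b ∈ ω.cycles n →
        a + b ∈ F ⊔ (chainsIn R A (n + 1)).map (ω.bd n) by
    obtain ⟨F, hF, h⟩ := hs
    refine ⟨F, hF, ?_⟩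
    rintro z ⟨hz, hzA⟩
    obtain ⟨k, hk⟩ := ω.exists_iterate_subdiv_mem h₁ h₂ hA hzA
    obtain ⟨hc, hd⟩ := ω.sub_iterate_subdiv_mem hz hzA k
    obtain ⟨a, ha, b, hb, hab⟩ := Submodule.mem_sup.1 hk
    rw [← sub_add_cancel z ((ω.subdiv n)^[k] z)]
    refine add_mem (Submodule.mem_sup_right hd) ?_
    rw [← hab] at hc ⊢
    exact h a ha b hb hc
  obtain ⟨FU, hFU, hleU⟩ := hU n
  obtain ⟨FV, hFV, hleV⟩ := hV n
  have hmU : (chainsIn R (A ∩ O₁) (n + 1)).map (ω.bd n) ≤ (chainsIn R A (n + 1)).map (ω.bd n) :=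
    Submodule.map_mono (chainsIn_mono Set.inter_subset_left _)
  have hmV : (chainsIn R (A ∩ O₂) (n + 1)).map (ω.bd n) ≤ (chainsIn R A (n + 1)).map (ω.bd n) :=
    Submodule.map_mono (chainsIn_mono Set.inter_subset_left _)
  have hsum {G : Submodule R (SingularChain X R n)} {a b : SingularChain X R n}
      (ha : a ∈ ω.cycles n ⊓ chainsIn R (A ∩ O₁) n)
      (hb : b ∈ ω.cycles n ⊓ chainsIn R (A ∩ O₂) n) :
      a + b ∈ FU ⊔ FV ⊔ G ⊔ (chainsIn R A (n + 1)).map (ω.bd n) :=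
    add_mem (sup_le_sup (le_sup_left.trans le_sup_left) hmU (hleU ha))
      (sup_le_sup (le_sup_right.trans le_sup_left) hmV (hleV hb))
  cases n with
  | zero =>
    refine ⟨FU ⊔ FV ⊔ ⊥, (hFU.sup hFV).sup Submodule.fg_bot, fun a ha b hb _ ↦ ?_⟩
    exact hsum ⟨trivial, ha⟩ ⟨trivial, hb⟩
  | succ n =>
    obtain ⟨F, hF, hle⟩ := hUV n
    -- `G` collects the elements of `F` that bound in both pieces. Lifts of its generators account
    -- for the classes with nonzero image under the connecting map.
    let G := F ⊓ (chainsIn R (A ∩ O₁) (n + 1)).map (ω.bd n) ⊓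
      (chainsIn R (A ∩ O₂) (n + 1)).map (ω.bd n)
    have hG : G.FG := Submodule.FG.of_le hF (inf_le_left.trans inf_le_left)
    obtain ⟨GU, hGU, hGUfg, hGUle⟩ := exists_fg_le_map (ω.bd n) hG (inf_le_left.trans inf_le_right)
    obtain ⟨GV, hGV, hGVfg, hGVle⟩ := exists_fg_le_map (ω.bd n) hG inf_le_right
    refine ⟨FU ⊔ FV ⊔ (GU ⊔ GV), (hFU.sup hFV).sup (hGUfg.sup hGVfg), fun a ha b hb hab ↦ ?_⟩
    have hab' : ω.bd n a + ω.bd n b = 0 := by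
      rw [← map_add]
      exact hab
    have he : ω.bd n a ∈ ω.cycles n ⊓ chainsIn R ((A ∩ O₁) ∩ (A ∩ O₂)) n := by
      refine ⟨ω.bd_mem_cycles n a, chainsIn_inf _ _ _ ⟨ω.bd_mem ha, ?_⟩⟩
      rw [eq_neg_of_add_eq_zero_left hab']
      exact neg_mem (ω.bd_mem hb)
    obtain ⟨f, hf, _, ⟨c, hc, rfl⟩, hfc⟩ := Submodule.mem_sup.1 (hle he)
    have hcU := chainsIn_mono (R := R) Set.inter_subset_left _ hc
    have hcV := chainsIn_mono (R := R) Set.inter_subset_right _ hc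
    have hfG : f ∈ G := by
      refine ⟨⟨hf, a - c, sub_mem ha hcU, ?_⟩, -b - c, sub_mem (neg_mem hb) hcV, ?_⟩
      · rw [map_sub, ← hfc, add_sub_cancel_right]
      · rw [map_sub, map_neg, ← eq_neg_of_add_eq_zero_left hab', ← hfc, add_sub_cancel_right]
    obtain ⟨a₁, ha₁, hfa⟩ := hGUle hfG
    obtain ⟨b₁, hb₁, hfb⟩ := hGVle hfG
    -- With `∂a = f + ∂c` and `∂a₁ = ∂b₁ = f`, the first two summands are cycles in the two pieces,
    -- and the last lies in the finitely generated module `GU ⊔ GV`.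
    have hsplit : a + b = ((a - a₁ - c) + (b + b₁ + c)) + (a₁ - b₁) := by abel
    rw [hsplit]
    refine add_mem (hsum ⟨?_, ?_⟩ ⟨?_, ?_⟩) (Submodule.mem_sup_left (Submodule.mem_sup_right
      (sub_mem (Submodule.mem_sup_left ha₁) (Submodule.mem_sup_right hb₁))))
    · change ω.bd n _ = 0
      rw [map_sub, map_sub, hfa, ← hfc]
      abel
    · exact sub_mem (sub_mem ha (hGU ha₁)) hcU
    · change ω.bd n _ = 0
      rw [map_add, map_add, hfb, eq_neg_of_add_eq_zero_right hab', ← hfc]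
      abel
    · exact add_mem (add_mem hb (hGV hb₁)) hcV

end MulCocycle

/-! ## Finiteness of the twisted homology of finite CW complexes -/

namespace MulCocycle

variable {X Z : Type*} [TopologicalSpace X] [TopologicalSpace Z] {R : Type*} [CommRing R]

/-- Deformations of subspaces of a space `Z` that is embedded in `X`. -/
lemma FinHom.of_isEmbedding {ω : MulCocycle X R} {φ : Z → X} (hφ : IsEmbedding φ) {P Q : Set Z}
    (k : C(P × unitInterval, Z)) (hQP : Q ⊆ P) (h0 : ∀ p, k (p, 0) = p) (hk : ∀ p, k p ∈ P)
    (h1 : ∀ p, k (p, 1) ∈ Q) (hQ : ω.FinHom (φ '' Q)) : ω.FinHom (φ '' P) := by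
  have h0' : (fun p : P ↦ φ (k (p, 0))) = φ ∘ Subtype.val := funext fun p ↦ by simp [h0]
  refine FinHom.of_homotopy (Set.image_mono hQP)
    ((⟨φ, hφ.continuous⟩ : C(Z, X)).comp k) ?_ ?_ ?_ ?_ hQ
  · exact h0' ▸ hφ.comp IsEmbedding.subtypeVal
  · change Set.range (fun p : P ↦ φ (k (p, 0))) = φ '' P
    rw [h0', Set.range_comp, Subtype.range_coe]
  · exact fun p ↦ Set.mem_image_of_mem φ (hk p)
  · exact fun p ↦ Set.mem_image_of_mem φ (h1 p)

/-- A subspace that is star-shaped in a real vector space embedded in `X`. -/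
lemma FinHom.of_starConvex {E : Type*} [AddCommGroup E] [Module ℝ E] [TopologicalSpace E]
    [IsTopologicalAddGroup E] [ContinuousSMul ℝ E] {ω : MulCocycle X R} {φ : E → X}
    (hφ : IsEmbedding φ) {P : Set E} {a : E} (ha : a ∈ P) (hP : StarConvex ℝ a P) :
    ω.FinHom (φ '' P) := by
  refine FinHom.of_isEmbedding (Q := {a}) hφ
    ⟨fun p ↦ (p.2 : ℝ) • a + (1 - (p.2 : ℝ)) • (p.1 : E), by fun_prop⟩ ?_ ?_ ?_ ?_ ?_
  · simpa using ha
  · intro p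
    simp
  · rintro ⟨p, t⟩
    exact hP p.2 t.2.1 (sub_nonneg.2 t.2.2) (add_sub_cancel _ _)
  · intro p
    simp
  · exact FinHom.of_subsingleton ω (Set.subsingleton_singleton.image φ)

/-- The homology of a punctured Euclidean space is finitely generated. -/
lemma FinHom.punctured [IsNoetherianRing R] (ω : MulCocycle X R) (n : ℕ) {φ : (Fin n → ℝ) → X}
    (hφ : IsEmbedding φ) : ω.FinHom (φ '' {0}ᶜ) := by
  induction n with
  | zero =>
    refine FinHom.of_subsingleton ω (Set.Subsingleton.image ?_ _)
    intro x _ y _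
    exact Subsingleton.elim x y
  | succ n ih =>
    let tl : (Fin (n + 1) → ℝ) → Fin n → ℝ := fun x i ↦ x i.succ
    have htl : Continuous tl := by fun_prop
    let cz : (Fin n → ℝ) → Fin (n + 1) → ℝ := fun x ↦ Fin.cons 0 x
    have hcz : Continuous cz := continuous_const.finCons continuous_id
    have hcz' : IsEmbedding cz := IsEmbedding.of_leftInverse (f := tl) (fun x ↦ rfl) htl hcz
    have hT : IsOpen {x | tl x ≠ 0} := isOpen_ne_fun htl continuous_const
    have h0 : Continuous fun x : Fin (n + 1) → ℝ ↦ x 0 := continuous_apply 0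
    -- For `s = ±1` this is the complement of a closed half-line on the first axis, star-shaped
    -- about `s` times the first basis vector. The two sets cover the punctured space, and they meet
    -- in the complement of the axis, which retracts to a punctured space of one dimension less.
    let Q (s : ℝ) : Set (Fin (n + 1) → ℝ) := {x | 0 < s * x 0} ∪ {x | tl x ≠ 0}
    have hQo (s : ℝ) : IsOpen (Q s) :=
      (isOpen_lt continuous_const (continuous_const.mul h0)).union hT
    have hQ0 (s : ℝ) : Q s ⊆ {0}ᶜ := by
      rintro x (hx | hx) rfl
      · simp at hx
      · exact hx rfl
    have hQ (s : ℝ) (hs : s ≠ 0) : ω.FinHom (φ '' Q s) := by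
      have ha : (Fin.cons s 0 : Fin (n + 1) → ℝ) ∈ Q s :=
        Or.inl (mul_self_pos.2 hs)
      refine FinHom.of_starConvex hφ ha ?_
      intro x hx a b ha hb hab
      by_cases hb0 : b = 0
      · obtain rfl : a = 1 := by linarith
        simpa [hb0] using ‹_ ∈ Q s›
      · rcases hx with hx | hx
        · left
          have hx' : 0 < s * x 0 := hx
          have hb' : 0 < b := lt_of_le_of_ne hb (Ne.symm hb0)
          change 0 < s * (a * s + b * x 0)
          have h1 : 0 < b * (s * x 0) := mul_pos hb' hx'
          nlinarith [mul_nonneg ha (mul_self_nonneg s)]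
        · right
          intro h
          refine hx (funext fun i ↦ ?_)
          have hi := congrFun h i
          change a * 0 + b * x i.succ = 0 at hi
          simpa [hb0] using hi
    obtain ⟨O₁, hO₁, h₁⟩ := hφ.isOpen_iff.1 (hQo 1)
    obtain ⟨O₂, hO₂, h₂⟩ := hφ.isOpen_iff.1 (hQo (-1))
    have hi {O : Set X} {s : ℝ} (h : φ ⁻¹' O = Q s) : φ '' {0}ᶜ ∩ O = φ '' Q s := by
      rw [← Set.image_inter_preimage, h, Set.inter_eq_right.2 (hQ0 s)]
    refine FinHom.of_cover hO₁ hO₂ ?_ ?_ ?_ ?_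
    · rintro _ ⟨x, hx, rfl⟩
      change x ∈ φ ⁻¹' O₁ ∨ x ∈ φ ⁻¹' O₂
      rw [h₁, h₂]
      by_cases ht : tl x = 0
      · have hx0 : x 0 ≠ 0 := by
          intro h
          refine hx (funext fun i ↦ ?_)
          exact Fin.cases h (fun j ↦ congrFun ht j) i
        rcases lt_or_gt_of_ne hx0 with h | h
        · right; left; change 0 < -1 * x 0; linarith
        · left; left; change 0 < 1 * x 0; linarith
      · exact Or.inl (Or.inr ht)
    · rw [hi h₁]
      exact hQ 1 one_ne_zero
    · rw [hi h₂]
      exact hQ (-1) (by norm_num)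
    · have hQQ : Q 1 ∩ Q (-1) = {x | tl x ≠ 0} := by
        ext x
        constructor
        · rintro ⟨h | h, h' | h'⟩
          · have h3 : 0 < 1 * x 0 := h
            have h4 : 0 < -1 * x 0 := h'
            linarith
          all_goals assumption
        · exact fun h ↦ ⟨Or.inr h, Or.inr h⟩
      rw [hi h₁, hi h₂, ← Set.image_inter hφ.injective, hQQ]
      have hφ' := ih (hφ.comp hcz')
      rw [Set.image_comp] at hφ'
      have hk (x : Fin (n + 1) → ℝ) (c : ℝ) : tl (Fin.cons c (tl x)) = tl x := rfl
      -- The deformation shrinks the first coordinate to zero and fixes the others.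
      refine FinHom.of_isEmbedding hφ
        ⟨fun p ↦ Fin.cons ((1 - (p.2 : ℝ)) * (p.1 : Fin (n + 1) → ℝ) 0) (tl p.1), ?_⟩ ?_ ?_ ?_ ?_ hφ'
      · refine Continuous.finCons ?_ (htl.comp (by fun_prop))
        exact (by fun_prop : Continuous fun p : {x | tl x ≠ 0} × unitInterval ↦ 1 - (p.2 : ℝ)).mul
          (h0.comp (by fun_prop))
      · rintro _ ⟨y, hy, rfl⟩
        exact hy
      · intro p
        funext i
        refine Fin.cases ?_ (fun j ↦ ?_) i
        · simp
        · rfl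
      · intro p
        exact p.1.2
      · intro p
        refine ⟨tl p, p.2, ?_⟩
        funext i
        refine Fin.cases ?_ (fun j ↦ ?_) i
        · simp [cz]
        · rfl

/-- Attaching a cell preserves finite generation of homology. -/
lemma FinHom.attach [T2Space X] [IsNoetherianRing R] {ω : MulCocycle X R} {A : Set X}
    (hA : IsClosed A) {n : ℕ} {e : (Fin n → ℝ) → X} {g : X → Fin n → ℝ}
    (he : ContinuousOn e (Metric.closedBall 0 1)) (hg : ContinuousOn g (e '' Metric.ball 0 1))
    (hge : ∀ v ∈ Metric.ball (0 : Fin n → ℝ) 1, g (e v) = v)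
    (hs : ∀ v ∈ Metric.sphere (0 : Fin n → ℝ) 1, e v ∈ A)
    (hb : ∀ v ∈ Metric.ball (0 : Fin n → ℝ) 1, e v ∉ A) (hfin : ω.FinHom A) :
    ω.FinHom (A ∪ e '' Metric.ball 0 1) := by
  set D := Metric.ball (0 : Fin n → ℝ) 1 with hD
  have hbc : D ⊆ Metric.closedBall 0 1 := Metric.ball_subset_closedBall
  have h0D : (0 : Fin n → ℝ) ∈ D := Metric.mem_ball_self one_pos
  have hcase {v : Fin n → ℝ} (hv : v ∈ Metric.closedBall (0 : Fin n → ℝ) 1) :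
      v ∈ D ∨ v ∈ Metric.sphere (0 : Fin n → ℝ) 1 := by
    rw [← Metric.ball_union_sphere] at hv
    exact hv
  -- the open cell as an embedded Euclidean space
  let r : D → X := fun v ↦ e v
  have hr : IsEmbedding r := by
    have hr1 : Continuous r := (continuousOn_iff_continuous_domRestrict.1 (he.mono hbc))
    have hgD (x : e '' D) : g x ∈ D := by
      obtain ⟨_, v, hv, rfl⟩ := x
      rwa [hge v hv]
    let H : D ≃ₜ e '' D :=
      { toFun := fun v ↦ ⟨e v, v, v.2, rfl⟩
        invFun := fun x ↦ ⟨g x, hgD x⟩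
        left_inv := fun v ↦ Subtype.ext (hge v v.2)
        right_inv := by
          rintro ⟨_, v, hv, rfl⟩
          exact Subtype.ext (congrArg e (hge v hv))
        continuous_toFun := hr1.subtype_mk _
        continuous_invFun := (continuousOn_iff_continuous_domRestrict.1 hg).subtype_mk hgD }
    exact IsEmbedding.subtypeVal.comp H.isEmbedding
  let φ : (Fin n → ℝ) → X := r ∘ Homeomorph.unitBall
  have hφ : IsEmbedding φ := hr.comp Homeomorph.unitBall.isEmbedding
  have hφ0 : φ 0 = e 0 := congrArg e Homeomorph.coe_unitBall_apply_zero
  have hφr : φ '' Set.univ = e '' D := by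
    rw [Set.image_univ, Set.range_comp, Homeomorph.unitBall.surjective.range_eq, Set.image_univ]
    ext x
    simp [r]
  have hφp : φ '' {0}ᶜ = e '' D \ {e 0} := by
    rw [Set.compl_eq_univ_sdiff, Set.image_sdiff hφ.injective, hφr, Set.image_singleton, hφ0]
  have h0A : e 0 ∉ A := hb 0 h0D
  set N := (A ∪ e '' D) ∩ {e 0}ᶜ with hN
  have hO₂ : (A ∪ e '' D) ∩ Aᶜ = e '' D := by
    ext x
    constructor
    · rintro ⟨h | h, h'⟩
      exacts [absurd h h', h]
    · rintro ⟨v, hv, rfl⟩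
      exact ⟨Or.inr ⟨v, hv, rfl⟩, hb v hv⟩
  -- One piece is the space without the centre of the cell, which deforms into `A`; the other is the
  -- open cell. Their intersection is the punctured cell.
  refine FinHom.of_cover (O₁ := {e 0}ᶜ) (O₂ := Aᶜ) isOpen_compl_singleton hA.isOpen_compl ?_ ?_ ?_ ?_
  · intro x _
    by_cases hx : x = e 0
    · exact Or.inr (hx ▸ h0A)
    · exact Or.inl hx
  · -- the punctured space retracts onto `A`
    rw [← hN]
    let K := Metric.closedBall (0 : Fin n → ℝ) 1
    have hAN : A ⊆ N := fun x hx ↦ ⟨Or.inl hx, fun h ↦ h0A (h ▸ hx)⟩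
    have heA {v : Fin n → ℝ} (hv : v ∈ K) : e v ∈ A ∪ e '' D :=
      (hcase hv).elim (fun h ↦ Or.inr ⟨v, h, rfl⟩) fun h ↦ Or.inl (hs v h)
    have hne {v : Fin n → ℝ} (hv : v ∈ K) (h : e v ≠ e 0) : v ≠ 0 := fun h' ↦ h (h' ▸ rfl)
    -- A radial push: the norm moves linearly from `‖v‖` to `1`, and vectors of norm `1` stay fixed.
    let k : (Fin n → ℝ) → ℝ → Fin n → ℝ := fun v t ↦ ((1 - t) + t * ‖v‖⁻¹) • v
    have hknorm {v : Fin n → ℝ} (hv : v ≠ 0) {t : ℝ} (ht : t ∈ unitInterval) :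
        ‖k v t‖ = (1 - t) * ‖v‖ + t := by
      have hv' : ‖v‖ ≠ 0 := norm_ne_zero_iff.2 hv
      have h2 : 0 ≤ (1 - t) + t * ‖v‖⁻¹ :=
        add_nonneg (sub_nonneg.2 ht.2) (mul_nonneg ht.1 (inv_nonneg.2 (norm_nonneg _)))
      rw [norm_smul, Real.norm_of_nonneg h2, add_mul, mul_assoc, inv_mul_cancel₀ hv', mul_one]
    have hkK {v : Fin n → ℝ} (hvK : v ∈ K) (hv : v ≠ 0) {t : ℝ} (ht : t ∈ unitInterval) :
        k v t ∈ K := by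
      rw [mem_closedBall_zero_iff] at hvK ⊢
      rw [hknorm hv ht]
      nlinarith [ht.1, ht.2, mul_le_mul_of_nonneg_left hvK (sub_nonneg.2 ht.2)]
    have hk0 {v : Fin n → ℝ} (hv : v ≠ 0) {t : ℝ} (ht : t ∈ unitInterval) : k v t ≠ 0 := by
      rw [← norm_ne_zero_iff, hknorm hv ht]
      have hv' : 0 < ‖v‖ := norm_pos_iff.2 hv
      rcases eq_or_lt_of_le ht.1 with h | h
      · rw [← h]
        simpa using hv
      · have := mul_nonneg (sub_nonneg.2 ht.2) hv'.le
        positivity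
    have hk1 {v : Fin n → ℝ} (hv : v ≠ 0) : k v 1 ∈ Metric.sphere (0 : Fin n → ℝ) 1 := by
      rw [mem_sphere_zero_iff_norm, hknorm hv ⟨zero_le_one, le_rfl⟩]
      simp
    classical
    -- The two formulas agree on the boundary of the cell, where `k` is constant in time; this makes
    -- `hhe` valid on the closed ball.
    let h : X × unitInterval → X := fun p ↦ if p.1 ∈ A then p.1 else e (k (g p.1) p.2)
    have hhe {v : Fin n → ℝ} (hv : v ∈ K) (t : unitInterval) : h (e v, t) = e (k v t) := by
      rcases hcase hv with h' | h'
      · have : e v ∉ A := hb v h'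
        simp only [h, this, if_false, hge v h']
      · have : e v ∈ A := hs v h'
        simp only [h, this, if_true, k]
        rw [mem_sphere_zero_iff_norm.1 h']
        simp
    have hNcase {x : X} (hx : x ∈ N) : x ∈ A ∨ ∃ v ∈ D, v ≠ 0 ∧ e v = x := by
      obtain ⟨h1 | ⟨v, hv, rfl⟩, h2⟩ := hx
      · exact Or.inl h1
      · exact Or.inr ⟨v, hv, fun h' ↦ h2 (h' ▸ rfl), rfl⟩
    have he0 {v : Fin n → ℝ} (hv : v ∈ K) (hv0 : v ≠ 0) : e v ≠ e 0 := by
      intro h'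
      rcases hcase hv with h1 | h1
      · exact hv0 (by rw [← hge v h1, h', hge 0 h0D])
      · exact h0A (h' ▸ hs v h1)
    -- Preimages of closed sets are closed: they are the union of a part in `A` and of an image
    -- under a restriction of `K × I → X × I`, a closed map because `K × I` is compact and the
    -- target is Hausdorff.
    have hcont : Continuous ((N ×ˢ (Set.univ : Set unitInterval)).domRestrict h) := by
      rw [continuous_iff_isClosed]
      intro C hC
      let p : K × unitInterval → X × unitInterval := fun q ↦ (e q.1, q.2)
      have hp : Continuous p :=
        ((continuousOn_iff_continuous_domRestrict.1 he).comp continuous_fst).prodMk continuous_snd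
      have hpc : IsClosedMap ((N ×ˢ (Set.univ : Set unitInterval)).restrictPreimage p) :=
        hp.isClosedMap.restrictPreimage _
      have hp0 (q : p ⁻¹' (N ×ˢ (Set.univ : Set unitInterval))) : (q.1.1 : Fin n → ℝ) ≠ 0 :=
        hne q.1.1.2 q.2.1.2
      have hcl : IsClosed {q : p ⁻¹' (N ×ˢ (Set.univ : Set unitInterval)) |
          e (k q.1.1 q.1.2) ∈ C} := by
        refine hC.preimage (he.comp_continuous ?_ fun q ↦ hkK q.1.1.2 (hp0 q) q.1.2.2)
        have hv : Continuous fun q : p ⁻¹' (N ×ˢ (Set.univ : Set unitInterval)) ↦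
          (q.1.1 : Fin n → ℝ) := by fun_prop
        have ht : Continuous fun q : p ⁻¹' (N ×ˢ (Set.univ : Set unitInterval)) ↦
          (q.1.2 : ℝ) := by fun_prop
        exact ((continuous_const.sub ht).add (ht.mul (hv.norm.inv₀ fun q ↦
          norm_ne_zero_iff.2 (hp0 q)))).smul hv
      have hunion : (N ×ˢ (Set.univ : Set unitInterval)).domRestrict h ⁻¹' C =
          {q | q.1.1 ∈ A ∩ C} ∪ (N ×ˢ (Set.univ : Set unitInterval)).restrictPreimage p ''
            {q | e (k q.1.1 q.1.2) ∈ C} := by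
        ext ⟨⟨x, t⟩, hx⟩
        constructor
        · intro hxC
          have hxC' : h (x, t) ∈ C := hxC
          rcases hNcase hx.1 with hxA | ⟨v, hv, hv0, rfl⟩
          · left
            refine ⟨hxA, ?_⟩
            simpa [h, hxA] using hxC'
          · right
            refine ⟨⟨(⟨v, hbc hv⟩, t), hx⟩, ?_, rfl⟩
            rw [hhe (hbc hv)] at hxC'
            exact hxC'
        · rintro (⟨hxA, hxC⟩ | ⟨⟨⟨⟨v, hv⟩, t'⟩, hq⟩, hqC, hqx⟩)
          · change h (x, t) ∈ C
            simpa [h, show x ∈ A from hxA] using hxC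
          · have h1 : (e v, t') = (x, t) := congrArg Subtype.val hqx
            change h (x, t) ∈ C
            rw [← h1, hhe hv]
            exact hqC
      rw [hunion]
      refine IsClosed.union ?_ (hpc _ hcl)
      exact (hA.inter hC).preimage (continuous_fst.comp continuous_subtype_val)
    let H : C(N × unitInterval, X) :=
      ⟨fun q ↦ (N ×ˢ (Set.univ : Set unitInterval)).domRestrict h ⟨(q.1, q.2), q.1.2, trivial⟩,
        hcont.comp (by fun_prop)⟩
    have hH0 : (fun y : N ↦ H (y, 0)) = Subtype.val := by
      funext x
      change h (x, 0) = x
      rcases hNcase x.2 with hxA | ⟨v, hv, hv0, hvx⟩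
      · simp [h, hxA]
      · rw [← hvx, hhe (hbc hv)]
        simp [k]
    refine FinHom.of_homotopy hAN H ?_ ?_ ?_ ?_ hfin
    · rw [hH0]
      exact IsEmbedding.subtypeVal
    · rw [hH0, Subtype.range_coe]
    · rintro ⟨x, t⟩
      change h (x, t) ∈ N
      rcases hNcase x.2 with hxA | ⟨v, hv, hv0, hvx⟩
      · simp [h, hxA, hAN hxA]
      · rw [← hvx, hhe (hbc hv)]
        exact ⟨heA (hkK (hbc hv) hv0 t.2), he0 (hkK (hbc hv) hv0 t.2) (hk0 hv0 t.2)⟩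
    · intro x
      change h (x, 1) ∈ A
      rcases hNcase x.2 with hxA | ⟨v, hv, hv0, hvx⟩
      · simp [h, hxA]
      · rw [← hvx, hhe (hbc hv)]
        exact hs _ (hk1 hv0)
  · rw [hO₂, ← hφr]
    exact FinHom.of_starConvex hφ (Set.mem_univ 0) (fun _ _ _ _ _ _ _ ↦ trivial)
  · have h3 : N ∩ ((A ∪ e '' D) ∩ Aᶜ) = φ '' {0}ᶜ := by
      rw [hO₂, hφp]
      ext x
      constructor
      · rintro ⟨h1, h2⟩
        exact ⟨h2, h1.2⟩
      · rintro ⟨h1, h2⟩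
        exact ⟨⟨Or.inr h1, h2⟩, h1⟩
    rw [h3]
    exact FinHom.punctured ω n hφ

end MulCocycle

/-! ### Induction over the cells of a finite subcomplex -/

section CW

open CWComplex

variable {X : Type*} [TopologicalSpace X] [T2Space X] {R : Type*} [CommRing R] [IsNoetherianRing R]
  {C : Set X} [CWComplex C]

/-- The hypothesis `hJ` says that the cells form a subcomplex. A cell of maximal dimension can be
removed: all frontiers of cells in `J` lie in lower skeleta and avoid it. What remains is a finite
union of closed cells, hence closed, and `attach` puts the cell back. -/
lemma MulCocycle.FinHom.of_cells (ω : MulCocycle X R) (J : Finset (Σ n, cell C n))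
    (hJ : ∀ c ∈ J, closedCell c.1 c.2 ⊆ ⋃ c ∈ J, openCell c.1 c.2) :
    ω.FinHom (⋃ c ∈ J, openCell c.1 c.2) := by
  classical
  induction hN : J.card generalizing J with
  | zero =>
    rw [Finset.card_eq_zero] at hN
    subst hN
    exact FinHom.of_subsingleton ω (by simp)
  | succ N ih =>
    obtain ⟨c, hc, hmax⟩ := J.exists_max_image (fun c ↦ c.1) (Finset.card_pos.1 (by lia))
    have hfr : ∀ b ∈ J, cellFrontier b.1 b.2 ⊆ ⋃ c' ∈ J.erase c, openCell c'.1 c'.2 := by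
      intro b hbJ x hx
      have h1 := hJ b hbJ (cellFrontier_subset_closedCell _ _ hx)
      simp only [Set.mem_iUnion] at h1
      obtain ⟨c', hc', hxc'⟩ := h1
      simp only [Set.mem_iUnion]
      refine ⟨c', Finset.mem_erase.2 ⟨?_, hc'⟩, hxc'⟩
      rintro rfl
      refine Set.disjoint_left.1 (disjoint_skeletonLT_openCell (n := b.1) (j := c'.2) ?_)
        (cellFrontier_subset_skeletonLT _ _ hx) hxc'
      exact_mod_cast hmax b hbJ
    have hcl : ∀ b ∈ J.erase c, closedCell b.1 b.2 ⊆ ⋃ c' ∈ J.erase c, openCell c'.1 c'.2 := by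
      intro b hb
      rw [← cellFrontier_union_openCell_eq_closedCell]
      exact Set.union_subset (hfr b (Finset.mem_of_mem_erase hb))
        (Set.subset_biUnion_of_mem (u := fun c' : Σ n, cell C n ↦ openCell c'.1 c'.2) hb)
    have hfin := ih (J.erase c) hcl (by rw [Finset.card_erase_of_mem hc]; lia)
    have hclosed : IsClosed (⋃ c' ∈ J.erase c, openCell c'.1 c'.2) := by
      have : (⋃ c' ∈ J.erase c, openCell c'.1 c'.2) =
          ⋃ c' ∈ J.erase c, closedCell c'.1 c'.2 :=
        subset_antisymm (Set.iUnion₂_mono fun _ _ ↦ openCell_subset_closedCell _ _)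
          (Set.iUnion₂_subset hcl)
      rw [this]
      exact (J.erase c).finite_toSet.isClosed_biUnion fun _ _ ↦ isClosed_closedCell
    have hsplit : (⋃ c' ∈ J, openCell c'.1 c'.2) =
        (⋃ c' ∈ J.erase c, openCell c'.1 c'.2) ∪ map c.1 c.2 '' Metric.ball 0 1 := by
      conv_lhs => rw [← Finset.insert_erase hc]
      rw [Finset.set_biUnion_insert, Set.union_comm]
      rfl
    rw [hsplit]
    have hsource := source_eq c.1 c.2
    refine FinHom.attach hclosed (g := (map c.1 c.2).symm) (continuousOn c.1 c.2) ?_ ?_ ?_ ?_ hfin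
    · rw [← hsource, (map c.1 c.2).image_source_eq_target]
      exact continuousOn_symm c.1 c.2
    · intro v hv
      exact (map c.1 c.2).left_inv (hsource ▸ hv)
    · intro v hv
      exact hfr c hc ⟨v, hv, rfl⟩
    · intro v hv hmem
      simp only [Set.mem_iUnion] at hmem
      obtain ⟨c', hc', hx⟩ := hmem
      exact Set.disjoint_left.1 (disjoint_openCell_of_ne (Finset.ne_of_mem_erase hc')) hx
        ⟨v, hv, rfl⟩

lemma MulCocycle.FinHom.of_subcomplex (ω : MulCocycle X R) [CWComplex.Finite C]
    (E : CWComplex.Subcomplex C) : ω.FinHom (E : Set X) := by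
  classical
  have : _root_.Finite (Σ n, cell C n) := RelCWComplex.finite_cells_of_finite
  have := Fintype.ofFinite (Σ n, cell C n)
  have hE : (⋃ c ∈ (Finset.univ.filter fun c : Σ n, cell C n ↦ c.2 ∈ E.I c.1),
      openCell c.1 c.2) = (E : Set X) := by
    rw [← CWComplex.Subcomplex.union]
    ext x
    simp
  rw [← hE]
  refine FinHom.of_cells ω _ fun c hc ↦ ?_
  rw [hE]
  exact CWComplex.Subcomplex.closedCell_subset_of_mem E (Finset.mem_filter.1 hc).2

end CW

/-! ## The cocycle of a local system -/

section Monodromy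

variable {X : Type*} [TopologicalSpace X] {x₀ : X} {R : Type*} [CommRing R]

lemma monodromy_congr_fun (ρ : FundamentalGroup X x₀ →* R) {a b a' b' : X} (p : Path a b)
    (q : Path a' b') (h : ∀ t, p t = q t) : monodromy ρ p = monodromy ρ q := by
  obtain rfl : a = a' := by simpa using h 0
  obtain rfl : b = b' := by simpa using h 1
  rw [show p = q from Path.ext (funext h)]

lemma monodromy_congr (ρ : FundamentalGroup X x₀ →* R) {a b : X} {p q : Path a b}
    (h : p.Homotopic q) : monodromy ρ p = monodromy ρ q := by
  unfold monodromy
  split_ifs with ha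
  · congr 2
    exact Path.Homotopic.Quotient.eq.2 (((Path.Homotopic.refl _).hcomp h).hcomp (.refl _))
  · rfl

lemma monodromy_refl (ρ : FundamentalGroup X x₀ →* R) (a : X) :
    monodromy ρ (Path.refl a) = 1 := by
  unfold monodromy
  split_ifs with ha
  · rw [← map_one ρ]
    congr 1
    simp only [Path.Homotopic.Quotient.mk_trans, Path.Homotopic.Quotient.mk_symm,
      Path.Homotopic.Quotient.mk_refl, Path.Homotopic.Quotient.trans_refl,
      Path.Homotopic.Quotient.trans_symm]
    rfl
  · rfl

/-- The chosen path to the middle point is run through back and forth, and cancels. Since `R` is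
commutative, the order of the factors can be adapted to the multiplication of `FundamentalGroup`. -/
lemma monodromy_trans (ρ : FundamentalGroup X x₀ →* R) {a b c : X} (p : Path a b) (q : Path b c) :
    monodromy ρ (p.trans q) = monodromy ρ p * monodromy ρ q := by
  by_cases ha : Joined x₀ a
  · have hb : Joined x₀ b := ha.trans ⟨p⟩
    unfold monodromy
    rw [dif_pos ha, dif_pos ha, dif_pos hb, mul_comm, ← map_mul, FundamentalGroup.mul_def]
    congr 1
    simp only [Path.Homotopic.Quotient.mk_trans, Path.Homotopic.Quotient.mk_symm,
      Path.Homotopic.Quotient.trans_assoc]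
    rw [← Path.Homotopic.Quotient.trans_assoc (Path.Homotopic.Quotient.symm _)
      (Path.Homotopic.Quotient.mk _), Path.Homotopic.Quotient.symm_trans,
      Path.Homotopic.Quotient.refl_trans]
  · have hb : ¬ Joined x₀ b := fun hb ↦ ha (hb.trans ⟨p.symm⟩)
    unfold monodromy
    rw [dif_neg ha, dif_neg ha, dif_neg hb, one_mul]

instance stdSimplex.simplyConnectedSpace {ι : Type*} [Fintype ι] [Nonempty ι] :
    SimplyConnectedSpace (stdSimplex ℝ ι) := by
  classical
  have := (convex_stdSimplex ℝ ι).contractibleSpace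
    ⟨_, single_mem_stdSimplex ℝ (Classical.arbitrary ι)⟩
  infer_instance

namespace SingularSimplex

lemma edge_apply {n : ℕ} (σ : SingularSimplex X (n + 1)) (t : unitInterval) :
    σ.edge t = σ (stdMap (m := 1) ![0, 1] (stdSimplexHomeomorphUnitInterval.symm t)) := rfl

lemma edge_comp_stdMap_apply {n : ℕ} (τ : SingularSimplex X n) (f : Fin 2 → Fin (n + 1))
    (t : unitInterval) : edge (n := 0) (τ.comp (stdMap (m := 1) f)) t =
      τ (stdMap (m := 1) f (stdSimplexHomeomorphUnitInterval.symm t)) := by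
  rw [edge_apply]
  have h : stdMap (m := 1) (n := 1) ![0, 1] = ContinuousMap.id _ := by
    rw [stdMap_eq_affineSimplex, show (![0, 1] : Fin 2 → Fin 2) = id by
      funext i; fin_cases i <;> rfl]
    exact affineSimplex_vertex_eq_id
  change τ (stdMap (m := 1) f (stdMap (m := 1) (n := 1) ![0, 1] _)) = _
  rw [h]
  rfl

end SingularSimplex

/-- The straight edge between two vertices of a standard simplex. -/
noncomputable def vertexPath {n : ℕ} (i j : Fin (n + 1)) :
    Path (stdSimplex.vertex (S := ℝ) i) (stdSimplex.vertex (S := ℝ) j) :=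
  (SingularSimplex.edge (n := 0) (SingularSimplex.stdMap (m := 1) (n := n) ![i, j])).cast
    (by
      rw [SingularSimplex.vert, stdMap_eq_affineSimplex, affineSimplex_vertex]
      rfl)
    (by
      rw [SingularSimplex.vert, stdMap_eq_affineSimplex, affineSimplex_vertex]
      rfl)

lemma monodromy_edge_comp (ρ : FundamentalGroup X x₀ →* R) {n : ℕ} (τ : SingularSimplex X n)
    (i j : Fin (n + 1)) :
    monodromy ρ (SingularSimplex.edge (n := 0)
      (τ.comp (SingularSimplex.stdMap (m := 1) ![i, j]))) =
      monodromy ρ ((vertexPath i j).map τ.continuous) := by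
  refine monodromy_congr_fun ρ _ _ fun t ↦ ?_
  rw [SingularSimplex.edge_comp_stdMap_apply]
  change _ = τ (SingularSimplex.edge (n := 0) (SingularSimplex.stdMap (m := 1) ![i, j]) t)
  rw [← ContinuousMap.id_comp (SingularSimplex.stdMap (m := 1) ![i, j]),
    SingularSimplex.edge_comp_stdMap_apply]
  rfl

/-- The multiplicative cocycle of a local system of rank one. -/
noncomputable def monodromyCocycle (ρ : FundamentalGroup X x₀ →* R) : MulCocycle X R where
  weight σ := monodromy ρ (SingularSimplex.edge (n := 0) σ)
  weight_const x := by
    rw [← monodromy_refl ρ x]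
    exact monodromy_congr_fun ρ _ _ fun t ↦ rfl
  weight_mul τ := by
    rw [monodromy_edge_comp, monodromy_edge_comp, monodromy_edge_comp, ← monodromy_trans,
      ← Path.map_trans]
    -- The standard simplex is simply connected, so two edges in succession are homotopic to the
    -- third one.
    exact monodromy_congr ρ ((SimplyConnectedSpace.paths_homotopic _ _).map τ)

lemma singularBoundary_eq_bd (ρ : FundamentalGroup X x₀ →* R) (n : ℕ) :
    singularBoundary ρ n = (monodromyCocycle ρ).bd n := by
  refine MulCocycle.chain_hom_ext fun σ ↦ ?_
  rw [MulCocycle.bd_single, one_smul, singularBoundary, Finsupp.lift_apply,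
    Finsupp.sum_single_index (by simp), one_smul]
  congr 2
  refine monodromy_congr_fun ρ _ _ fun t ↦ ?_
  rw [SingularSimplex.edge_comp_stdMap_apply]
  rfl

/-! ## Finiteness of the homology of a pair -/

/-- The subquotient embeds in the image of `F` modulo `B`, which is a Noetherian module. -/
lemma Submodule.finite_subquotient {M : Type*} [AddCommGroup M] [Module R M] [IsNoetherianRing R]
    {Z B F : Submodule R M} (hF : F.FG) (h : Z ≤ F ⊔ B) : Module.Finite R (Subquotient Z B) := by
  let f : Subquotient Z B →ₗ[R] M ⧸ B := Submodule.mapQ _ _ Z.subtype le_rfl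
  have hf : Function.Injective f := by
    rw [← LinearMap.ker_eq_bot, eq_bot_iff]
    intro x hx
    obtain ⟨z, rfl⟩ := Submodule.Quotient.mk_surjective _ x
    have hz : (Submodule.Quotient.mk (z : M) : M ⧸ B) = 0 := hx
    rw [Submodule.Quotient.mk_eq_zero] at hz
    exact (Submodule.Quotient.mk_eq_zero _).2 hz
  have hfg : (F.map B.mkQ).FG := hF.map _
  have hle : LinearMap.range f ≤ F.map B.mkQ := by
    rintro _ ⟨x, rfl⟩
    obtain ⟨z, rfl⟩ := Submodule.Quotient.mk_surjective _ x
    obtain ⟨u, hu, b, hb, hub⟩ := Submodule.mem_sup.1 (h z.2)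
    refine ⟨u, hu, ?_⟩
    change (Submodule.Quotient.mk u : M ⧸ B) = Submodule.Quotient.mk (z : M)
    rw [Submodule.Quotient.eq, ← hub]
    simpa using hb
  have : Module.Finite R (LinearMap.range f) := Module.Finite.iff_fg.2 (hfg.of_le hle)
  exact Module.Finite.equiv (LinearEquiv.ofInjective f hf).symm

/-- This is the exactness of `H_n(X) → H_n(X, A) → H_(n-1)(A)` at the level of chains. Modulo
boundaries in `A`, the boundary of a relative cycle lies in the finitely generated module `G ⊓ range
∂`. Subtracting a lift in `Q` and a chain in `A` leaves an absolute cycle. -/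
lemma localHomology_finite [IsNoetherianRing R] (ρ : FundamentalGroup X x₀ →* R) {A : Set X}
    (hX : (monodromyCocycle ρ).FinHom Set.univ) (hA : (monodromyCocycle ρ).FinHom A) (n : ℕ) :
    Module.Finite R (LocalHomology ρ A n) := by
  set ω := monodromyCocycle ρ
  have htop (k) : chainsIn R (Set.univ : Set X) k = ⊤ := by
    rw [chainsIn, ← Finsupp.supported_univ]
    congr 1
    exact Set.eq_univ_of_forall fun σ ↦ Set.subset_univ _
  obtain ⟨F, hF, hle⟩ := hX n
  rw [htop, htop, inf_top_eq, Submodule.map_top, ← singularBoundary_eq_bd] at hle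
  have hle' : ω.cycles n ≤ F ⊔ relBoundaries ρ A n := hle.trans (sup_le_sup_left le_sup_left F)
  cases n with
  | zero => exact Submodule.finite_subquotient hF hle'
  | succ n =>
    obtain ⟨G, hG, hleA⟩ := hA n
    obtain ⟨Q, -, hQ, hGQ⟩ := MulCocycle.exists_fg_le_map (ω.bd n)
      (hG.of_le (inf_le_left : G ⊓ LinearMap.range (ω.bd n) ≤ G)) (P := ⊤)
      (by rw [Submodule.map_top]; exact inf_le_right)
    refine Submodule.finite_subquotient (hF.sup hQ) fun z hz ↦ ?_
    have hz' : ω.bd n z ∈ chainsIn R A n := by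
      rw [← singularBoundary_eq_bd]
      exact hz
    obtain ⟨g, hg, _, ⟨c, hc, rfl⟩, hgc⟩ := Submodule.mem_sup.1 (hleA ⟨ω.bd_mem_cycles n z, hz'⟩)
    obtain ⟨q, hq, hqg⟩ := hGQ ⟨hg, z - c, by rw [map_sub, ← hgc, add_sub_cancel_right]⟩
    have hcyc : z - c - q ∈ ω.cycles (n + 1) := by
      change ω.bd n _ = 0
      rw [map_sub, map_sub, hqg, ← hgc]
      abel
    rw [show z = (z - c - q) + q + c by abel]
    refine add_mem (add_mem ?_ (Submodule.mem_sup_left (Submodule.mem_sup_right hq))) ?_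
    · exact sup_le_sup_right le_sup_left (relBoundaries ρ A (n + 1)) (hle' hcyc)
    · exact Submodule.mem_sup_right (Submodule.mem_sup_right hc)

/-- The twisted homology of a finite CW pair over a Noetherian ring is finitely generated. -/
lemma localHomology_finite_of_subcomplex [T2Space X] [CWComplex (Set.univ : Set X)]
    [CWComplex.Finite (Set.univ : Set X)] [IsNoetherianRing R]
    (E : CWComplex.Subcomplex (Set.univ : Set X)) (ρ : FundamentalGroup X x₀ →* R) (n : ℕ) :
    Module.Finite R (LocalHomology ρ (E : Set X) n) := by
  refine localHomology_finite ρ ?_ (MulCocycle.FinHom.of_subcomplex _ E) n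
  have h := MulCocycle.FinHom.of_subcomplex (monodromyCocycle ρ)
    (CWComplex.skeleton (Set.univ : Set X) ⊤)
  rwa [CWComplex.skeleton_top] at h

/-! ## Change of coefficients -/

variable {S : Type*} [CommRing S]

/-- The change of coefficients of singular chains. -/
noncomputable def chainMap (f : R →+* S) (n : ℕ) :
    SingularChain X R n →ₛₗ[f] SingularChain X S n where
  toFun := Finsupp.mapRange f (map_zero f)
  map_add' := Finsupp.mapRange_add (map_add f)
  map_smul' r c := by
    ext σ
    simp

lemma chainMap_single (f : R →+* S) (n : ℕ) (σ : SingularSimplex X n) (r : R) :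
    chainMap f n (Finsupp.single σ r) = Finsupp.single σ (f r) :=
  Finsupp.mapRange_single (hf := map_zero f)

lemma chainMap_singularBoundary (f : R →+* S) {ρ : FundamentalGroup X x₀ →* R}
    {ρ' : FundamentalGroup X x₀ →* S} (hρ : ∀ g, ρ' g = f (ρ g)) (n : ℕ)
    (c : SingularChain X R (n + 1)) :
    chainMap f n (singularBoundary ρ n c) = singularBoundary ρ' n (chainMap f (n + 1) c) := by
  have hm {a b : X} (p : Path a b) : f (monodromy ρ p) = monodromy ρ' p := by
    unfold monodromy
    split_ifs
    · exact (hρ _).symm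
    · exact map_one f
  induction c using Finsupp.induction_linear with
  | zero => simp
  | add x y hx hy => rw [map_add, map_add, map_add, map_add, hx, hy]
  | single σ r =>
    rw [chainMap_single, singularBoundary, singularBoundary, Finsupp.lift_apply,
      Finsupp.sum_single_index (by simp), Finsupp.lift_apply, Finsupp.sum_single_index (by simp),
      LinearMap.map_smulₛₗ, map_add, map_sum]
    simp only [chainMap_single, hm, map_pow, map_neg, map_one]

lemma chainMap_mem (f : R →+* S) {A : Set X} {n : ℕ} {c : SingularChain X R n}
    (hc : c ∈ chainsIn R A n) : chainMap f n c ∈ chainsIn S A n :=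
  fun _ hσ ↦ hc (Finsupp.support_mapRange (hf := map_zero f) hσ)

lemma exists_chainMap_eq {f : R →+* S} (hf : Function.Surjective f) {A : Set X} {n : ℕ}
    {c : SingularChain X S n} (hc : c ∈ chainsIn S A n) :
    ∃ b ∈ chainsIn R A n, chainMap f n b = c := by
  classical
  choose g hg using hf
  -- The section must send `0` to `0`, so that lifting does not enlarge the support of a chain.
  let g' : S → R := fun s ↦ if s = 0 then 0 else g s
  have h0 : g' 0 = 0 := if_pos rfl
  refine ⟨Finsupp.mapRange g' h0 c, fun _ hσ ↦ hc (Finsupp.support_mapRange (hf := h0) hσ), ?_⟩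
  ext σ
  change f (if c σ = 0 then 0 else g (c σ)) = c σ
  split_ifs with h
  · rw [map_zero, h]
  · exact hg _

lemma exists_smul_of_chainMap_eq_zero {f : R →+* S} {a : R}
    (hker : ∀ r, f r = 0 → a ∣ r) {n : ℕ} {c : SingularChain X R n} (hc : chainMap f n c = 0) :
    ∃ b, c = a • b := by
  classical
  have h (σ) : ∃ s, c σ = a * s := hker _ (DFunLike.congr_fun hc σ)
  choose g hg using h
  refine ⟨Finsupp.onFinset c.support (fun σ ↦ if c σ = 0 then 0 else g σ) fun σ hσ ↦ ?_, ?_⟩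
  · rw [Finsupp.mem_support_iff]
    intro h
    exact hσ (if_pos h)
  · ext σ
    rw [Finsupp.smul_apply, Finsupp.onFinset_apply, smul_eq_mul]
    split_ifs with h
    · rw [h, mul_zero]
    · exact hg σ

lemma Subquotient.exists_map {M M' : Type*} [AddCommGroup M] [Module R M] [AddCommGroup M']
    [Module S M'] {f : R →+* S} (g : M →ₛₗ[f] M') {Z B : Submodule R M} {Z' B' : Submodule S M'}
    (hZ : ∀ z ∈ Z, g z ∈ Z') (hB : ∀ z ∈ B, g z ∈ B') {a : R}
    (h : ∀ z ∈ Z, g z ∈ B' → ∃ u ∈ Z, z - a • u ∈ B) :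
    ∃ j : Subquotient Z B →ₛₗ[f] Subquotient Z' B', ∀ x, j x = 0 → ∃ y, x = a • y := by
  let g' : Z →ₛₗ[f] Z' := (g.comp Z.subtype).codRestrict _ fun z ↦ hZ z z.2
  have hg' : B.submoduleOf Z ≤ (B'.submoduleOf Z').comap g' := fun z hz ↦ hB z hz
  refine ⟨Submodule.mapQ _ _ g' hg', fun x hx ↦ ?_⟩
  obtain ⟨z, rfl⟩ := Submodule.Quotient.mk_surjective _ x
  have hz : g z ∈ B' := (Submodule.Quotient.mk_eq_zero (B'.submoduleOf Z') (x := g' z)).1 hx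
  obtain ⟨u, hu, hzu⟩ := h z z.2 hz
  exact ⟨Submodule.Quotient.mk (p := B.submoduleOf Z) ⟨u, hu⟩,
    (Submodule.Quotient.eq (B.submoduleOf Z) (y := a • ⟨u, hu⟩)).2 hzu⟩

/-- A surjective change of coefficients with principal kernel generated by `a` induces a map in
homology whose kernel consists of multiples of `a`. -/
lemma exists_homologyMap {f : R →+* S} (hf : Function.Surjective f) {a : R}
    (hker : ∀ r, f r = 0 → a ∣ r) (ha : a = 0 ∨ a ∈ nonZeroDivisors R)
    {ρ : FundamentalGroup X x₀ →* R} {ρ' : FundamentalGroup X x₀ →* S}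
    (hρ : ∀ g, ρ' g = f (ρ g)) (A : Set X) (n : ℕ) :
    ∃ j : LocalHomology ρ A n →ₛₗ[f] LocalHomology ρ' A n, ∀ x, j x = 0 → ∃ y, x = a • y := by
  refine Subquotient.exists_map (chainMap f n) (fun z hz ↦ ?_) (fun z hz ↦ ?_) fun z hz hz' ↦ ?_
  · cases n with
    | zero => trivial
    | succ n =>
      change singularBoundary ρ' n _ ∈ chainsIn S A n
      rw [← chainMap_singularBoundary f hρ]
      exact chainMap_mem f hz
  · obtain ⟨_, ⟨w, rfl⟩, c, hc, hwc⟩ := Submodule.mem_sup.1 hz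
    rw [← hwc, map_add, chainMap_singularBoundary f hρ]
    exact Submodule.add_mem_sup ⟨_, rfl⟩ (chainMap_mem f hc)
  · obtain ⟨_, ⟨w', rfl⟩, c', hc', hwc⟩ := Submodule.mem_sup.1 hz'
    obtain ⟨w, -, rfl⟩ := exists_chainMap_eq hf (A := Set.univ) (c := w')
      fun σ _ ↦ Set.subset_univ _
    obtain ⟨c, hc, rfl⟩ := exists_chainMap_eq hf hc'
    have hb : singularBoundary ρ n w + c ∈ relBoundaries ρ A n :=
      Submodule.add_mem_sup ⟨w, rfl⟩ hc
    obtain ⟨u, hu⟩ := exists_smul_of_chainMap_eq_zero hker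
      (c := z - (singularBoundary ρ n w + c)) (by
        rw [map_sub, map_add, chainMap_singularBoundary f hρ, hwc, sub_self])
    -- If `a = 0`, then `f` is injective and the relative boundary lifts as it is; this case serves
    -- `Λ_0 = ℤ`.
    rcases ha with rfl | ha
    · refine ⟨0, zero_mem _, ?_⟩
      rw [zero_smul, sub_eq_zero] at hu
      rwa [smul_zero, sub_zero, hu]
    refine ⟨u, ?_, by rwa [← hu, sub_sub_cancel]⟩
    cases n with
    | zero => trivial
    | succ n =>
      change singularBoundary ρ n u ∈ chainsIn R A n
      -- The multiple `a • ∂u` is carried by `A`. As `a` is not a zero divisor, so is `∂u`, and `u`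
      -- is a relative cycle.
      have h1 : a • singularBoundary ρ n u ∈ chainsIn R A n := by
        rw [← map_smul, ← hu, map_sub, map_add, singularBoundary_eq_bd, singularBoundary_eq_bd,
          MulCocycle.bd_bd, zero_add]
        refine sub_mem ?_ (MulCocycle.bd_mem _ hc)
        rw [← singularBoundary_eq_bd]
        exact hz
      intro σ hσ
      refine h1 ?_
      rw [Finset.mem_coe, Finsupp.mem_support_iff] at hσ ⊢
      rw [Finsupp.smul_apply, smul_eq_mul]
      exact fun h ↦ hσ ((mul_left_mem_nonZeroDivisors_eq_zero_iff ha).1 h)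

end Monodromy

/-! ### Annihilators from the Cayley-Hamilton theorem -/

section Annihilators

variable {R R' : Type*} [CommRing R] [CommRing R'] {M : Type*} [AddCommGroup M] [Module R M]

/-- Since `r M ⊆ a M`, Cayley-Hamilton gives a monic `p` with lower coefficients in `(a)` such that
`p(r)` kills `M`. As `f a = 0`, the polynomial `p` becomes a power of `X` under `f`. -/
lemma exists_annihilator_of_smul_eq [Module.Finite R M] (f : R →+* R') {a r : R} (ha : f a = 0)
    (h : ∀ m : M, ∃ m' : M, r • m = a • m') :
    ∃ (n : ℕ) (q : R), f q = f r ^ n ∧ ∀ m : M, q • m = 0 := by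
  obtain ⟨p, hp, hdeg, hcoeff, hann⟩ :=
    LinearMap.exists_monic_and_natDegree_eq_and_coeff_mem_pow_and_aeval_eq_zero
      R (algebraMap R (Module.End R M) r) (Ideal.span {a}) (by
        rintro _ ⟨m, rfl⟩
        obtain ⟨m', h'⟩ := h m
        rw [Module.algebraMap_end_apply, h']
        exact Submodule.smul_mem_smul (Ideal.mem_span_singleton_self a) trivial)
  refine ⟨p.natDegree, p.eval r, ?_, fun m ↦ ?_⟩
  · have hmap : p.map f = Polynomial.X ^ p.natDegree := by
      ext k
      rw [Polynomial.coeff_map, Polynomial.coeff_X_pow]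
      split_ifs with hk
      · rw [hk, hp.coeff_natDegree, map_one]
      · rcases lt_or_gt_of_ne hk with hk | hk
        · have h1 := Ideal.pow_le_self (Nat.sub_ne_zero_of_lt hk) (hcoeff k)
          obtain ⟨c, hc⟩ := Ideal.mem_span_singleton.1 h1
          rw [hc, map_mul, ha, zero_mul]
        · rw [Polynomial.coeff_eq_zero_of_natDegree_lt hk, map_zero]
    rw [← Polynomial.eval_map_apply, hmap, Polynomial.eval_pow, Polynomial.eval_X]
  · rw [Polynomial.aeval_algebraMap_apply_eq_algebraMap_eval] at hann
    exact LinearMap.congr_fun hann m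

/-- The product of the multipliers of finitely many generators works; its image is nonzero because
`R'` is a domain. -/
lemma exists_common_multiplier [Module.Finite R M] [IsDomain R'] (f : R →+* R') {a : R}
    (h : ∀ m : M, ∃ r : R, f r ≠ 0 ∧ ∃ m' : M, r • m = a • m') :
    ∃ r : R, f r ≠ 0 ∧ ∀ m : M, ∃ m' : M, r • m = a • m' := by
  classical
  obtain ⟨S, hS⟩ := Module.Finite.fg_top (R := R) (M := M)
  choose r hr m' hm' using h
  refine ⟨∏ y ∈ S, r y, by
    rw [map_prod]; exact Finset.prod_ne_zero_iff.2 fun y _ ↦ hr y, fun m ↦ ?_⟩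
  have hm : m ∈ Submodule.span R (S : Set M) := hS ▸ trivial
  induction hm using Submodule.span_induction with
  | mem y hy =>
    obtain ⟨c, hc⟩ := Finset.dvd_prod_of_mem r hy
    exact ⟨c • m' y, by rw [hc, mul_comm, mul_smul, hm', smul_comm]⟩
  | zero => exact ⟨0, by simp⟩
  | add y z _ _ hy hz =>
    obtain ⟨y', hy⟩ := hy
    obtain ⟨z', hz⟩ := hz
    exact ⟨y' + z', by rw [smul_add, smul_add, hy, hz]⟩
  | smul c y _ hy =>
    obtain ⟨y', hy⟩ := hy
    exact ⟨c • y', by rw [smul_comm, hy, smul_comm]⟩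

end Annihilators

/-! ### Specialization of ranks and of torsion -/

section Specialization

lemma rank_eq_of_smul_mem {R H : Type*} [CommRing R] [IsDomain R] [AddCommGroup H] [Module R H]
    {N : Submodule R H} {q : R} (hq : q ≠ 0)
    (h : ∀ y : H, q • y ∈ N) :
    Module.rank R N = Module.rank R H := by
  have h0 : Module.rank R (H ⧸ N) = 0 := by
    rw [rank_eq_zero_iff]
    intro m
    obtain ⟨y, rfl⟩ := N.mkQ_surjective m
    exact ⟨q, hq, by rw [← map_smul]; exact (Submodule.Quotient.mk_eq_zero N).2 (h y)⟩
  rw [← rank_quotient_add_rank_of_isDomain N, h0, zero_add]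

variable {R R' : Type*} [CommRing R] [CommRing R'] [IsDomain R']
  {H H' : Type*} [AddCommGroup H] [Module R H] [AddCommGroup H'] [Module R' H']
  [Module.Finite R H] {f : R →+* R'} {a : R} {l : ℕ}

/-- A finite module `H` over `R` whose specialization along `R → R' = R ⧸ a` embeds into `H'`
contains a submodule generated by at most `rank H'` elements with a quotient that is annihilated
by an element which does not specialize to zero. -/
lemma exists_generators_of_specialization (hf : Function.Surjective f) (hfa : f a = 0)
    (hrank : Module.rank R' H' ≤ l) (j : H →ₛₗ[f] H') (hj : ∀ x, j x = 0 → ∃ y, x = a • y) :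
    ∃ (d : ℕ) (x : Fin d → H) (q : R), d ≤ l ∧ f q ≠ 0 ∧
      ∀ y, q • y ∈ Submodule.span R (Set.range x) := by
  classical
  let Q : ℕ → Prop := fun d ↦ ∃ x : Fin d → H, LinearIndependent R' (j ∘ x)
  have hQ : ∀ d, Q d → d ≤ l := by
    rintro d ⟨x, hx⟩
    have := hx.cardinal_lift_le_rank
    simp only [Cardinal.mk_fin, Cardinal.lift_natCast] at this
    have h2 := this.trans (Cardinal.lift_le.2 hrank)
    simpa using h2
  have hQ0 : Q 0 := ⟨Fin.elim0, linearIndependent_empty_type⟩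
  -- A family in `H` whose image in `H'` is independent, of maximal length; the rank of `H'` bounds
  -- this length.
  obtain ⟨d, ⟨x, hx⟩, hmax⟩ : ∃ d, Q d ∧ ¬ Q (d + 1) := by
    refine ⟨Nat.findGreatest Q l, Nat.findGreatest_spec (Nat.zero_le l) hQ0, fun h ↦ ?_⟩
    have := Nat.le_findGreatest (hQ _ h) h
    omega
  have hlift : ∀ y ∈ Submodule.span R' (Set.range (j ∘ x)),
      ∃ n ∈ Submodule.span R (Set.range x), j n = y := by
    intro y hy
    induction hy using Submodule.span_induction with
    | mem y hy =>
      obtain ⟨i, rfl⟩ := hy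
      exact ⟨x i, Submodule.subset_span ⟨i, rfl⟩, rfl⟩
    | zero => exact ⟨0, zero_mem _, map_zero j⟩
    | add y z _ _ hy hz =>
      obtain ⟨n, hn, rfl⟩ := hy
      obtain ⟨n', hn', rfl⟩ := hz
      exact ⟨n + n', add_mem hn hn', map_add j n n'⟩
    | smul c y _ hy =>
      obtain ⟨n, hn, rfl⟩ := hy
      obtain ⟨c, rfl⟩ := hf c
      exact ⟨c • n, Submodule.smul_mem _ c hn, map_smulₛₗ j c n⟩
  let N := Submodule.span R (Set.range x)
  -- By maximality `j y` depends on the `j (x i)`. The relation lifts to an element `r • y + n` of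
  -- the kernel of `j`, hence to a multiple of `a`.
  have key : ∀ m : H ⧸ N, ∃ r : R, f r ≠ 0 ∧ ∃ m' : H ⧸ N, r • m = a • m' := by
    intro m
    obtain ⟨y, rfl⟩ := N.mkQ_surjective m
    by_contra hcon
    refine hmax ⟨Fin.cons y x, ?_⟩
    have h1 : (j ∘ (Fin.cons y x : Fin (d + 1) → H)) = Fin.cons (j y) (j ∘ x) := by
      ext i
      refine Fin.cases ?_ (fun i ↦ ?_) i <;> simp
    rw [h1]
    refine LinearIndependent.finCons' _ _ hx fun c z hzs hz ↦ ?_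
    by_contra hc
    obtain ⟨n, hn, hnz⟩ := hlift z hzs
    obtain ⟨r, rfl⟩ := hf c
    have h2 : j (r • y + n) = 0 := by rw [map_add, map_smulₛₗ, hnz, hz]
    obtain ⟨w, hw⟩ := hj _ h2
    refine hcon ⟨r, hc, N.mkQ w, ?_⟩
    rw [← map_smul, ← map_smul, ← hw, map_add, (Submodule.Quotient.mk_eq_zero N).2 hn |>
      (show N.mkQ n = 0 from ·), add_zero]
  obtain ⟨r, hr, hr'⟩ := exists_common_multiplier f key
  obtain ⟨n, q, hq, hq'⟩ := exists_annihilator_of_smul_eq f hfa hr'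
  refine ⟨d, x, q, hQ d ⟨x, hx⟩, by rw [hq]; exact pow_ne_zero n hr, fun y ↦ ?_⟩
  have := hq' (N.mkQ y)
  rw [← map_smul] at this
  exact (Submodule.Quotient.mk_eq_zero N).1 this

lemma rank_le_of_specialization [IsDomain R] (hf : Function.Surjective f) (hfa : f a = 0)
    (hrank : Module.rank R' H' ≤ l) (j : H →ₛₗ[f] H') (hj : ∀ x, j x = 0 → ∃ y, x = a • y) :
    Module.rank R H ≤ l := by
  obtain ⟨d, x, q, hd, hq, hx⟩ := exists_generators_of_specialization hf hfa hrank j hj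
  have hq0 : q ≠ 0 := by rintro rfl; exact hq (map_zero f)
  rw [← rank_eq_of_smul_mem hq0 hx]
  refine (rank_span_le _).trans ?_
  have h1 : Cardinal.lift.{0} (Cardinal.mk (Set.range x)) ≤ Cardinal.lift (Cardinal.mk (Fin d)) :=
    Cardinal.mk_range_le_lift
  simp only [Cardinal.lift_uzero, Cardinal.mk_fin, Cardinal.lift_natCast] at h1
  exact h1.trans (by exact_mod_cast hd)

/-- Equality of ranks makes the generators `x` of the approximating submodule independent, so this
submodule is free. Hence `j` maps torsion to torsion, a lift `s` of `s'` maps the torsion of `H`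
into `a` times itself, and Cayley-Hamilton applies to the torsion submodule. -/
lemma exists_annihilator_torsion_of_specialization [IsDomain R] [IsNoetherianRing R]
    (ha : a ≠ 0) (hf : Function.Surjective f) (hfa : f a = 0) (hrank : Module.rank R' H' ≤ l)
    (hrank' : Module.rank R H = l) (j : H →ₛₗ[f] H') (hj : ∀ x, j x = 0 → ∃ y, x = a • y)
    {s' : R'} (hs' : ∀ t ∈ Submodule.torsion R' H', s' • t = 0) :
    ∃ (n : ℕ) (q : R), f q = s' ^ n ∧ ∀ t ∈ Submodule.torsion R H, q • t = 0 := by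
  obtain ⟨d, x, q, hd, hq, hx⟩ := exists_generators_of_specialization hf hfa hrank j hj
  have hq0 : q ≠ 0 := by rintro rfl; exact hq (map_zero f)
  have hN : Module.rank R (Submodule.span R (Set.range x)) = l :=
    (rank_eq_of_smul_mem hq0 hx).trans hrank'
  have hfin : Module.finrank R (Submodule.span R (Set.range x)) = l :=
    Module.finrank_eq_of_rank_eq hN
  have hld : l ≤ d := by
    have := finrank_range_le_card (R := R) x
    rw [Set.finrank, hfin] at this
    simpa using this
  obtain rfl : d = l := le_antisymm hd hld
  let xN : Fin d → Submodule.span R (Set.range x) :=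
    fun i ↦ ⟨x i, Submodule.subset_span ⟨i, rfl⟩⟩
  have hli : LinearIndependent R x := by
    have h1 : LinearIndependent R xN := by
      refine linearIndependent_of_top_le_span_of_card_eq_finrank ?_ (by rw [hfin]; simp)
      rintro ⟨y, hy⟩ -
      have h2 : Submodule.map (Submodule.span R (Set.range x)).subtype
          (Submodule.span R (Set.range xN)) = Submodule.span R (Set.range x) := by
        rw [Submodule.map_span, ← Set.range_comp]; rfl
      have hy' := hy
      rw [← h2] at hy
      obtain ⟨z, hz, hzy⟩ := hy
      rwa [show (⟨y, hy'⟩ : Submodule.span R (Set.range x)) = z from Subtype.ext hzy.symm]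
    exact h1.map' (Submodule.span R (Set.range x)).subtype (Submodule.ker_subtype _)
  -- `q • t` is a torsion element of the span of the independent family `x`, hence zero.
  have hqt : ∀ t ∈ Submodule.torsion R H, q • t = 0 := by
    rintro t ⟨⟨c, hc⟩, hct⟩
    have hct : c • t = 0 := hct
    obtain ⟨g, hg⟩ := (Submodule.mem_span_range_iff_exists_fun R).1 (hx t)
    have h1 : ∑ i, (c * g i) • x i = 0 := by
      simp_rw [mul_smul, ← Finset.smul_sum, hg]
      rw [smul_comm, hct, smul_zero]
    have h2 := Fintype.linearIndependent_iff.1 hli _ h1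
    rw [← hg]
    refine Finset.sum_eq_zero fun i _ ↦ ?_
    rw [(mul_eq_zero.1 (h2 i)).resolve_left (nonZeroDivisors.ne_zero hc), zero_smul]
  obtain ⟨s, rfl⟩ := hf s'
  -- `j t` is killed by `f q ≠ 0`, hence is torsion and killed by `s'`; so `s • t = a • y` for some
  -- `y`. This `y` is torsion itself because `a ≠ 0`.
  have hst : ∀ t : Submodule.torsion R H, ∃ y : Submodule.torsion R H, s • t = a • y := by
    rintro ⟨t, ht⟩
    have h1 : f q • j t = 0 := by rw [← map_smulₛₗ, hqt t ht, map_zero]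
    have h2 := hs' (j t) ⟨⟨f q, mem_nonZeroDivisors_of_ne_zero hq⟩, h1⟩
    rw [← map_smulₛₗ] at h2
    obtain ⟨y, hy⟩ := hj _ h2
    obtain ⟨⟨c, hc⟩, hct⟩ := ht
    have hct : c • t = 0 := hct
    refine ⟨⟨y, ⟨⟨c * a, mul_mem hc (mem_nonZeroDivisors_of_ne_zero ha)⟩, ?_⟩⟩, Subtype.ext hy⟩
    change (c * a) • y = 0
    rw [mul_smul, ← hy, smul_comm, hct, smul_zero]
  obtain ⟨n, p, hp, hp'⟩ := exists_annihilator_of_smul_eq f hfa hst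
  exact ⟨n, p, hp, fun t ht ↦ congrArg Subtype.val (hp' ⟨t, ht⟩)⟩

end Specialization

/-! ### Setting the first Laurent variable equal to one -/

namespace LaurentRing

instance (μ : ℕ) : IsNoetherianRing (LaurentRing μ) :=
  Algebra.FiniteType.isNoetherianRing ℤ _

/-- The map of exponents that forgets the first variable. -/
def tailHom (μ : ℕ) : (Fin (μ + 1) → ℤ) →+ (Fin μ → ℤ) where
  toFun := Fin.tail
  map_zero' := rfl
  map_add' _ _ := rfl

/-- The map of exponents that adds a first variable. -/
def consHom (μ : ℕ) : (Fin μ → ℤ) →+ (Fin (μ + 1) → ℤ) where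
  toFun v := Fin.cons 0 v
  map_zero' := by
    ext i
    refine Fin.cases ?_ (fun i ↦ ?_) i <;> simp
  map_add' v w := by
    ext i
    refine Fin.cases ?_ (fun i ↦ ?_) i <;> simp

/-- The specialization of the first variable to `1`. -/
noncomputable def specialize (μ : ℕ) : LaurentRing (μ + 1) →+* LaurentRing μ :=
  AddMonoidAlgebra.mapDomainRingHom ℤ (tailHom μ)

/-- The element `t - 1`, where `t` is the first variable. -/
noncomputable def firstSubOne (μ : ℕ) : LaurentRing (μ + 1) :=
  AddMonoidAlgebra.single (Pi.single 0 1) 1 - 1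

lemma specialize_single (μ : ℕ) (v : Fin (μ + 1) → ℤ) (c : ℤ) :
    specialize μ (AddMonoidAlgebra.single v c) = AddMonoidAlgebra.single (Fin.tail v) c := by
  rw [specialize, AddMonoidAlgebra.mapDomainRingHom_apply, AddMonoidAlgebra.mapDomain_single]
  rfl

lemma specialize_surjective (μ : ℕ) : Function.Surjective (specialize μ) := by
  intro r
  induction r using AddMonoidAlgebra.induction_linear with
  | zero => exact ⟨0, map_zero _⟩
  | add p q hp hq =>
    obtain ⟨p, rfl⟩ := hp
    obtain ⟨q, rfl⟩ := hq
    exact ⟨p + q, map_add _ _ _⟩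
  | single v c => exact ⟨AddMonoidAlgebra.single (Fin.cons 0 v) c, by simp [specialize_single]⟩

lemma specialize_firstSubOne (μ : ℕ) : specialize μ (firstSubOne μ) = 0 := by
  rw [firstSubOne, map_sub, specialize_single, map_one, sub_eq_zero, AddMonoidAlgebra.one_def]
  congr 1

lemma firstSubOne_ne_zero (μ : ℕ) : firstSubOne μ ≠ 0 := by
  rw [firstSubOne, sub_ne_zero, AddMonoidAlgebra.one_def]
  intro h
  have h1 := (AddMonoidAlgebra.single_left_inj (one_ne_zero (α := ℤ))).1 h
  simpa using congrFun h1 0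

/-- Modulo `t - 1` a monomial does not change when its first exponent is set to zero. So the
quotient map factors through `specialize`, by way of the section `consHom`. -/
lemma firstSubOne_dvd (μ : ℕ) (r : LaurentRing (μ + 1)) (h : specialize μ r = 0) :
    firstSubOne μ ∣ r := by
  let mk := Ideal.Quotient.mk (Ideal.span {firstSubOne μ})
  have hfirst : mk (AddMonoidAlgebra.single (Pi.single 0 1) 1) = 1 := by
    rw [← sub_eq_zero, ← map_one mk, ← map_sub, Ideal.Quotient.eq_zero_iff_mem]
    exact Ideal.mem_span_singleton_self _
  let g : Multiplicative ℤ →* LaurentRing (μ + 1) ⧸ Ideal.span {firstSubOne μ} :=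
    (mk : LaurentRing (μ + 1) →* _).comp ((AddMonoidAlgebra.of ℤ (Fin (μ + 1) → ℤ)).comp
      (AddMonoidHom.toMultiplicative (AddMonoidHom.single (fun _ : Fin (μ + 1) ↦ ℤ) 0)))
  -- A homomorphism from `ℤ` is determined at the generator, which covers negative powers of `t` as
  -- well.
  have hg : g = 1 := MonoidHom.ext_mint hfirst
  have hsec : mk = mk.comp ((AddMonoidAlgebra.mapDomainRingHom ℤ (consHom μ)).comp
      (specialize μ)) := by
    refine AddMonoidAlgebra.ringHom_ext' (RingHom.ext_int _ _) (MonoidHom.ext fun v ↦ ?_)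
    have hv : v.toAdd = Pi.single 0 (v.toAdd 0) + Fin.cons 0 (Fin.tail v.toAdd) := by
      ext i
      refine Fin.cases ?_ (fun i ↦ ?_) i <;> simp [Fin.tail]
    have h1 : mk (AddMonoidAlgebra.single (Pi.single 0 (v.toAdd 0)) 1) = 1 :=
      DFunLike.congr_fun hg (Multiplicative.ofAdd (v.toAdd 0))
    have h2 : mk (AddMonoidAlgebra.single v.toAdd 1) =
        mk (AddMonoidAlgebra.single (Fin.cons 0 (Fin.tail v.toAdd)) 1) := by
      conv_lhs => rw [hv]
      rw [show (1 : ℤ) = 1 * 1 from rfl, ← AddMonoidAlgebra.single_mul_single, map_mul, h1, one_mul]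
      rfl
    have h4 : AddMonoidAlgebra.mapDomainRingHom ℤ (consHom μ)
        (specialize μ (AddMonoidAlgebra.single v.toAdd 1)) =
          AddMonoidAlgebra.single (Fin.cons 0 (Fin.tail v.toAdd)) 1 := by
      rw [specialize_single, AddMonoidAlgebra.mapDomainRingHom_apply,
        AddMonoidAlgebra.mapDomain_single]
      rfl
    exact h2.trans (congrArg mk h4.symm)
  have h3 : mk r = 0 := by
    rw [hsec, RingHom.comp_apply, RingHom.comp_apply, h, map_zero, map_zero]
  exact Ideal.mem_span_singleton.1 (Ideal.Quotient.eq_zero_iff_mem.1 h3)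

lemma evalOne_single (μ : ℕ) (v : Fin μ → ℤ) (c : ℤ) :
    evalOne μ (AddMonoidAlgebra.single v c) = c := by
  simp [evalOne]

lemma evalOne_specialize (μ : ℕ) (r : LaurentRing (μ + 1)) :
    evalOne μ (specialize μ r) = evalOne (μ + 1) r := by
  induction r using AddMonoidAlgebra.induction_linear with
  | zero => simp
  | add p q hp hq => rw [map_add, map_add, map_add, hp, hq]
  | single v c => rw [specialize_single, evalOne_single, evalOne_single]

lemma evalOne_zero_injective : Function.Injective (evalOne 0) := by
  rw [injective_iff_map_eq_zero]
  intro r hr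
  have h : ∀ r : LaurentRing 0, r = algebraMap ℤ _ (evalOne 0 r) := by
    intro r
    induction r using AddMonoidAlgebra.induction_linear with
    | zero => simp
    | add p q hp hq => rw [map_add, map_add, ← hp, ← hq]
    | single v c =>
      rw [evalOne_single, Subsingleton.elim v 0]
      rfl
  rw [h r, hr, map_zero]

lemma evalOne_surjective (μ : ℕ) : Function.Surjective (evalOne μ) := fun c ↦
  ⟨algebraMap ℤ _ c, by simp⟩

end LaurentRing

/-! ### Induction on the number of variables -/

section Induction

variable {X : Type*} [TopologicalSpace X] [T2Space X] [CWComplex (Set.univ : Set X)]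
  [CWComplex.Finite (Set.univ : Set X)]

/-- The rank of the Laurent homology is bounded by the rank of a free integral homology; if the
ranks agree, then the torsion is annihilated by an element with value `1` at `(1, …, 1)`. -/
theorem laurentHomology_rank_le_and_annihilator (E : CWComplex.Subcomplex (Set.univ : Set X))
    (x₀ : X) (k l : ℕ)
    (hZ : Nonempty (IntegralHomology x₀ (E : Set X) k ≃ₗ[ℤ] (Fin l → ℤ))) (μ : ℕ)
    (γ : FundamentalGroup X x₀ →* Multiplicative (Fin μ → ℤ)) :
    Module.rank (LaurentRing μ) (LaurentHomology γ (E : Set X) k) ≤ l ∧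
    (Module.rank (LaurentRing μ) (LaurentHomology γ (E : Set X) k) = l →
      ∃ s : LaurentRing μ, LaurentRing.evalOne μ s = 1 ∧
        ∀ t ∈ Submodule.torsion (LaurentRing μ) (LaurentHomology γ (E : Set X) k), s • t = 0) := by
  induction μ with
  | zero =>
    obtain ⟨e⟩ := hZ
    -- Evaluation identifies `Λ_0` with `ℤ`, so the kernel generator is `0` and `j` is injective;
    -- the homology is then torsion-free.
    obtain ⟨j, hj⟩ := exists_homologyMap (f := (LaurentRing.evalOne 0 : LaurentRing 0 →+* ℤ))
      (LaurentRing.evalOne_surjective 0) (a := 0)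
      (fun r hr ↦ by
        rw [zero_dvd_iff]
        exact LaurentRing.evalOne_zero_injective (hr.trans (map_zero _).symm)) (.inl rfl)
      (ρ := (AddMonoidAlgebra.of ℤ (Fin 0 → ℤ)).comp γ) (ρ' := 1)
      (fun g ↦ (LaurentRing.evalOne_single 0 _ 1).symm) (E : Set X) k
    have hj0 : ∀ x, j x = 0 → x = 0 := fun x hx ↦ by
      obtain ⟨y, hy⟩ := hj x hx
      rw [hy, zero_smul]
    have hrank : Module.rank ℤ (IntegralHomology x₀ (E : Set X) k) = l := by
      have := e.lift_rank_eq
      simpa using this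
    constructor
    · rw [← hrank]
      exact rank_le_of_surjective_injective (LaurentRing.evalOne 0) j.toAddMonoidHom
        (LaurentRing.evalOne_surjective 0) ((injective_iff_map_eq_zero _).2 hj0)
        (fun c x ↦ j.map_smulₛₗ c x)
    · intro _
      refine ⟨1, map_one _, ?_⟩
      rintro t ⟨⟨c, hc⟩, hct⟩
      have hct : c • t = 0 := hct
      have h1 : LaurentRing.evalOne 0 c • e (j t) = 0 := by
        rw [← map_smul]
        have h2 : j (c • t) = _ := j.map_smulₛₗ c t
        rw [hct, map_zero] at h2
        exact (congrArg e h2.symm).trans (map_zero e)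
      have hc0 : LaurentRing.evalOne 0 c ≠ 0 := fun h ↦ nonZeroDivisors.ne_zero hc
        (LaurentRing.evalOne_zero_injective (h.trans (map_zero _).symm))
      have h3 : e (j t) = 0 := (smul_eq_zero.1 h1).resolve_left hc0
      rw [one_smul]
      exact hj0 t (e.injective (h3.trans (map_zero e).symm))
  | succ μ ih =>
    let γ' : FundamentalGroup X x₀ →* Multiplicative (Fin μ → ℤ) :=
      (AddMonoidHom.toMultiplicative (LaurentRing.tailHom μ)).comp γ
    obtain ⟨j, hj⟩ := exists_homologyMap (LaurentRing.specialize_surjective μ)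
      (LaurentRing.firstSubOne_dvd μ)
      (.inr (mem_nonZeroDivisors_of_ne_zero (LaurentRing.firstSubOne_ne_zero μ)))
      (ρ := (AddMonoidAlgebra.of ℤ (Fin (μ + 1) → ℤ)).comp γ)
      (ρ' := (AddMonoidAlgebra.of ℤ (Fin μ → ℤ)).comp γ')
      (fun g ↦ (LaurentRing.specialize_single μ _ 1).symm) (E : Set X) k
    have := localHomology_finite_of_subcomplex E
      ((AddMonoidAlgebra.of ℤ (Fin (μ + 1) → ℤ)).comp γ) k
    obtain ⟨h1, h2⟩ := ih γ'
    have hle := rank_le_of_specialization (LaurentRing.specialize_surjective μ)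
      (LaurentRing.specialize_firstSubOne μ) h1 j hj
    refine ⟨hle, fun hrank ↦ ?_⟩
    -- The rank `m` after specialization is at most `l` by induction, and at least the rank `l`
    -- before it. So it equals `l`, and the induction hypothesis provides an annihilator.
    obtain ⟨m, hm⟩ := Cardinal.lt_aleph0.1 (h1.trans_lt Cardinal.natCast_lt_aleph0)
    have hlm : l ≤ m := by
      have := rank_le_of_specialization (LaurentRing.specialize_surjective μ)
        (LaurentRing.specialize_firstSubOne μ) hm.le j hj
      rw [hrank] at this
      exact_mod_cast this
    have hml : m ≤ l := by
      rw [hm] at h1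
      exact_mod_cast h1
    obtain ⟨s', hs', hs'0⟩ := h2 (by rw [hm, le_antisymm hml hlm])
    obtain ⟨n, q, hq, hq0⟩ := exists_annihilator_torsion_of_specialization
      (LaurentRing.firstSubOne_ne_zero μ) (LaurentRing.specialize_surjective μ)
      (LaurentRing.specialize_firstSubOne μ) h1 hrank j hj hs'0
    exact ⟨q, by rw [← LaurentRing.evalOne_specialize, hq, map_pow, hs', one_pow], hq0⟩

end Induction

/-! ### Factoriality of the Laurent polynomial ring -/

namespace LaurentRing

/-- The inclusion of the exponents of polynomials in those of Laurent polynomials. -/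
def natExponents (μ : ℕ) : (Fin μ →₀ ℕ) →+ (Fin μ → ℤ) where
  toFun v i := v i
  map_zero' := by ext; simp
  map_add' v w := by ext; simp

lemma natExponents_injective (μ : ℕ) : Function.Injective (natExponents μ) := fun _ _ h ↦
  Finsupp.ext fun i ↦ Int.ofNat.inj (congrFun h i)

/-- The Laurent ring is the localization of a polynomial ring over `ℤ` at its monomials, and
localization preserves unique factorization. -/
instance (μ : ℕ) : UniqueFactorizationMonoid (LaurentRing μ) := by
  let A := AddMonoidAlgebra ℤ (Fin μ →₀ ℕ)
  have : UniqueFactorizationMonoid A :=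
    inferInstanceAs (UniqueFactorizationMonoid (MvPolynomial (Fin μ) ℤ))
  let f : A →+* LaurentRing μ := AddMonoidAlgebra.mapDomainRingHom ℤ (natExponents μ)
  have hf : ∀ v c, f (AddMonoidAlgebra.single v c) =
      AddMonoidAlgebra.single (natExponents μ v) c := fun v c ↦ by
    rw [AddMonoidAlgebra.mapDomainRingHom_apply, AddMonoidAlgebra.mapDomain_single]
  let : Algebra A (LaurentRing μ) := f.toAlgebra
  let S : Submonoid A := MonoidHom.mrange (AddMonoidAlgebra.of ℤ (Fin μ →₀ ℕ))
  have hS : IsLocalization S (LaurentRing μ) := by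
    refine ⟨?_, ?_, ?_⟩
    · rintro ⟨_, v, rfl⟩
      refine IsUnit.of_mul_eq_one
        (AddMonoidAlgebra.single (-natExponents μ v.toAdd) 1) ?_
      change f (AddMonoidAlgebra.single v.toAdd 1) * _ = 1
      rw [hf, AddMonoidAlgebra.single_mul_single, add_neg_cancel]
      rfl
    · suffices h : ∀ r : LaurentRing μ, ∃ (v : Fin μ →₀ ℕ) (p : A),
          r * AddMonoidAlgebra.single (natExponents μ v) 1 = f p by
        intro r
        obtain ⟨v, p, h⟩ := h r
        exact ⟨(p, ⟨AddMonoidAlgebra.single v 1, Multiplicative.ofAdd v, rfl⟩),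
          (congrArg (r * ·) (hf v 1)).trans h⟩
      intro r
      induction r using AddMonoidAlgebra.induction_linear with
      | zero => exact ⟨0, 0, by rw [zero_mul, map_zero]⟩
      | add r s hr hs =>
        obtain ⟨v, p, hr⟩ := hr
        obtain ⟨w, q, hs⟩ := hs
        refine ⟨v + w, p * AddMonoidAlgebra.single w 1 + q * AddMonoidAlgebra.single v 1, ?_⟩
        have h1 : (AddMonoidAlgebra.single (natExponents μ (v + w)) 1 : LaurentRing μ) =
            AddMonoidAlgebra.single (natExponents μ v) 1 *
              AddMonoidAlgebra.single (natExponents μ w) 1 := by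
          rw [AddMonoidAlgebra.single_mul_single, map_add, one_mul]
        rw [h1, map_add f, map_mul f, map_mul f, hf, hf, ← hr, ← hs]
        ring
      | single u c =>
        -- Multiplication by the monomial of the negative parts of the exponents leaves the positive
        -- parts.
        refine ⟨Finsupp.equivFunOnFinite.symm fun i ↦ (-u i).toNat,
          AddMonoidAlgebra.single (Finsupp.equivFunOnFinite.symm fun i ↦ (u i).toNat) c, ?_⟩
        rw [hf, AddMonoidAlgebra.single_mul_single, mul_one]
        congr 1
        ext i
        simp [natExponents]
        omega
    · intro x y h
      refine ⟨1, ?_⟩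
      have : x = y := AddMonoidAlgebra.mapDomain_injective (natExponents_injective μ) h
      rw [this]
  exact UniqueFactorizationMonoid.of_isLocalization S (LaurentRing μ)

end LaurentRing

/-! ### Ideals of minors and their independence of the presentation -/

section MinorIdeal

variable {R F G : Type*} [CommRing R] [AddCommGroup F] [Module R F] [AddCommGroup G] [Module R G]

/-- The arguments pass from `X` to its span one at a time: with the others fixed the map is linear,
so the preimage of `I` is a submodule. -/
lemma MultilinearMap.map_mem_of_span {ι N : Type*} [Finite ι] [AddCommGroup N] [Module R N]
    (g : MultilinearMap R (fun _ : ι ↦ F) N) (I : Submodule R N) (X : Set F)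
    (h : ∀ x : ι → F, (∀ a, x a ∈ X) → g x ∈ I) (x : ι → F)
    (hx : ∀ a, x a ∈ Submodule.span R X) : g x ∈ I := by
  classical
  have := Fintype.ofFinite ι
  suffices H : ∀ (s : Finset ι) (x : ι → F), (∀ a ∈ s, x a ∈ Submodule.span R X) →
      (∀ a ∉ s, x a ∈ X) → g x ∈ I from
    H Finset.univ x (fun a _ ↦ hx a) fun a ha ↦ (ha (Finset.mem_univ a)).elim
  intro s
  induction s using Finset.induction_on with
  | empty => exact fun x _ hx ↦ h x fun a ↦ hx a (Finset.notMem_empty a)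
  | insert a s ha ih =>
    intro x hs hX
    have h1 : Submodule.span R X ≤ I.comap (g.toLinearMap x a) := by
      refine Submodule.span_le.2 fun y hy ↦ ih _ (fun b hb ↦ ?_) fun b hb ↦ ?_
      · rw [Function.update_of_ne (by rintro rfl; exact ha hb)]
        exact hs b (Finset.mem_insert_of_mem hb)
      · by_cases hba : b = a
        · subst hba
          rwa [Function.update_self]
        · rw [Function.update_of_ne hba]
          exact hX b (by simp [hba, hb])
    have h2 := h1 (hs a (Finset.mem_insert_self a s))
    rwa [Submodule.mem_comap, MultilinearMap.toLinearMap_apply, Function.update_eq_self] at h2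

/-- The determinant of the values of `j` linear forms at `j` vectors. -/
def formDet {j : ℕ} (x : Fin j → F) (f : Fin j → Module.Dual R F) : R :=
  (Matrix.of fun a b ↦ f b (x a)).det

lemma formDet_mem_of_span {j : ℕ} (I : Ideal R) (X : Set F) (Φ : Set (Module.Dual R F))
    (h : ∀ (x : Fin j → F) (f : Fin j → Module.Dual R F), (∀ a, x a ∈ X) → (∀ b, f b ∈ Φ) →
      formDet x f ∈ I) (x : Fin j → F) (f : Fin j → Module.Dual R F)
    (hx : ∀ a, x a ∈ Submodule.span R X) (hf : ∀ b, f b ∈ Submodule.span R Φ) :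
    formDet x f ∈ I := by
  have h1 : ∀ f : Fin j → Module.Dual R F, (∀ b, f b ∈ Φ) → formDet x f ∈ I := fun f hf ↦
    MultilinearMap.map_mem_of_span ((Matrix.detRowAlternating (R := R) (n := Fin j)).compLinearMap
      (LinearMap.pi f)).toMultilinearMap I X (fun x hx ↦ h x f hx hf) x hx
  have h2 : ∀ f : Fin j → Module.Dual R F,
      ((Matrix.detRowAlternating (R := R) (n := Fin j)).compLinearMap
        (LinearMap.pi fun a ↦ LinearMap.applyₗ (x a))).toMultilinearMap f = formDet x f := fun f ↦
    Matrix.det_transpose (Matrix.of fun a b ↦ f b (x a))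
  rw [← h2]
  exact MultilinearMap.map_mem_of_span _ I Φ (fun f hf ↦ by rw [h2]; exact h1 f hf) f hf

/-- The ideal generated by the determinants of the values of `j` linear forms at `j` vectors of a
submodule. -/
def minorIdeal (K : Submodule R F) (j : ℕ) : Ideal R :=
  Ideal.span {d | ∃ (x : Fin j → F) (f : Fin j → Module.Dual R F), (∀ a, x a ∈ K) ∧ formDet x f = d}

lemma formDet_mem_minorIdeal {K : Submodule R F} {j : ℕ} {x : Fin j → F}
    (f : Fin j → Module.Dual R F) (hx : ∀ a, x a ∈ K) : formDet x f ∈ minorIdeal K j :=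
  Ideal.subset_span ⟨x, f, hx, rfl⟩

lemma minorIdeal_le {K : Submodule R F} {j : ℕ} {I : Ideal R}
    (h : ∀ (x : Fin j → F) (f : Fin j → Module.Dual R F), (∀ a, x a ∈ K) → formDet x f ∈ I) :
    minorIdeal K j ≤ I := by
  refine Ideal.span_le.2 ?_
  rintro _ ⟨x, f, hx, rfl⟩
  exact h x f hx

/-- Forms on `G` restrict along `ι`, and forms on `F` extend along the retraction `ρ`; the values at
the vectors are unchanged. -/
lemma minorIdeal_map {ι : F →ₗ[R] G} {ρ : G →ₗ[R] F} (h : ρ ∘ₗ ι = LinearMap.id)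
    (K : Submodule R F) (j : ℕ) : minorIdeal (K.map ι) j = minorIdeal K j := by
  apply le_antisymm
  · refine minorIdeal_le fun x f hx ↦ ?_
    choose y hy hyx using hx
    obtain rfl : (fun a ↦ ι (y a)) = x := funext hyx
    exact formDet_mem_minorIdeal (fun b ↦ (f b).comp ι) hy
  · refine minorIdeal_le fun x f hx ↦ ?_
    have h1 : formDet x f = formDet (fun a ↦ ι (x a)) fun b ↦ (f b).comp ρ := by
      unfold formDet
      congr 2
      ext a b
      exact congrArg (f b) (LinearMap.congr_fun h (x a)).symm
    rw [h1]
    exact formDet_mem_minorIdeal _ fun a ↦ Submodule.mem_map_of_mem (hx a)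

lemma minorIdeal_map_equiv (e : F ≃ₗ[R] G) (K : Submodule R F) (j : ℕ) :
    minorIdeal (K.map e.toLinearMap) j = minorIdeal K j :=
  minorIdeal_map (ρ := e.symm.toLinearMap) (by ext; simp) K j

lemma Matrix.det_mem_of_row {j : ℕ} (A : Matrix (Fin (j + 1)) (Fin (j + 1)) R) (I : Ideal R)
    (a : Fin (j + 1)) (h : ∀ b : Fin (j + 1), (A.submatrix a.succAbove b.succAbove).det ∈ I) : A.det ∈ I := by
  rw [Matrix.det_succ_row A a]
  exact Submodule.sum_mem _ fun b _ ↦ I.mul_mem_left _ (h b)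

/-- By multilinearity every row comes from `K` or is `(0, 1)`. Two rows `(0, 1)` make the
determinant vanish, and otherwise expansion along one row leaves only rows from `K`. Conversely, a
determinant of size `j` is bordered by a row `(0, 1)`. -/
lemma minorIdeal_prod_top (K : Submodule R F) (j : ℕ) :
    minorIdeal (K.prod (⊤ : Submodule R R)) (j + 1) = minorIdeal K j := by
  apply le_antisymm
  · let X : Set (F × R) := (LinearMap.inl R F R '' K) ∪ {(0, 1)}
    have hX : K.prod ⊤ ≤ Submodule.span R X := by
      rintro ⟨y, r⟩ ⟨hy, -⟩
      have h1 : ((y, r) : F × R) = (y, 0) + r • (0, 1) := by simp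
      rw [h1]
      exact add_mem (Submodule.subset_span (.inl ⟨y, hy, rfl⟩))
        (Submodule.smul_mem _ r (Submodule.subset_span (.inr rfl)))
    refine minorIdeal_le fun x f hx ↦ formDet_mem_of_span _ X Set.univ (fun x f hx _ ↦ ?_) x f
      (fun a ↦ hX (hx a)) fun b ↦ Submodule.subset_span trivial
    obtain ⟨a, ha⟩ : ∃ a, (∀ a' ≠ a, x a' ∈ LinearMap.inl R F R '' K) ∨ formDet x f = 0 := by
      by_cases h : ∃ a, x a = (0, 1)
      · obtain ⟨a, ha⟩ := h
        refine ⟨a, ?_⟩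
        by_cases h' : ∃ a' ≠ a, x a' = (0, 1)
        · obtain ⟨a', hne, ha'⟩ := h'
          exact .inr (Matrix.det_zero_of_row_eq hne (by ext b; simp [ha, ha']))
        · push Not at h'
          exact .inl fun a' hne ↦ (hx a').resolve_right (h' a' hne)
      · push Not at h
        exact ⟨0, .inl fun a' _ ↦ (hx a').resolve_right (h a')⟩
    rcases ha with ha | ha
    · refine Matrix.det_mem_of_row _ _ a fun b ↦ ?_
      choose y hy hyx using fun i ↦ ha (a.succAbove i) (Fin.succAbove_ne a i)
      have h1 := formDet_mem_minorIdeal (fun i ↦ (f (b.succAbove i)).comp (LinearMap.inl R F R)) hy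
      convert h1 using 1
      unfold formDet
      congr 1
      ext i k
      exact congrArg (f (b.succAbove k)) (hyx i).symm
    · rw [ha]
      exact zero_mem _
  · refine minorIdeal_le fun x f hx ↦ ?_
    have h1 := formDet_mem_minorIdeal (K := K.prod (⊤ : Submodule R R)) (j := j + 1)
      (x := Fin.cons (0, 1) fun a ↦ (x a, 0))
      (Fin.cons (LinearMap.snd R F R) fun b ↦ (f b).comp (LinearMap.fst R F R)) (by
        intro a
        refine Fin.cases ?_ (fun a ↦ ?_) a
        · exact ⟨zero_mem _, trivial⟩
        · exact ⟨hx a, trivial⟩)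
    convert h1 using 1
    unfold formDet
    rw [Matrix.det_succ_row_zero, Fin.sum_univ_succ]
    simp [Matrix.submatrix]

lemma minorIdeal_prod_top_pi (n : ℕ) (K : Submodule R F) (j : ℕ) :
    minorIdeal (K.prod (⊤ : Submodule R (Fin n → R))) (j + n) = minorIdeal K j := by
  induction n with
  | zero =>
    rw [← minorIdeal_map (ι := LinearMap.inl R F (Fin 0 → R)) (ρ := LinearMap.fst R F _)
      (by ext; simp) K]
    congr 1
    ext ⟨y, r⟩
    simp [Subsingleton.elim r 0]
  | succ n ih =>
    let e : ((F × (Fin n → R)) × R) ≃ₗ[R] F × (Fin (n + 1) → R) :=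
      (LinearEquiv.prodAssoc R F (Fin n → R) R).trans ((LinearEquiv.refl R F).prodCongr
        ((LinearEquiv.prodComm R (Fin n → R) R).trans (Fin.consLinearEquiv R fun _ ↦ R)))
    rw [← ih, ← minorIdeal_prod_top (F := F × (Fin n → R)) (K.prod ⊤), ← minorIdeal_map_equiv e, ← add_assoc]
    congr 1
    ext ⟨y, r⟩
    rw [Submodule.mem_map_equiv]
    simp [e]
    rfl

/-- As in Schanuel's lemma, both kernels are compared with that of the combined surjection from the
direct sum, where each picks up a free factor. -/
lemma minorIdeal_ker_eq {M : Type*} [AddCommGroup M] [Module R M] {n n' j j' : ℕ}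
    (π : (Fin n → R) →ₗ[R] M) (π' : (Fin n' → R) →ₗ[R] M) (hπ : Function.Surjective π)
    (hπ' : Function.Surjective π') (hj : j + n' = j' + n) :
    minorIdeal (LinearMap.ker π) j = minorIdeal (LinearMap.ker π') j' := by
  have key : ∀ {n n' : ℕ} (j : ℕ) (π : (Fin n → R) →ₗ[R] M) (π' : (Fin n' → R) →ₗ[R] M),
      Function.Surjective π →
        minorIdeal (LinearMap.ker (π.coprod π')) (j + n') = minorIdeal (LinearMap.ker π) j := by
    intro n n' j π π' hπ
    obtain ⟨σ, hσ⟩ := Module.projective_lifting_property π π' hπ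
    -- For a lift `σ` of `π'` through `π`, the shear `(x, y) ↦ (x + σ y, y)` carries the kernel of
    -- `π.coprod π'` to `ker π × ⊤`.
    let e : ((Fin n → R) × (Fin n' → R)) ≃ₗ[R] (Fin n → R) × (Fin n' → R) :=
      LinearEquiv.ofLinearMap
        ((LinearMap.fst R _ _ + σ ∘ₗ LinearMap.snd R _ _).prod (LinearMap.snd R _ _))
        ((LinearMap.fst R _ _ - σ ∘ₗ LinearMap.snd R _ _).prod (LinearMap.snd R _ _))
        (by ext <;> simp) (by ext <;> simp)
    rw [← minorIdeal_prod_top_pi n' (LinearMap.ker π), ← minorIdeal_map_equiv e]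
    congr 1
    ext ⟨x, y⟩
    rw [Submodule.mem_map_equiv]
    have h1 : π (σ y) = π' y := LinearMap.congr_fun hσ y
    simp [e, h1]
  rw [← key j π π' hπ, ← key j' π' π hπ', hj,
    ← minorIdeal_map_equiv (LinearEquiv.prodComm R (Fin n → R) (Fin n' → R))]
  congr 1
  ext ⟨x, y⟩
  rw [Submodule.mem_map_equiv]
  simp [add_comm]

/-- Removing a free direct summand of a module does not change its ideals of minors. -/
lemma minorIdeal_ker_eq_of_equiv_prod {M T : Type*} [AddCommGroup M] [Module R M] [AddCommGroup T]
    [Module R T] {n n' j l : ℕ} (π : (Fin n → R) →ₗ[R] M) (π' : (Fin n' → R) →ₗ[R] T)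
    (hπ : Function.Surjective π) (hπ' : Function.Surjective π') (e : M ≃ₗ[R] T × (Fin l → R))
    (hj : j + l = n) : minorIdeal (LinearMap.ker π) j = minorIdeal (LinearMap.ker π') n' := by
  let E : (Fin (n' + l) → R) ≃ₗ[R] (Fin n' → R) × (Fin l → R) :=
    (LinearEquiv.funCongrLeft R R finSumFinEquiv).trans
      (LinearEquiv.sumArrowLequivProdArrow (Fin n') (Fin l) R R)
  let ψ : (Fin (n' + l) → R) →ₗ[R] M :=
    e.symm.toLinearMap ∘ₗ (π'.prodMap LinearMap.id) ∘ₗ E.toLinearMap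
  have hψ : Function.Surjective ψ :=
    e.symm.surjective.comp ((Prod.map_surjective.2 ⟨hπ', Function.surjective_id⟩).comp E.surjective)
  rw [minorIdeal_ker_eq π ψ hπ hψ (j' := n') (by omega), ← minorIdeal_map_equiv E,
    ← minorIdeal_map (ι := LinearMap.inl R (Fin n' → R) (Fin l → R)) (ρ := LinearMap.fst R _ _)
      (by ext; simp) (LinearMap.ker π')]
  congr 1
  ext ⟨x, y⟩
  rw [Submodule.mem_map_equiv]
  simp [ψ, Prod.ext_iff, eq_comm]

end MinorIdeal

/-! ### Presentation matrices and their minors -/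

section Presentations

variable {R : Type*} [CommRing R]

lemma exists_orderEmbedding_comp_perm {j m : ℕ} (r : Fin j → Fin m) (hr : Function.Injective r) :
    ∃ (s : Fin j ↪o Fin m) (σ : Equiv.Perm (Fin j)), r ∘ σ = s :=
  ⟨OrderEmbedding.ofStrictMono (r ∘ Tuple.sort r) ((Tuple.monotone_sort r).strictMono_of_injective
    (hr.comp (Tuple.sort r).injective)), Tuple.sort r, rfl⟩

/-- Up to sign, the determinant of a submatrix is zero or a minor. -/
lemma det_submatrix_mem {m n j : ℕ} {P : Matrix (Fin m) (Fin n) R} {I : Ideal R}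
    (h : ∀ d, IsMinor P j d → d ∈ I) (r : Fin j → Fin m) (c : Fin j → Fin n) :
    (P.submatrix r c).det ∈ I := by
  by_cases hr : Function.Injective r
  · by_cases hc : Function.Injective c
    · obtain ⟨r', σ, hr'⟩ := exists_orderEmbedding_comp_perm r hr
      obtain ⟨c', τ, hc'⟩ := exists_orderEmbedding_comp_perm c hc
      have h1 := h _ ⟨r', c', rfl⟩
      rw [← hr', ← hc'] at h1
      have h2 : (P.submatrix (r ∘ σ) (c ∘ τ)).det =
          (Equiv.Perm.sign σ : R) * ((Equiv.Perm.sign τ : R) * (P.submatrix r c).det) := by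
        rw [← Matrix.det_permute', ← Matrix.det_permute]
        rfl
      rw [h2, Ideal.unit_mul_mem_iff_mem, Ideal.unit_mul_mem_iff_mem] at h1
      · exact h1
      · exact (Equiv.Perm.sign τ).isUnit.map (Int.castRingHom R)
      · exact (Equiv.Perm.sign σ).isUnit.map (Int.castRingHom R)
    · obtain ⟨a, b, hab, hne⟩ := Function.not_injective_iff.1 hc
      rw [Matrix.det_zero_of_column_eq hne fun i ↦ by simp [hab]]
      exact zero_mem I
  · obtain ⟨a, b, hab, hne⟩ := Function.not_injective_iff.1 hr
    rw [Matrix.det_zero_of_row_eq hne (by ext i; simp [hab])]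
    exact zero_mem I

/-- The rows span the module of relations and the coordinate forms span the dual, so multilinearity
reduces all determinants to those of submatrices. -/
lemma span_minors_eq {m n : ℕ} (P : Matrix (Fin m) (Fin n) R) (j : ℕ) :
    Ideal.span {d | IsMinor P j d} = minorIdeal (LinearMap.range P.vecMulLinear) j := by
  apply le_antisymm
  · refine Ideal.span_le.2 ?_
    rintro _ ⟨r, c, rfl⟩
    exact formDet_mem_minorIdeal (x := fun a ↦ P.row (r a)) (fun b ↦ LinearMap.proj (c b)) fun a ↦
      ⟨Pi.single (r a) 1, by ext i; simp⟩
  · refine minorIdeal_le fun x f hx ↦ formDet_mem_of_span _ (Set.range P.row)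
      (Set.range fun b : Fin n ↦ (LinearMap.proj b : Module.Dual R (Fin n → R)))
      (fun x f hx hf ↦ ?_) x f (fun a ↦ ?_) fun b ↦ ?_
    · choose r hr using hx
      choose c hc using hf
      obtain rfl : (fun a ↦ P.row (r a)) = x := funext hr
      obtain rfl : (fun b ↦ LinearMap.proj (c b)) = f := funext hc
      exact det_submatrix_mem (fun d hd ↦ Ideal.subset_span hd) r c
    · rw [← range_vecMulLinear]
      exact hx a
    · have h1 : f b = ∑ i, f b (Pi.single i 1) • (LinearMap.proj i : Module.Dual R (Fin n → R)) := by
        ext i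
        simp [Pi.single_apply]
      rw [h1]
      exact Submodule.sum_mem _ fun i _ ↦ Submodule.smul_mem _ _ (Submodule.subset_span ⟨i, rfl⟩)

lemma dvd_minors_iff {m n : ℕ} (P : Matrix (Fin m) (Fin n) R) (j : ℕ) (a : R) :
    (∀ d, IsMinor P j d → a ∣ d) ↔
      ∀ d ∈ minorIdeal (LinearMap.range P.vecMulLinear) j, a ∣ d := by
  rw [← span_minors_eq]
  simp only [← Ideal.mem_span_singleton]
  exact (Ideal.span_le (s := {d | IsMinor P j d}) (I := Ideal.span {a})).symm

lemma exists_surjective_of_fin (N : Type*) [AddCommGroup N] [Module R N] [Module.Finite R N]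
    (k : ℕ) : ∃ (n : ℕ) (π : (Fin n → R) →ₗ[R] N), k ≤ n ∧ Function.Surjective π := by
  obtain ⟨n, π, hπ⟩ := Module.Finite.exists_fin' R N
  exact ⟨n + k, π ∘ₗ LinearMap.funLeft R R (Fin.castAdd k), Nat.le_add_left k n,
    hπ.comp (LinearMap.funLeft_surjective_of_injective R R _ (Fin.castAdd_injective n k))⟩

/-- A finite module over a Noetherian ring has presentation matrices of arbitrarily large size. -/
lemma exists_isPresentationMatrix [IsNoetherianRing R] (M : Type*) [AddCommGroup M] [Module R M]
    [Module.Finite R M] (l : ℕ) : ∃ (m n : ℕ) (P : Matrix (Fin m) (Fin n) R),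
      l < n ∧ n - l ≤ m ∧ IsPresentationMatrix P M := by
  -- At least `l + 1` generators give `l < n`, and at least `n` relations give `n - l ≤ m`;
  -- superfluous ones are harmless.
  obtain ⟨n, π, hn, hπ⟩ := exists_surjective_of_fin (R := R) M (l + 1)
  obtain ⟨m, g, hm, hg⟩ := exists_surjective_of_fin (R := R) (LinearMap.ker π) n
  have hP : (LinearMap.toMatrixRight' ((LinearMap.ker π).subtype ∘ₗ g)).vecMulLinear =
      (LinearMap.ker π).subtype ∘ₗ g :=
    LinearMap.toMatrixRight'.symm_apply_apply _
  refine ⟨m, n, LinearMap.toMatrixRight' ((LinearMap.ker π).subtype ∘ₗ g), hn, by omega, π, ?_, hπ⟩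
  rw [hP, LinearMap.exact_iff, LinearMap.range_comp, LinearMap.range_eq_top.2 hg,
    Submodule.map_top, Submodule.range_subtype]

end Presentations

/-! ### Localization at principal primes -/

section Localization

variable {R : Type*} [CommRing R] (S : Submonoid R)

lemma IsPresentationMatrix.localizedModule {M : Type*} [AddCommGroup M] [Module R M] {m n : ℕ}
    {P : Matrix (Fin m) (Fin n) R} (h : IsPresentationMatrix P M) :
    IsPresentationMatrix (P.map (algebraMap R (Localization S))) (LocalizedModule S M) := by
  obtain ⟨π, hex, hsurj⟩ := h
  let loc : ∀ n, (Fin n → R) →ₗ[R] (Fin n → Localization S) := fun n ↦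
    LinearMap.pi fun i ↦ (Algebra.linearMap R (Localization S)) ∘ₗ LinearMap.proj i
  have hloc : ∀ n, IsLocalizedModule S (loc n) := fun n ↦ inferInstance
  have h1 : IsLocalizedModule.map S (loc m) (loc n) P.vecMulLinear =
      (P.map (algebraMap R (Localization S))).vecMulLinear.restrictScalars R := by
    refine IsLocalizedModule.ext S (loc m) (IsLocalizedModule.map_units (loc n)) ?_
    ext i k
    have h0 : loc m (Pi.single i 1) = Pi.single i 1 := by
      ext k
      by_cases hk : k = i
      · subst hk; simp [loc]
      · simp [loc, hk]
    have h1 := IsLocalizedModule.map_apply S (loc m) (loc n) P.vecMulLinear (Pi.single i 1)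
    rw [h0] at h1
    simp [h0, h1]
    simp [loc]
  have h2 := IsLocalizedModule.map_exact S (loc m) (loc n) (LocalizedModule.mkLinearMap S M) _ _ hex
  rw [h1] at h2
  exact ⟨(IsLocalizedModule.map S (loc n) (LocalizedModule.mkLinearMap S M)
    π).extendScalarsOfIsLocalization S _, h2,
    IsLocalizedModule.map_surjective S (loc n) (LocalizedModule.mkLinearMap S M) π hsurj⟩

/-- Over a principal localization, a finite module is the direct sum of its torsion submodule and
of a free module. -/
lemma LocalizedModule.exists_equiv_torsion_prod [IsDomain R] (hS : S ≤ nonZeroDivisors R)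
    [IsDomain (Localization S)] [IsPrincipalIdealRing (Localization S)] {M : Type*}
    [AddCommGroup M] [Module R M] [Module.Finite R M] {l : ℕ} (hl : Module.rank R M = l) :
    Nonempty (LocalizedModule S M ≃ₗ[Localization S]
      LocalizedModule S (Submodule.torsion R M) × (Fin l → Localization S)) := by
  let T := Submodule.torsion R M
  let V := Localization S
  -- The quotient by the torsion is torsion-free, and finitely generated torsion-free modules over a
  -- principal ideal domain are free.
  have hfree : Module.Free V (LocalizedModule S (M ⧸ T)) := inferInstance
  have hrank : Module.finrank V (LocalizedModule S (M ⧸ T)) = l := by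
    have h0 : Module.rank R T = 0 :=
      Module.rank_eq_zero_iff_isTorsion.2 Submodule.torsion_isTorsion
    rw [IsLocalization.finrank_eq V S hS,
      IsLocalizedModule.finrank_eq S (LocalizedModule.mkLinearMap S (M ⧸ T)) hS]
    refine Module.finrank_eq_of_rank_eq ?_
    rw [← hl, ← rank_quotient_add_rank_of_isDomain T, h0, add_zero]
  have e1 : LocalizedModule S (M ⧸ T) ≃ₗ[V] (Fin l → V) :=
    LinearEquiv.ofFinrankEq _ _ (by rw [hrank]; simp)
  let g : LocalizedModule S M →ₗ[V] LocalizedModule S (M ⧸ T) := LocalizedModule.map S T.mkQ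
  have hg : Function.Surjective g := LocalizedModule.map_surjective S _ T.mkQ_surjective
  let f : LocalizedModule S T →ₗ[V] LocalizedModule S M := LocalizedModule.map S T.subtype
  have hf : Function.Injective f := LocalizedModule.map_injective S _ T.injective_subtype
  have hfg : Function.Exact f g := LocalizedModule.map_exact S _ _ (LinearMap.exact_subtype_mkQ T)
  obtain ⟨s, hs⟩ := Module.projective_lifting_property g LinearMap.id hg
  exact ⟨(hfg.splitSurjectiveEquiv hf ⟨s, hs⟩).1.trans ((LinearEquiv.refl V _).prodCongr e1)⟩

end Localization

/-- After cancelling the common factor, an irreducible factor `p` of the rest of `a` would have to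
divide the denominator allowed at `(p)`, being prime to the rest of `x`. -/
lemma dvd_of_forall_localization {R : Type*} [CommRing R] [IsDomain R]
    [UniqueFactorizationMonoid R] {a x : R}
    (h : ∀ (p : Ideal R) [p.IsPrime], p.IsPrincipal →
      algebraMap R (Localization.AtPrime p) a ∣ algebraMap R (Localization.AtPrime p) x) :
    a ∣ x := by
  have h' : ∀ (p : R), (Ideal.span {p}).IsPrime → ∃ s, ¬ p ∣ s ∧ a ∣ s * x := by
    intro p hp
    obtain ⟨c, hc⟩ := h (Ideal.span {p}) ⟨p, rfl⟩
    obtain ⟨⟨r, s⟩, hrs⟩ := IsLocalization.surj (Ideal.span {p}).primeCompl c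
    refine ⟨s, fun hs ↦ s.2 (Ideal.mem_span_singleton.2 hs), r, ?_⟩
    refine IsLocalization.injective (Localization.AtPrime (Ideal.span {p}))
      (Ideal.primeCompl_le_nonZeroDivisors (Ideal.span {p})) ?_
    rw [map_mul, map_mul, hc, ← hrs]
    ring
  by_cases ha : a = 0
  -- The zero ideal is a principal prime too, and it settles the case `a = 0`.
  · obtain ⟨s, hs, hs'⟩ := h' 0 (by simpa using Ideal.isPrime_bot)
    subst ha
    rw [zero_dvd_iff] at hs hs' ⊢
    exact (mul_eq_zero.1 hs').resolve_left hs
  · obtain ⟨a', x', c, hrel, rfl, rfl⟩ := UniqueFactorizationMonoid.exists_reduced_factors a ha x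
    by_cases hu : IsUnit a'
    · exact mul_dvd_mul_left c hu.dvd
    · obtain ⟨p, hp, hpa⟩ := WfDvdMonoid.exists_irreducible_factor hu (by rintro rfl; simp at ha)
      have hp := hp.prime
      obtain ⟨s, hs, hs'⟩ := h' p ((Ideal.span_singleton_prime hp.ne_zero).2 hp)
      have hc : c ≠ 0 := left_ne_zero_of_mul ha
      rw [mul_left_comm, mul_dvd_mul_iff_left hc] at hs'
      exact (hs (hpa.trans (hrel.dvd_of_dvd_mul_right hs'))).elim

/-- A Noetherian local domain with principal maximal ideal is a principal ideal ring. -/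
lemma Localization.AtPrime.isPrincipalIdealRing {R : Type*} [CommRing R] [IsDomain R]
    [IsNoetherianRing R] (p : Ideal R) [p.IsPrime] (hp : p.IsPrincipal) :
    IsPrincipalIdealRing (Localization.AtPrime p) := by
  have h1 : IsNoetherianRing (Localization.AtPrime p) :=
    IsLocalization.isNoetherianRing p.primeCompl _ inferInstance
  have h2 : IsDomain (Localization.AtPrime p) :=
    IsLocalization.isDomain_localization p.primeCompl_le_nonZeroDivisors
  refine ((tfae_of_isNoetherianRing_of_isLocalRing_of_isDomain (Localization.AtPrime p)).out
    4 0).1 ?_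
  rw [← Localization.AtPrime.map_eq_maximalIdeal]
  obtain ⟨a, rfl⟩ := hp
  exact ⟨algebraMap R _ a, (Ideal.map_span _ {a}).trans (by rw [Set.image_singleton])⟩

/-! ### Alexander polynomials of a module and of its torsion -/

section Comparison

variable {R : Type*} [CommRing R]

lemma IsMinor.map {R' : Type*} [CommRing R'] (f : R →+* R') {m n j : ℕ}
    {P : Matrix (Fin m) (Fin n) R} {d : R} (h : IsMinor P j d) : IsMinor (P.map f) j (f d) := by
  obtain ⟨r, c, rfl⟩ := h
  exact ⟨r, c, by rw [RingHom.map_det]; rfl⟩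

lemma dvd_minors_iff_localization [IsDomain R] [UniqueFactorizationMonoid R] {m n : ℕ}
    (P : Matrix (Fin m) (Fin n) R) (j : ℕ) (a : R) :
    (∀ d, IsMinor P j d → a ∣ d) ↔ ∀ (p : Ideal R) [p.IsPrime], p.IsPrincipal →
      ∀ d, IsMinor (P.map (algebraMap R (Localization.AtPrime p))) j d →
        algebraMap R (Localization.AtPrime p) a ∣ d := by
  constructor
  · rintro h p _ - _ ⟨r, c, rfl⟩
    have h1 := map_dvd (algebraMap R (Localization.AtPrime p)) (h _ ⟨r, c, rfl⟩)
    rwa [RingHom.map_det] at h1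
  · exact fun h d hd ↦ dvd_of_forall_localization fun p _ hp ↦ h p hp _ (hd.map _)

lemma IsPresentationMatrix.span_minors_eq_of_equiv_prod {M T : Type*} [AddCommGroup M]
    [Module R M] [AddCommGroup T] [Module R T] {m n m' n' l : ℕ} {P : Matrix (Fin m) (Fin n) R}
    {Q : Matrix (Fin m') (Fin n') R} (hP : IsPresentationMatrix P M)
    (hQ : IsPresentationMatrix Q T) (e : M ≃ₗ[R] T × (Fin l → R)) (hl : l ≤ n) :
    Ideal.span {d | IsMinor P (n - l) d} = Ideal.span {d | IsMinor Q n' d} := by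
  obtain ⟨π, hπ, hπ'⟩ := hP
  obtain ⟨θ, hθ, hθ'⟩ := hQ
  rw [span_minors_eq, span_minors_eq, ← hπ.linearMap_ker_eq, ← hθ.linearMap_ker_eq]
  exact minorIdeal_ker_eq_of_equiv_prod π θ hπ' hθ' e (Nat.sub_add_cancel hl)

/-- The common divisors of the minors that define the Alexander polynomial `Δ_l` of a module of
rank `l` are those of the minors that define the Alexander polynomial `Δ_0` of its torsion. -/
lemma IsPresentationMatrix.dvd_minors_iff_torsion [IsDomain R] [IsNoetherianRing R]
    [UniqueFactorizationMonoid R] {M : Type*} [AddCommGroup M] [Module R M] [Module.Finite R M]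
    {m n m' n' l : ℕ} (hrank : Module.rank R M = l) {P : Matrix (Fin m) (Fin n) R}
    {Q : Matrix (Fin m') (Fin n') R} (hP : IsPresentationMatrix P M)
    (hQ : IsPresentationMatrix Q (Submodule.torsion R M)) (hl : l ≤ n) (a : R) :
    (∀ d, IsMinor P (n - l) d → a ∣ d) ↔ ∀ d, IsMinor Q n' d → a ∣ d := by
  rw [dvd_minors_iff_localization P, dvd_minors_iff_localization Q]
  refine forall_congr' fun p ↦ forall_congr' fun _ ↦ forall_congr' fun hp ↦ ?_
  have h1 : IsDomain (Localization.AtPrime p) :=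
    IsLocalization.isDomain_localization p.primeCompl_le_nonZeroDivisors
  have h2 : IsPrincipalIdealRing (Localization.AtPrime p) :=
    Localization.AtPrime.isPrincipalIdealRing p hp
  obtain ⟨e⟩ := LocalizedModule.exists_equiv_torsion_prod p.primeCompl
    p.primeCompl_le_nonZeroDivisors hrank
  have h3 := (hP.localizedModule p.primeCompl).span_minors_eq_of_equiv_prod
    (hQ.localizedModule p.primeCompl) e hl
  rw [dvd_minors_iff, dvd_minors_iff, ← span_minors_eq, ← span_minors_eq]
  exact forall_congr' fun d ↦ by rw [h3]

/-- An annihilator of a module has a power in the ideal of maximal minors. -/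
lemma IsPresentationMatrix.dvd_pow_of_annihilator {T : Type*} [AddCommGroup T] [Module R T]
    {m n : ℕ} {Q : Matrix (Fin m) (Fin n) R} (hQ : IsPresentationMatrix Q T) {a s : R}
    (ha : ∀ d, IsMinor Q n d → a ∣ d) (hs : ∀ t : T, s • t = 0) : a ∣ s ^ n := by
  obtain ⟨π, hπ, -⟩ := hQ
  refine (dvd_minors_iff Q n a).1 ha _ ?_
  -- The vectors `s • e_i` are relations, and their matrix is `s` times the identity.
  have h1 : formDet (fun i : Fin n ↦ s • (Pi.single i 1 : Fin n → R))
      (fun b ↦ LinearMap.proj b) = s ^ n := by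
    have h2 : (Matrix.of fun i b : Fin n ↦ (LinearMap.proj b : Module.Dual R (Fin n → R))
        (s • (Pi.single i 1 : Fin n → R))) = Matrix.diagonal fun _ ↦ s := by
      ext i b
      by_cases hib : i = b
      · subst hib; simp
      · simp [hib, Ne.symm hib]
    rw [formDet, h2, Matrix.det_diagonal]
    simp
  rw [← h1, ← hπ.linearMap_ker_eq]
  exact formDet_mem_minorIdeal _ fun i ↦ by simp [hs]

lemma exists_gcd_minors [IsDomain R] [UniqueFactorizationMonoid R] {m n : ℕ}
    (P : Matrix (Fin m) (Fin n) R) (j : ℕ) : ∃ A : R, (∀ d, IsMinor P j d → A ∣ d) ∧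
      ∀ e : R, (∀ d, IsMinor P j d → e ∣ d) → e ∣ A := by
  classical
  let _ : NormalizedGCDMonoid R := Classical.choice inferInstance
  have hfin : {d | IsMinor P j d}.Finite := by
    refine (Set.finite_range fun rc : (Fin j ↪o Fin m) × (Fin j ↪o Fin n) ↦
      (P.submatrix rc.1 rc.2).det).subset ?_
    rintro _ ⟨r, c, rfl⟩
    exact ⟨(r, c), rfl⟩
  refine ⟨hfin.toFinset.gcd id, fun d hd ↦ Finset.gcd_dvd (f := id) (hfin.mem_toFinset.2 hd),
    fun e he ↦ Finset.dvd_gcd fun d hd ↦ he d (hfin.mem_toFinset.1 hd)⟩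

end Comparison

section AlexanderComparison

variable {R : Type*} [CommRing R] [IsDomain R] [IsNoetherianRing R] [UniqueFactorizationMonoid R]
  {M : Type*} [AddCommGroup M] [Module R M] [Module.Finite R M] {l : ℕ}

variable (M) in
lemma exists_isAlexanderPolynomial (l : ℕ) : ∃ A : R, IsAlexanderPolynomial l M A := by
  obtain ⟨m, n, P, hn, hm, hP⟩ := exists_isPresentationMatrix (R := R) M l
  obtain ⟨A, hA, hA'⟩ := exists_gcd_minors P (n - l)
  exact ⟨A, m, n, P, hn, hm, hP, hA, hA'⟩

/-- The common divisors of the minors agree for any two presentations of the module and of its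
torsion, so the greatest common divisor can be carried to a freely chosen presentation of the other
module. -/
lemma isAlexanderPolynomial_iff_torsion (hrank : Module.rank R M = l) (A : R) :
    IsAlexanderPolynomial l M A ↔ IsAlexanderPolynomial 0 (Submodule.torsion R M) A := by
  constructor
  · rintro ⟨m, n, P, hn, -, hP, hA, hA'⟩
    obtain ⟨m', n', Q, hn', hm', hQ⟩ :=
      exists_isPresentationMatrix (R := R) (Submodule.torsion R M) 0
    have h := hP.dvd_minors_iff_torsion hrank hQ hn.le
    exact ⟨m', n', Q, hn', hm', hQ, (h A).1 hA, fun e he ↦ hA' e ((h e).2 he)⟩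
  · rintro ⟨m', n', Q, -, -, hQ, hA, hA'⟩
    obtain ⟨m, n, P, hn, hm, hP⟩ := exists_isPresentationMatrix (R := R) M l
    have h := hP.dvd_minors_iff_torsion hrank hQ hn.le
    exact ⟨m, n, P, hn, hm, hP, (h A).2 hA, fun e he ↦ hA' e ((h e).1 he)⟩

end AlexanderComparison

theorem lemma5p3 {X : Type*} [TopologicalSpace X] [T2Space X] [ConnectedSpace X]
    [CWComplex (Set.univ : Set X)] [CWComplex.Finite (Set.univ : Set X)]
    (X₀ : CWComplex.Subcomplex (Set.univ : Set X))
    (x₀ : X) (μ : ℕ) (γ : FundamentalGroup X x₀ →* Multiplicative (Fin μ → ℤ))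
    (hγ : Function.Surjective γ) (k l : ℕ)
    (hZ : Nonempty (IntegralHomology x₀ (X₀ : Set X) k ≃ₗ[ℤ] (Fin l → ℤ)))
    (hΛ : Module.rank (LaurentRing μ) (LaurentHomology γ (X₀ : Set X) k) = l) :
    (∃ A : LaurentRing μ, IsAlexanderPolynomial l (LaurentHomology γ (X₀ : Set X) k) A) ∧
    (∀ A : LaurentRing μ,
      IsAlexanderPolynomial l (LaurentHomology γ (X₀ : Set X) k) A ↔
        IsAlexanderPolynomial 0
          (Submodule.torsion (LaurentRing μ) (LaurentHomology γ (X₀ : Set X) k)) A) ∧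
    ∀ A : LaurentRing μ, IsAlexanderPolynomial l (LaurentHomology γ (X₀ : Set X) k) A →
      |LaurentRing.evalOne μ A| = 1 := by
  have hfin : Module.Finite (LaurentRing μ) (LaurentHomology γ (X₀ : Set X) k) :=
    localHomology_finite_of_subcomplex X₀ _ k
  have hiff := isAlexanderPolynomial_iff_torsion hΛ
  refine ⟨exists_isAlexanderPolynomial _ l, hiff, fun A hA ↦ ?_⟩
  obtain ⟨s, hs, hs0⟩ := (laurentHomology_rank_le_and_annihilator X₀ x₀ k l hZ μ γ).2 hΛ
  obtain ⟨m, n, Q, -, -, hQ, hAQ, -⟩ := (hiff A).1 hA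
  -- `A` divides a power of `s`; evaluation at `(1, …, 1)` turns this into a divisor of `1` in `ℤ`.
  have hdvd := map_dvd (LaurentRing.evalOne μ)
    (hQ.dvd_pow_of_annihilator hAQ fun t ↦ Subtype.ext (hs0 t t.2))
  rw [map_pow, hs, one_pow] at hdvd
  exact Int.isUnit_iff_abs_eq.1 (isUnit_of_dvd_one hdvd)
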